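/- **Setting.** The finite types are generated from the type $0$ of natural numbers by $\rho,\tau\mapsto\rho\to\tau$; write $1$ for $0\to0$. Terms are built by typed application from variables of all finite types and the constants $0$, $S$, $+$, $\cdot$, the combinators $\Pi_{\rho,\tau}$ and $\Sigma_{\delta,\rho,\tau}$, and the recursors $R_\sigma$ of type $0\to\sigma\to(\sigma\to0\to\sigma)\to\sigma$, for all finite types. Formulas are built from $\bot$ and equations $s=_0t$ between terms of type $0$ by $\land,\lor,\to$ and quantifiers over all finite types ($\lnot A$ is $A\to\bot$); for $\sigma=\rho_1\to\dots\to\rho_k\to0$, $s=_\sigma t$ abbreviates $\forall y_1^{\rho_1}\cdots\forall y_k^{\rho_k}\,(s\,y_1\cdots y_k=_0t\,y_1\cdots y_k)$. $\mathsf{E}\text{-}\mathsf{HA}^\omega$ is the theory over intuitionistic predicate logic whose axioms are the equality axioms for $=_0$; the usual axioms for $0,S,+,\cdot$; extensionality $x=_\rho y\to z(x)=_\tau z(y)$; the equations $\Pi xy=x$, $\Sigma xyz=xz(yz)$, $R_\sigma0yz=y$, $R_\sigma(Sn)yz=z(R_\sigma nyz)n$; and induction $A(0)\to(\forall n(A(n)\to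 A(n+1))\to\forall n\,A(n))$ for all formulas $A$. $\mathsf{E}\text{-}\mathsf{HA}^2$ is its restriction to the formulas in which all variables have type $0$ or $1$ and the only recursor is $R_0$; here $x,y,z,n$ in the axioms stand for arbitrary terms of the restricted language, and an asserted equation $s=_\tau t$ of higher type stands for all equations $s\,u_1\cdots u_k=_0t\,u_1\cdots u_k$ with terms $u_i$ of the restricted language. $\mathsf{QF}\text{-}\mathsf{AC}^{\rho,\tau}$ is the scheme $\forall x^\rho\exists y^\tau A_0(x,y)\to\exists Y^{\rho\to\tau}\forall x^\rho A_0(x,Y(x))$ for quantifier-free $A_0$, possibly with parameters. $\mathsf{RCA}^\omega$ is $\mathsf{E}\text{-}\mathsf{HA}^\omega$ plus $\mathsf{QF}\text{-}\mathsf{AC}^{1,0}$ and the law of the excluded middle. $\mathsf{RCA}$ is $\mathsf{E}\text{-}\mathsf{HA}^2$ plus $\mathsf{QF}\text{-}\mathsf{AC}^{0,0}$ and the law of the excluded middle, all schemes restricted to the language $\mathcal L(\mathsf{RCA})$ of $\mathsf{E}\text{-}\mathsf{HA}^2$. **Theorem.** For each sentence $\Phi$ in $\mathcal L(\mathsf{RCA})$,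 if $\mathsf{RCA}^\omega\vdash\Phi$ then $\mathsf{RCA}\vdash\Phi$. -/

import Mathlib

namespace FiniteType

/-- The finite types: `nat` is the type `0` of natural numbers, `ρ ⇾ τ` is the type of functions
from objects of type `ρ` to objects of type `τ`. -/
inductive Ty : Type
  | nat : Ty
  | arr : Ty → Ty → Ty

infixr:60 " ⇾ " => Ty.arr

/-- The type `1`, that is `0 → 0`. -/
abbrev Ty.one : Ty := Ty.nat ⇾ Ty.nat

/-- A language fragment: which types variables (free or bound) may have, and for which types `σ`
the recursor constant `R_σ` is available. -/
structure Fragment where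
  varTy : Ty → Prop
  recTy : Ty → Prop
  nat_mem : varTy Ty.nat

/-- All finite types: variables of every type and recursors of every type. -/
def Fragment.omega : Fragment where
  varTy _ := True
  recTy _ := True
  nat_mem := trivial

/-- The second order restriction: variables of types `0` and `1` only, and only the recursor
of type `0`. -/
def Fragment.second : Fragment where
  varTy σ := σ = Ty.nat ∨ σ = Ty.one
  recTy σ := σ = Ty.nat
  nat_mem := Or.inl rfl

/-- A variable context; the head of the list is the innermost variable (de Bruijn index `0`). -/
abbrev Ctx : Type := List Ty

/-- `Var Γ σ`: the variables of type `σ` in the context `Γ`. -/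
inductive Var : Ctx → Ty → Type
  | zero {Γ : Ctx} {σ : Ty} : Var (σ :: Γ) σ
  | succ {Γ : Ctx} {σ τ : Ty} (x : Var Γ σ) : Var (τ :: Γ) σ

/-- Typed terms: variables, the constants `0`, `S`, `+`, `·`, the projection combinators
`Π_{ρ,τ}` (`proj`), the substitution combinators `Σ_{δ,ρ,τ}` (`comb`), the recursors `R_σ`,
and application. -/
inductive Term (L : Fragment) (Γ : Ctx) : Ty → Type
  | var {σ : Ty} (h : L.varTy σ) (x : Var Γ σ) : Term L Γ σ
  | zero : Term L Γ Ty.nat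
  | succ : Term L Γ (Ty.nat ⇾ Ty.nat)
  | add : Term L Γ (Ty.nat ⇾ Ty.nat ⇾ Ty.nat)
  | mul : Term L Γ (Ty.nat ⇾ Ty.nat ⇾ Ty.nat)
  | proj (ρ τ : Ty) : Term L Γ (ρ ⇾ τ ⇾ ρ)
  | comb (δ ρ τ : Ty) : Term L Γ ((δ ⇾ ρ ⇾ τ) ⇾ (δ ⇾ ρ) ⇾ δ ⇾ τ)
  | recursor (σ : Ty) (h : L.recTy σ) : Term L Γ (Ty.nat ⇾ σ ⇾ (σ ⇾ Ty.nat ⇾ σ) ⇾ σ)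
  | app {σ τ : Ty} (s : Term L Γ (σ ⇾ τ)) (t : Term L Γ σ) : Term L Γ τ

/-- Formulas; the only primitive relation is equality between terms of type `0`. -/
inductive Formula (L : Fragment) : Ctx → Type
  | eq {Γ : Ctx} (s t : Term L Γ Ty.nat) : Formula L Γ
  | bot {Γ : Ctx} : Formula L Γ
  | and {Γ : Ctx} (A B : Formula L Γ) : Formula L Γ
  | or {Γ : Ctx} (A B : Formula L Γ) : Formula L Γ
  | imp {Γ : Ctx} (A B : Formula L Γ) : Formula L Γ
  | all {Γ : Ctx} (σ : Ty) (h : L.varTy σ) (A : Formula L (σ :: Γ)) : Formula L Γ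
  | ex {Γ : Ctx} (σ : Ty) (h : L.varTy σ) (A : Formula L (σ :: Γ)) : Formula L Γ

infix:50 " ≐ " => Formula.eq
infixr:30 " ⇒ " => Formula.imp

/-- Negation `¬A` is an abbreviation for `A → ⊥`. -/
abbrev Formula.neg {L : Fragment} {Γ : Ctx} (A : Formula L Γ) : Formula L Γ := A ⇒ Formula.bot

/-- Sentences are formulas without free variables. -/
abbrev Sentence (L : Fragment) : Type := Formula L []

/-! ### Renaming and substitution -/

/-- A renaming of variables. -/
abbrev Ren (Γ Δ : Ctx) : Type := ∀ ⦃σ : Ty⦄, Var Γ σ → Var Δ σ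

/-- A simultaneous substitution of terms for the variables of `Γ`. -/
abbrev Sub (L : Fragment) (Γ Δ : Ctx) : Type := ∀ ⦃σ : Ty⦄, L.varTy σ → Var Γ σ → Term L Δ σ

def Ren.lift {Γ Δ : Ctx} {ρ : Ty} (r : Ren Γ Δ) : Ren (ρ :: Γ) (ρ :: Δ)
  | _, Var.zero => Var.zero
  | _, Var.succ x => Var.succ (r x)

def Term.rename {L : Fragment} {Γ Δ : Ctx} (r : Ren Γ Δ) : {σ : Ty} → Term L Γ σ → Term L Δ σ
  | _, .var h x => .var h (r x)
  | _, .zero => .zero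
  | _, .succ => .succ
  | _, .add => .add
  | _, .mul => .mul
  | _, .proj ρ τ => .proj ρ τ
  | _, .comb δ ρ τ => .comb δ ρ τ
  | _, .recursor σ h => .recursor σ h
  | _, .app s t => .app (s.rename r) (t.rename r)

/-- Weakening of a term by one fresh variable. -/
abbrev Term.shift {L : Fragment} {Γ : Ctx} {ρ σ : Ty} (t : Term L Γ σ) : Term L (ρ :: Γ) σ :=
  t.rename (fun _ x => Var.succ x)

def Sub.lift {L : Fragment} {Γ Δ : Ctx} {ρ : Ty} (s : Sub L Γ Δ) : Sub L (ρ :: Γ) (ρ :: Δ)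
  | _, h, Var.zero => .var h Var.zero
  | _, h, Var.succ x => (s h x).shift

def Term.subst {L : Fragment} {Γ Δ : Ctx} (s : Sub L Γ Δ) : {σ : Ty} → Term L Γ σ → Term L Δ σ
  | _, .var h x => s h x
  | _, .zero => .zero
  | _, .succ => .succ
  | _, .add => .add
  | _, .mul => .mul
  | _, .proj ρ τ => .proj ρ τ
  | _, .comb δ ρ τ => .comb δ ρ τ
  | _, .recursor σ h => .recursor σ h
  | _, .app t u => .app (t.subst s) (u.subst s)

def Formula.rename {L : Fragment} : {Γ Δ : Ctx} → Ren Γ Δ → Formula L Γ → Formula L Δ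
  | _, _, r, .eq s t => .eq (s.rename r) (t.rename r)
  | _, _, _, .bot => .bot
  | _, _, r, .and A B => .and (A.rename r) (B.rename r)
  | _, _, r, .or A B => .or (A.rename r) (B.rename r)
  | _, _, r, .imp A B => .imp (A.rename r) (B.rename r)
  | _, _, r, .all σ h A => .all σ h (A.rename r.lift)
  | _, _, r, .ex σ h A => .ex σ h (A.rename r.lift)

/-- Weakening of a formula by one fresh variable. -/
abbrev Formula.shift {L : Fragment} {Γ : Ctx} {ρ : Ty} (A : Formula L Γ) : Formula L (ρ :: Γ) :=
  A.rename (fun _ x => Var.succ x)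

def Formula.subst {L : Fragment} : {Γ Δ : Ctx} → Sub L Γ Δ → Formula L Γ → Formula L Δ
  | _, _, s, .eq t u => .eq (t.subst s) (u.subst s)
  | _, _, _, .bot => .bot
  | _, _, s, .and A B => .and (A.subst s) (B.subst s)
  | _, _, s, .or A B => .or (A.subst s) (B.subst s)
  | _, _, s, .imp A B => .imp (A.subst s) (B.subst s)
  | _, _, s, .all σ h A => .all σ h (A.subst s.lift)
  | _, _, s, .ex σ h A => .ex σ h (A.subst s.lift)

/-- The substitution of `t` for the innermost variable. -/
def Sub.single {L : Fragment} {Γ : Ctx} {ρ : Ty} (t : Term L Γ ρ) : Sub L (ρ :: Γ) Γ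
  | _, _, Var.zero => t
  | _, h, Var.succ x => .var h x

/-- `A(t)`, for a formula `A` with a distinguished innermost variable. -/
abbrev Formula.inst {L : Fragment} {Γ : Ctx} {ρ : Ty} (A : Formula L (ρ :: Γ)) (t : Term L Γ ρ) :
    Formula L Γ :=
  A.subst (Sub.single t)

/-! ### Intuitionistic predicate calculus -/

/-- Intuitionistic natural deduction in all the sorts of `L`, from a set `T` of (possibly open)
axioms. `Derives T H A` says that `A` is derivable from the finitely many hypotheses `H`. -/
inductive Derives {L : Fragment} (T : ∀ Γ : Ctx, Set (Formula L Γ)) :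
    {Γ : Ctx} → List (Formula L Γ) → Formula L Γ → Prop
  | ax {Γ : Ctx} {H : List (Formula L Γ)} {A : Formula L Γ} : A ∈ T Γ → Derives T H A
  | hyp {Γ : Ctx} {H : List (Formula L Γ)} {A : Formula L Γ} : A ∈ H → Derives T H A
  | botE {Γ : Ctx} {H : List (Formula L Γ)} {A : Formula L Γ} :
      Derives T H .bot → Derives T H A
  | andI {Γ : Ctx} {H : List (Formula L Γ)} {A B : Formula L Γ} :
      Derives T H A → Derives T H B → Derives T H (.and A B)
  | andE₁ {Γ : Ctx} {H : List (Formula L Γ)} {A B : Formula L Γ} :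
      Derives T H (.and A B) → Derives T H A
  | andE₂ {Γ : Ctx} {H : List (Formula L Γ)} {A B : Formula L Γ} :
      Derives T H (.and A B) → Derives T H B
  | orI₁ {Γ : Ctx} {H : List (Formula L Γ)} {A B : Formula L Γ} :
      Derives T H A → Derives T H (.or A B)
  | orI₂ {Γ : Ctx} {H : List (Formula L Γ)} {A B : Formula L Γ} :
      Derives T H B → Derives T H (.or A B)
  | orE {Γ : Ctx} {H : List (Formula L Γ)} {A B C : Formula L Γ} :
      Derives T H (.or A B) → Derives T (A :: H) C → Derives T (B :: H) C → Derives T H C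
  | impI {Γ : Ctx} {H : List (Formula L Γ)} {A B : Formula L Γ} :
      Derives T (A :: H) B → Derives T H (A ⇒ B)
  | impE {Γ : Ctx} {H : List (Formula L Γ)} {A B : Formula L Γ} :
      Derives T H (A ⇒ B) → Derives T H A → Derives T H B
  | allI {Γ : Ctx} {H : List (Formula L Γ)} {σ : Ty} {h : L.varTy σ} {A : Formula L (σ :: Γ)} :
      Derives T (H.map Formula.shift) A → Derives T H (.all σ h A)
  | allE {Γ : Ctx} {H : List (Formula L Γ)} {σ : Ty} {h : L.varTy σ} {A : Formula L (σ :: Γ)}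
      (t : Term L Γ σ) : Derives T H (.all σ h A) → Derives T H (A.inst t)
  | exI {Γ : Ctx} {H : List (Formula L Γ)} {σ : Ty} {h : L.varTy σ} {A : Formula L (σ :: Γ)}
      (t : Term L Γ σ) : Derives T H (A.inst t) → Derives T H (.ex σ h A)
  | exE {Γ : Ctx} {H : List (Formula L Γ)} {σ : Ty} {h : L.varTy σ} {A : Formula L (σ :: Γ)}
      {B : Formula L Γ} :
      Derives T H (.ex σ h A) → Derives T (A :: H.map Formula.shift) B.shift → Derives T H B

/-! ### Higher type equations -/

/-- All argument types of `σ = ρ₁ → ⋯ → ρₖ → 0` are types of variables of `L`; exactly then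
the formula `s =_σ t` can be written in the fragment `L`. -/
def Ty.ArgsIn (L : Fragment) : Ty → Prop
  | .nat => True
  | .arr ρ τ => L.varTy ρ ∧ Ty.ArgsIn L τ

/-- The formula `s =_σ t`: pointwise equality,
`∀ y₁ ⋯ yₖ, s y₁ ⋯ yₖ =₀ t y₁ ⋯ yₖ`. -/
def Formula.eqAt {L : Fragment} :
    {Γ : Ctx} → (σ : Ty) → Ty.ArgsIn L σ → Term L Γ σ → Term L Γ σ → Formula L Γ
  | _, .nat, _, s, t => s ≐ t
  | _, .arr ρ τ, h, s, t =>
      .all ρ h.1 (Formula.eqAt τ h.2 (.app s.shift (.var h.1 .zero)) (.app t.shift (.var h.1 .zero)))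

/-- A list of argument terms to which a term of type `σ` can be applied to yield type `0`. -/
inductive Spine (L : Fragment) (Γ : Ctx) : Ty → Type
  | nil : Spine L Γ Ty.nat
  | cons {ρ τ : Ty} (t : Term L Γ ρ) (u : Spine L Γ τ) : Spine L Γ (ρ ⇾ τ)

/-- `t u₁ ⋯ uₖ`, of type `0`. -/
def Term.apps {L : Fragment} {Γ : Ctx} : {σ : Ty} → Term L Γ σ → Spine L Γ σ → Term L Γ Ty.nat
  | _, t, .nil => t
  | _, t, .cons a u => Term.apps (.app t a) u

/-! ### Arithmetic in finite types -/

section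
variable {L : Fragment} {Γ : Ctx}

/-- The term `S t`. -/
abbrev Term.s (t : Term L Γ Ty.nat) : Term L Γ Ty.nat := .app .succ t

/-- The term `s + t`. -/
abbrev Term.plus (s t : Term L Γ Ty.nat) : Term L Γ Ty.nat := .app (.app .add s) t

/-- The term `s · t`. -/
abbrev Term.times (s t : Term L Γ Ty.nat) : Term L Γ Ty.nat := .app (.app .mul s) t

/-- The term `R_σ n y z`. -/
abbrev Term.recAt {σ : Ty} (h : L.recTy σ) (n : Term L Γ Ty.nat) (y : Term L Γ σ)
    (z : Term L Γ (σ ⇾ Ty.nat ⇾ σ)) : Term L Γ σ :=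
  .app (.app (.app (.recursor σ h) n) y) z

/-- The substitution that replaces the innermost variable `n` by `S n`. -/
def Sub.step : Sub L (Ty.nat :: Γ) (Ty.nat :: Γ)
  | _, h, Var.zero => .app .succ (.var h Var.zero)
  | _, h, Var.succ x => .var h (Var.succ x)

/-- For `A(x, y)` in the context `y, x, Γ`: the substitution of `Y x` for `y`, with values in the
context `x, Y, Γ`. -/
def Sub.choice {ρ τ : Ty} (hρ : L.varTy ρ) (hY : L.varTy (ρ ⇾ τ)) :
    Sub L (τ :: ρ :: Γ) (ρ :: (ρ ⇾ τ) :: Γ)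
  | _, _, Var.zero => .app (.var hY (Var.succ Var.zero)) (.var hρ Var.zero)
  | _, h, Var.succ Var.zero => .var h Var.zero
  | _, h, Var.succ (Var.succ x) => .var h (Var.succ (Var.succ x))

end

/-- The non-logical axioms of extensional arithmetic with full induction in the fragment `L`.
Axioms are open, the letters in them ranging over all terms and formulas of the fragment.
An equation `s =_τ t` that is asserted (the defining equations of `Π`, `Σ`, `R_σ` and the
conclusion of the extensionality scheme) is given by all its instances `s u₁ ⋯ uₖ =₀ t u₁ ⋯ uₖ`,
so that it makes sense also when the variables needed to write `s =_τ t` are not available;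
when they are, this amounts to the same as asserting the formula `s =_τ t`. -/
inductive EHA (L : Fragment) : (Γ : Ctx) → Formula L Γ → Prop
  | eq_refl {Γ : Ctx} (t : Term L Γ .nat) : EHA L Γ (t ≐ t)
  | eq_symm {Γ : Ctx} (s t : Term L Γ .nat) : EHA L Γ (s ≐ t ⇒ t ≐ s)
  | eq_trans {Γ : Ctx} (s t u : Term L Γ .nat) : EHA L Γ (s ≐ t ⇒ t ≐ u ⇒ s ≐ u)
  | succ_ne_zero {Γ : Ctx} (t : Term L Γ .nat) : EHA L Γ (t.s ≐ .zero).neg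
  | succ_inj {Γ : Ctx} (s t : Term L Γ .nat) : EHA L Γ (s.s ≐ t.s ⇒ s ≐ t)
  | add_zero {Γ : Ctx} (s : Term L Γ .nat) : EHA L Γ (s.plus .zero ≐ s)
  | add_succ {Γ : Ctx} (s t : Term L Γ .nat) : EHA L Γ (s.plus t.s ≐ (s.plus t).s)
  | mul_zero {Γ : Ctx} (s : Term L Γ .nat) : EHA L Γ (s.times .zero ≐ .zero)
  | mul_succ {Γ : Ctx} (s t : Term L Γ .nat) : EHA L Γ (s.times t.s ≐ (s.times t).plus s)
  /-- `x =_ρ y → z x =_τ z y` -/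
  | ext {Γ : Ctx} {ρ τ : Ty} (h : ρ.ArgsIn L) (x y : Term L Γ ρ) (z : Term L Γ (ρ ⇾ τ))
      (u : Spine L Γ τ) :
      EHA L Γ (Formula.eqAt ρ h x y ⇒ (Term.app z x).apps u ≐ (Term.app z y).apps u)
  /-- `Π x y =_ρ x` -/
  | proj {Γ : Ctx} {ρ τ : Ty} (x : Term L Γ ρ) (y : Term L Γ τ) (u : Spine L Γ ρ) :
      EHA L Γ (Term.apps (.app (.app (.proj ρ τ) x) y) u ≐ x.apps u)
  /-- `Σ x y z =_τ x z (y z)` -/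
  | comb {Γ : Ctx} {δ ρ τ : Ty} (x : Term L Γ (δ ⇾ ρ ⇾ τ)) (y : Term L Γ (δ ⇾ ρ))
      (z : Term L Γ δ) (u : Spine L Γ τ) :
      EHA L Γ (Term.apps (.app (.app (.app (.comb δ ρ τ) x) y) z) u ≐
        Term.apps (.app (.app x z) (.app y z)) u)
  /-- `R_σ 0 y z =_σ y` -/
  | rec_zero {Γ : Ctx} {σ : Ty} (h : L.recTy σ) (y : Term L Γ σ) (z : Term L Γ (σ ⇾ .nat ⇾ σ))
      (u : Spine L Γ σ) :
      EHA L Γ ((Term.recAt h .zero y z).apps u ≐ y.apps u)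
  /-- `R_σ (S n) y z =_σ z (R_σ n y z) n` -/
  | rec_succ {Γ : Ctx} {σ : Ty} (h : L.recTy σ) (n : Term L Γ .nat) (y : Term L Γ σ)
      (z : Term L Γ (σ ⇾ .nat ⇾ σ)) (u : Spine L Γ σ) :
      EHA L Γ ((Term.recAt h n.s y z).apps u ≐
        Term.apps (.app (.app z (Term.recAt h n y z)) n) u)
  /-- `A(0) → (∀ n, A(n) → A(n + 1)) → ∀ n, A(n)` -/
  | induction {Γ : Ctx} (A : Formula L (.nat :: Γ)) :
      EHA L Γ (A.inst .zero ⇒ .all .nat L.nat_mem (A ⇒ A.subst Sub.step) ⇒ .all .nat L.nat_mem A)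

/-- Quantifier-free formulas. -/
def Formula.QF {L : Fragment} : {Γ : Ctx} → Formula L Γ → Prop
  | _, .eq _ _ => True
  | _, .bot => True
  | _, .and A B => A.QF ∧ B.QF
  | _, .or A B => A.QF ∧ B.QF
  | _, .imp A B => A.QF ∧ B.QF
  | _, .all _ _ _ => False
  | _, .ex _ _ _ => False

/-- The scheme `QF-AC^{ρ,τ}`: `∀ x ∃ y, A(x, y) → ∃ Y ∀ x, A(x, Y x)` for quantifier-free `A`
with arbitrary parameters. -/
inductive QFAC (L : Fragment) (ρ τ : Ty) : (Γ : Ctx) → Formula L Γ → Prop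
  | choice {Γ : Ctx} (hρ : L.varTy ρ) (hτ : L.varTy τ) (hY : L.varTy (ρ ⇾ τ))
      (A : Formula L (τ :: ρ :: Γ)) (hA : A.QF) :
      QFAC L ρ τ Γ (.all ρ hρ (.ex τ hτ A) ⇒
        .ex (ρ ⇾ τ) hY (.all ρ hρ (A.subst (Sub.choice hρ hY))))

/-- The law of the excluded middle. -/
inductive LEM (L : Fragment) : (Γ : Ctx) → Formula L Γ → Prop
  | em {Γ : Ctx} (A : Formula L Γ) : LEM L Γ (.or A A.neg)

/-- The axioms of `RCA^ω`: extensional arithmetic in all finite types with full induction,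
`QF-AC^{1,0}`, and excluded middle. -/
def RCAomega (Γ : Ctx) : Set (Formula Fragment.omega Γ) :=
  {A | EHA .omega Γ A ∨ QFAC .omega .one .nat Γ A ∨ LEM .omega Γ A}

/-- The axioms of `RCA`: the second order restriction of extensional arithmetic with full
induction, `QF-AC^{0,0}`, and excluded middle. -/
def RCA (Γ : Ctx) : Set (Formula Fragment.second Γ) :=
  {A | EHA .second Γ A ∨ QFAC .second .nat .nat Γ A ∨ LEM .second Γ A}

/-- `T ⊢ Φ` for a sentence `Φ`. -/
def Provable {L : Fragment} (T : ∀ Γ : Ctx, Set (Formula L Γ)) (Φ : Sentence L) : Prop :=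
  Derives T [] Φ

/-! ### The language of `RCA` as a part of the language of `RCA^ω` -/

/-- A term of a fragment, read as a term of the full language. -/
def Term.toOmega {L : Fragment} {Γ : Ctx} : {σ : Ty} → Term L Γ σ → Term Fragment.omega Γ σ
  | _, .var _ x => .var trivial x
  | _, .zero => .zero
  | _, .succ => .succ
  | _, .add => .add
  | _, .mul => .mul
  | _, .proj ρ τ => .proj ρ τ
  | _, .comb δ ρ τ => .comb δ ρ τ
  | _, .recursor σ _ => .recursor σ trivial
  | _, .app s t => .app s.toOmega t.toOmega

/-- A formula of a fragment, read as a formula of the full language. -/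
def Formula.toOmega {L : Fragment} : {Γ : Ctx} → Formula L Γ → Formula Fragment.omega Γ
  | _, .eq s t => .eq s.toOmega t.toOmega
  | _, .bot => .bot
  | _, .and A B => .and A.toOmega B.toOmega
  | _, .or A B => .or A.toOmega B.toOmega
  | _, .imp A B => .imp A.toOmega B.toOmega
  | _, .all σ _ A => .all σ trivial A.toOmega
  | _, .ex σ _ A => .ex σ trivial A.toOmega

end FiniteType

/-!
By Henkin's completeness theorem, a sentence `Φ` that is not provable in `RCA` fails in a model
`M` of `RCA`. The sets of numbers of `M` that are computably enumerable in `M`, relative to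
parameters, form a graph algebra in the sense of Scott and Engeler, hence a model of untyped
combinatory logic. Its hereditarily extensional objects form a model of `RCA^ω` in which every
choice function for a quantifier-free formula is found by unbounded search; the search is itself
an object of the algebra, so there is no restriction on the type of the arguments of the choice
function. A function on the numbers of `M` is computed by a computably enumerable set exactly if it
is an object of type `1` of `M`, by `QF-AC^{0,0}` in `M`. Second order sentences therefore have the
same truth value in both models, and `Φ` fails in a model of `RCA^ω`.
-/

namespace FiniteType

section Substitution
variable {L : Fragment} {Γ Δ Θ : Ctx}

theorem Term.rename_eq_subst (r : Ren Γ Δ) {σ : Ty} (t : Term L Γ σ) :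
    t.rename r = t.subst (fun _ h x => .var h (r x)) := by
  induction t <;> simp_all only [Term.rename, Term.subst]

theorem Term.subst_subst (s : Sub L Γ Δ) (s' : Sub L Δ Θ) {σ : Ty} (t : Term L Γ σ) :
    (t.subst s).subst s' = t.subst (fun _ h x => (s h x).subst s') := by
  induction t <;> simp_all only [Term.subst]

theorem Term.subst_var {σ : Ty} (t : Term L Γ σ) : t.subst (fun _ h x => .var h x) = t := by
  induction t <;> simp_all only [Term.subst]

theorem Term.subst_rename (r : Ren Γ Δ) (s : Sub L Δ Θ) {σ : Ty} (t : Term L Γ σ) :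
    (t.rename r).subst s = t.subst (fun _ h x => s h (r x)) := by
  simp only [Term.rename_eq_subst, Term.subst_subst, Term.subst]

theorem Term.rename_subst (s : Sub L Γ Δ) (r : Ren Δ Θ) {σ : Ty} (t : Term L Γ σ) :
    (t.subst s).rename r = t.subst (fun _ h x => (s h x).rename r) := by
  simp only [Term.rename_eq_subst, Term.subst_subst]

theorem Term.shift_subst_lift {ρ σ : Ty} (t : Term L Γ σ) (s : Sub L Γ Δ) :
    (t.shift (ρ := ρ)).subst s.lift = (t.subst s).shift := by
  simp only [Term.shift, Term.subst_rename, Term.rename_subst, Sub.lift]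

theorem Term.shift_subst_single {ρ σ : Ty} (t : Term L Γ σ) (u : Term L Γ ρ) :
    t.shift.subst (Sub.single u) = t :=
  (Term.subst_rename _ _ t).trans t.subst_var

theorem Sub.lift_subst {ρ : Ty} (s : Sub L Γ Δ) (s' : Sub L Δ Θ) :
    (fun _ h x => (s.lift h x).subst s'.lift : Sub L (ρ :: Γ) (ρ :: Θ)) =
      Sub.lift (fun _ h x => (s h x).subst s') := by
  funext σ h x
  cases x with
  | zero => rfl
  | succ x => exact Term.shift_subst_lift _ _

theorem Sub.lift_var_comp {ρ : Ty} (r : Ren Γ Δ) :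
    Sub.lift (fun _ h x => .var h (r x) : Sub L Γ Δ) =
      (fun _ h x => .var h (r.lift x) : Sub L (ρ :: Γ) (ρ :: Δ)) := by
  funext σ h x
  cases x <;> rfl

theorem Sub.lift_var {ρ : Ty} :
    Sub.lift (fun _ h x => .var h x : Sub L Γ Γ) = (fun _ h x => .var h x : Sub L (ρ :: Γ) _) := by
  funext σ h x
  cases x <;> rfl

theorem Formula.rename_eq_subst (r : Ren Γ Δ) (A : Formula L Γ) :
    A.rename r = A.subst (fun _ h x => .var h (r x)) := by
  induction A generalizing Δ <;>
    simp_all only [Formula.rename, Formula.subst, Term.rename_eq_subst, Sub.lift_var_comp]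

theorem Formula.subst_subst (s : Sub L Γ Δ) (s' : Sub L Δ Θ) (A : Formula L Γ) :
    (A.subst s).subst s' = A.subst (fun _ h x => (s h x).subst s') := by
  induction A generalizing Δ Θ <;>
    simp_all only [Formula.subst, Term.subst_subst, Sub.lift_subst]

theorem Formula.subst_var (A : Formula L Γ) : A.subst (fun _ h x => .var h x) = A := by
  induction A <;> simp_all only [Formula.subst, Term.subst_var, Sub.lift_var]

theorem Formula.subst_rename (r : Ren Γ Δ) (s : Sub L Δ Θ) (A : Formula L Γ) :
    (A.rename r).subst s = A.subst (fun _ h x => s h (r x)) := by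
  simp only [Formula.rename_eq_subst, Formula.subst_subst, Term.subst]

theorem Formula.rename_subst (s : Sub L Γ Δ) (r : Ren Δ Θ) (A : Formula L Γ) :
    (A.subst s).rename r = A.subst (fun _ h x => (s h x).rename r) := by
  simp only [Formula.rename_eq_subst, Formula.subst_subst, Term.rename_eq_subst]

theorem Formula.shift_subst_lift {ρ : Ty} (A : Formula L Γ) (s : Sub L Γ Δ) :
    (A.shift (ρ := ρ)).subst s.lift = (A.subst s).shift := by
  simp only [Formula.shift, Formula.subst_rename, Formula.rename_subst, Sub.lift]

theorem Formula.map_shift_subst_lift {ρ : Ty} (H : List (Formula L Γ)) (s : Sub L Γ Δ) :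
    (H.map (Formula.shift (ρ := ρ))).map (Formula.subst s.lift) =
      (H.map (Formula.subst s)).map Formula.shift := by
  simp only [List.map_map, Function.comp_def, Formula.shift_subst_lift]

theorem Formula.rename_lift_inst_zero {ρ : Ty} (h : L.varTy ρ) (A : Formula L (ρ :: Γ)) :
    (A.rename (Ren.lift (fun _ x => Var.succ x))).inst (.var h Var.zero) = A := by
  rw [Formula.inst, Formula.subst_rename]
  convert Formula.subst_var A using 2
  funext σ h x
  cases x <;> rfl

/-- The extension of a substitution by a term for the innermost variable. -/
def Sub.cons {ρ : Ty} (t : Term L Δ ρ) (s : Sub L Γ Δ) : Sub L (ρ :: Γ) Δ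
  | _, _, Var.zero => t
  | _, h, Var.succ x => s h x

theorem Formula.subst_lift_inst {ρ : Ty} (A : Formula L (ρ :: Γ)) (s : Sub L Γ Δ)
    (t : Term L Δ ρ) : (A.subst s.lift).inst t = A.subst (Sub.cons t s) := by
  rw [Formula.inst, Formula.subst_subst]
  congr 1
  funext σ h x
  cases x with
  | zero => rfl
  | succ x => exact Term.shift_subst_single _ _

theorem Formula.inst_subst {ρ : Ty} (A : Formula L (ρ :: Γ)) (t : Term L Γ ρ) (s : Sub L Γ Δ) :
    (A.inst t).subst s = (A.subst s.lift).inst (t.subst s) := by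
  rw [Formula.subst_lift_inst, Formula.inst, Formula.subst_subst]
  congr 1
  funext σ h x
  cases x <;> rfl

theorem Formula.inst_rename {ρ : Ty} (A : Formula L (ρ :: Γ)) (t : Term L Γ ρ) (r : Ren Γ Δ) :
    (A.inst t).rename r = (A.rename r.lift).inst (t.rename r) := by
  simp only [Formula.rename_eq_subst, Term.rename_eq_subst, Formula.inst_subst, Sub.lift_var_comp]

theorem Formula.step_subst (A : Formula L (.nat :: Γ)) (s : Sub L Γ Δ) :
    (A.subst Sub.step).subst s.lift = (A.subst s.lift).subst Sub.step := by
  rw [Formula.subst_subst, Formula.subst_subst]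
  congr 1
  funext σ h x
  cases x with
  | zero => rfl
  | succ x => simp only [Sub.step, Sub.lift, Term.subst, Term.rename_eq_subst, Term.subst_subst]

theorem Formula.choice_subst {ρ τ : Ty} (hρ : L.varTy ρ) (hY : L.varTy (ρ ⇾ τ))
    (A : Formula L (τ :: ρ :: Γ)) (s : Sub L Γ Δ) :
    (A.subst (Sub.choice hρ hY)).subst s.lift.lift =
      (A.subst s.lift.lift).subst (Sub.choice hρ hY) := by
  rw [Formula.subst_subst, Formula.subst_subst]
  congr 1
  funext σ h x
  rcases x with _ | _ | x
  · rfl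
  · rfl
  · simp only [Sub.choice, Sub.lift, Term.subst, Term.rename_eq_subst, Term.subst_subst]

theorem Formula.eqAt_subst (s : Sub L Γ Δ) (σ : Ty) (h : σ.ArgsIn L) (t u : Term L Γ σ) :
    (Formula.eqAt σ h t u).subst s = Formula.eqAt σ h (t.subst s) (u.subst s) := by
  induction σ generalizing Γ Δ with
  | nat => rfl
  | arr ρ τ _ ih =>
    simp only [Formula.eqAt, Formula.subst, ih, Term.subst, Term.shift_subst_lift, Sub.lift]

theorem Formula.QF.subst (s : Sub L Γ Δ) {A : Formula L Γ} (h : A.QF) : (A.subst s).QF := by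
  induction A generalizing Δ <;> simp_all only [Formula.QF, Formula.subst, and_self]

/-- The simultaneous substitution in a list of argument terms. -/
def Spine.subst (s : Sub L Γ Δ) : {σ : Ty} → Spine L Γ σ → Spine L Δ σ
  | _, .nil => .nil
  | _, .cons t u => .cons (t.subst s) (u.subst s)

theorem Term.apps_subst (s : Sub L Γ Δ) {σ : Ty} (t : Term L Γ σ) (u : Spine L Γ σ) :
    (t.apps u).subst s = (t.subst s).apps (u.subst s) := by
  induction u with
  | nil => rfl
  | cons _ _ ih => exact ih _

theorem EHA.subst (s : Sub L Γ Δ) {A : Formula L Γ} (h : EHA L Γ A) : EHA L Δ (A.subst s) := by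
  cases h <;>
    simp only [Formula.subst, Formula.eqAt_subst, Formula.inst_subst, Formula.step_subst,
      Term.apps_subst] <;>
    constructor

theorem QFAC.subst (s : Sub L Γ Δ) {ρ τ : Ty} {A : Formula L Γ} (h : QFAC L ρ τ Γ A) :
    QFAC L ρ τ Δ (A.subst s) := by
  obtain ⟨hρ, hτ, hY, A, hA⟩ := h
  simp only [Formula.subst, Formula.choice_subst]
  exact .choice hρ hτ hY _ (hA.subst _)

theorem LEM.subst (s : Sub L Γ Δ) {A : Formula L Γ} (h : LEM L Γ A) : LEM L Δ (A.subst s) := by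
  obtain ⟨A⟩ := h
  exact .em _

end Substitution

/-- A classical theory of arithmetic in the fragment `L`: a set of axioms that is closed under
substitution and contains `EHA L` and excluded middle. -/
class ClassicalTheory {L : Fragment} (T : ∀ Γ : Ctx, Set (Formula L Γ)) : Prop where
  subst_mem : ∀ {Γ Δ : Ctx} (s : Sub L Γ Δ) {A : Formula L Γ}, A ∈ T Γ → A.subst s ∈ T Δ
  eha_mem : ∀ {Γ : Ctx} {A : Formula L Γ}, EHA L Γ A → A ∈ T Γ
  em_mem : ∀ {Γ : Ctx} (A : Formula L Γ), A.or A.neg ∈ T Γ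

instance : ClassicalTheory RCA where
  subst_mem s _ := Or.imp (EHA.subst s) (Or.imp (QFAC.subst s) (LEM.subst s))
  eha_mem := Or.inl
  em_mem A := .inr (.inr (.em A))

namespace Derives
variable {L : Fragment} {T : ∀ Γ : Ctx, Set (Formula L Γ)} {Γ Δ : Ctx}

theorem subst (hT : ∀ {Γ Δ : Ctx} (s : Sub L Γ Δ) {A}, A ∈ T Γ → A.subst s ∈ T Δ)
    (s : Sub L Γ Δ) {H : List (Formula L Γ)} {A : Formula L Γ} (d : Derives T H A) :
    Derives T (H.map (Formula.subst s)) (A.subst s) := by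
  induction d generalizing Δ with
  | ax h => exact .ax (hT s h)
  | hyp h => exact .hyp (List.mem_map_of_mem h)
  | botE _ ih => exact .botE (ih s)
  | andI _ _ ih₁ ih₂ => exact .andI (ih₁ s) (ih₂ s)
  | andE₁ _ ih => exact .andE₁ (ih s)
  | andE₂ _ ih => exact .andE₂ (ih s)
  | orI₁ _ ih => exact .orI₁ (ih s)
  | orI₂ _ ih => exact .orI₂ (ih s)
  | orE _ _ _ ih ih₁ ih₂ => exact .orE (ih s) (ih₁ s) (ih₂ s)
  | impI _ ih => exact .impI (ih s)
  | impE _ _ ih₁ ih₂ => exact .impE (ih₁ s) (ih₂ s)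
  | allI _ ih => exact .allI (Formula.map_shift_subst_lift _ s ▸ ih s.lift)
  | allE t _ ih => exact Formula.inst_subst _ t s ▸ .allE _ (ih s)
  | exI t _ ih => exact .exI (t.subst s) (Formula.inst_subst _ t s ▸ ih s)
  | exE _ _ ih ih₁ =>
    refine .exE (ih s) ?_
    simpa only [List.map_cons, Formula.map_shift_subst_lift, Formula.shift_subst_lift]
      using ih₁ s.lift

theorem mono {U : ∀ Γ : Ctx, Set (Formula L Γ)} {H K : List (Formula L Γ)} {A : Formula L Γ}
    (d : Derives T H A) (hT : ∀ Γ, T Γ ⊆ U Γ) (hK : H ⊆ K) : Derives U K A := by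
  induction d with
  | ax h => exact .ax (hT _ h)
  | hyp h => exact .hyp (hK h)
  | botE _ ih => exact .botE (ih hK)
  | andI _ _ ih₁ ih₂ => exact .andI (ih₁ hK) (ih₂ hK)
  | andE₁ _ ih => exact .andE₁ (ih hK)
  | andE₂ _ ih => exact .andE₂ (ih hK)
  | orI₁ _ ih => exact .orI₁ (ih hK)
  | orI₂ _ ih => exact .orI₂ (ih hK)
  | orE _ _ _ ih ih₁ ih₂ =>
    exact .orE (ih hK) (ih₁ (List.cons_subset_cons _ hK)) (ih₂ (List.cons_subset_cons _ hK))
  | impI _ ih => exact .impI (ih (List.cons_subset_cons _ hK))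
  | impE _ _ ih₁ ih₂ => exact .impE (ih₁ hK) (ih₂ hK)
  | allI _ ih => exact .allI (ih (List.map_subset _ hK))
  | allE t _ ih => exact .allE t (ih hK)
  | exI t _ ih => exact .exI t (ih hK)
  | exE _ _ ih ih₁ =>
    exact .exE (ih hK) (ih₁ (List.cons_subset_cons _ (List.map_subset _ hK)))

theorem weaken {H K : List (Formula L Γ)} {A : Formula L Γ} (d : Derives T H A) (hK : H ⊆ K) :
    Derives T K A := d.mono (fun _ => subset_rfl) hK


theorem head {H : List (Formula L Γ)} {A : Formula L Γ} : Derives T (A :: H) A :=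
  .hyp List.mem_cons_self

theorem cons {H : List (Formula L Γ)} {A B : Formula L Γ} (d : Derives T H A) :
    Derives T (B :: H) A :=
  d.weaken (List.subset_cons_self _ _)

variable [ClassicalTheory T]

theorem eha {H : List (Formula L Γ)} {A : Formula L Γ} (h : EHA L Γ A) : Derives T H A :=
  .ax (ClassicalTheory.eha_mem h)

theorem rename (r : Ren Γ Δ) {H : List (Formula L Γ)} {A : Formula L Γ} (d : Derives T H A) :
    Derives T (H.map (Formula.rename r)) (A.rename r) := by
  simpa only [Formula.rename_eq_subst, funext (Formula.rename_eq_subst (L := L) r)]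
    using d.subst ClassicalTheory.subst_mem _

theorem shift {ρ : Ty} {H : List (Formula L Γ)} {A : Formula L Γ} (d : Derives T H A) :
    Derives T (H.map (Formula.shift (ρ := ρ))) A.shift :=
  d.rename _

theorem byContra {H : List (Formula L Γ)} {A : Formula L Γ} (d : Derives T (A.neg :: H) .bot) :
    Derives T H A :=
  .orE (.ax (ClassicalTheory.em_mem A)) .head (.botE d)

theorem ex_neg_of_neg_all {H : List (Formula L Γ)} {σ : Ty} {h : L.varTy σ}
    {A : Formula L (σ :: Γ)} (d : Derives T H (Formula.all σ h A).neg) :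
    Derives T H (.ex σ h A.neg) := by
  refine .byContra (.impE d.cons (.allI (.byContra ?_)))
  refine .impE (A := (Formula.ex σ h A.neg).shift)
    (shift .head).cons (.exI (.var h .zero) ?_)
  exact (Formula.rename_lift_inst_zero h A.neg).symm ▸ .head

end Derives

/-- A closed term of every type, constantly `0`. -/
def Term.default {L : Fragment} {Γ : Ctx} : (σ : Ty) → Term L Γ σ
  | .nat => .zero
  | .arr ρ τ => .app (.proj τ ρ) (Term.default τ)

/-! ### Henkin completeness -/

open Filter

deriving instance Countable for Ty, Var, Term, Formula

namespace Henkin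
variable {L : Fragment}

instance : Nonempty {σ // L.varTy σ} := ⟨⟨.nat, L.nat_mem⟩⟩

/-- An enumeration of the types of variables. -/
noncomputable def varTyEnum (L : Fragment) : ℕ → {σ // L.varTy σ} :=
  (exists_surjective_nat {σ // L.varTy σ}).choose

/-- The type of the variable that is adjoined at stage `m` of a Henkin construction: each type of
variables occurs infinitely often. -/
noncomputable def witnessTy (L : Fragment) (m : ℕ) : Ty := (varTyEnum L (Nat.unpair m).1).1

theorem witnessTy_mem (m : ℕ) : L.varTy (witnessTy L m) := (varTyEnum L (Nat.unpair m).1).2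

/-- The number of the formula that is decided at stage `m` of a Henkin construction. -/
def task (m : ℕ) : ℕ := (Nat.unpair (Nat.unpair m).2).1

theorem exists_witnessTy_task {σ : Ty} (hσ : L.varTy σ) (i n : ℕ) :
    ∃ m ≥ n, witnessTy L m = σ ∧ task m = i := by
  obtain ⟨k, hk⟩ : ∃ k, varTyEnum L k = ⟨σ, hσ⟩ :=
    (exists_surjective_nat {σ // L.varTy σ}).choose_spec ⟨σ, hσ⟩
  refine ⟨Nat.pair k (Nat.pair i n), (Nat.right_le_pair _ _).trans (Nat.right_le_pair _ _), ?_, ?_⟩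
  · simp only [witnessTy, Nat.unpair_pair, hk]
  · simp only [task, Nat.unpair_pair]

/-- The context of the variables adjoined before stage `m`. -/
noncomputable def ctx (L : Fragment) : ℕ → Ctx
  | 0 => []
  | m + 1 => witnessTy L m :: ctx L m

section Transport
variable {X : ℕ → Type} (d : ∀ m, X m) (f : ∀ m, X m → X (m + 1)) {n : ℕ}

/-- The transport of an element of stage `n` to the later stages along the maps `f`. The earlier
stages carry the default value `d`. -/
def up (x : X n) (m : ℕ) : X m := if h : n ≤ m then Nat.leRecOn h (f _) x else d m

theorem up_self (x : X n) : up d f x n = x := by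
  rw [up, dif_pos le_rfl, Nat.leRecOn_self]

theorem up_succ (x : X n) {m : ℕ} (h : n ≤ m) : up d f x (m + 1) = f m (up d f x m) := by
  rw [up, up, dif_pos h, dif_pos (h.trans m.le_succ), Nat.leRecOn_succ h]

theorem up_eq (x : ∀ m, X m) (hx : ∀ m ≥ n, x (m + 1) = f m (x m)) {m : ℕ} (h : n ≤ m) :
    up d f (x n) m = x m := by
  induction m, h using Nat.le_induction with
  | base => exact up_self d f _
  | succ m hm ih => rw [up_succ d f _ hm, ih, hx m hm]

end Transport

variable {T : ∀ Γ : Ctx, Set (Formula L Γ)} {Γ : Ctx}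

/-- The hypotheses `K`, in which a variable of type `σ` is fresh, refute `B`, or else they assert
`B` and, if `B` is existential, name a witness by the fresh variable. -/
def Settles {σ : Ty} (K : List (Formula L (σ :: Γ))) (B : Formula L Γ) : Prop :=
  B.neg.shift ∈ K ∨ B.shift ∈ K ∧ ∀ h C, B = .ex σ h C → C ∈ K

theorem consistent_shift {H : List (Formula L Γ)} {σ : Ty} (hσ : L.varTy σ)
    (h : ¬ Derives T H .bot) : ¬ Derives T (H.map (Formula.shift (ρ := σ))) .bot := fun d =>
  h (Derives.allE (h := hσ) (A := .bot) (Term.default σ) (.allI d))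

theorem consistent_cons_or_neg {H : List (Formula L Γ)} (h : ¬ Derives T H .bot)
    (B : Formula L Γ) : ¬ Derives T (B :: H) .bot ∨ ¬ Derives T (B.neg :: H) .bot :=
  not_and_or.1 fun ⟨d, d'⟩ => h (.impE (.impI d') (.impI d))

theorem consistent_witness {H : List (Formula L Γ)} {σ : Ty} {h : L.varTy σ}
    {C : Formula L (σ :: Γ)} (hC : .ex σ h C ∈ H) (hH : ¬ Derives T H .bot) :
    ¬ Derives T (C :: H.map Formula.shift) .bot := fun d =>
  hH (.exE (.hyp hC) (B := .bot) d)

theorem exists_settles {H : List (Formula L Γ)} {σ : Ty} (hσ : L.varTy σ)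
    (hH : ¬ Derives T H .bot) (B : Formula L Γ) :
    ∃ K : List (Formula L (σ :: Γ)),
      ¬ Derives T K .bot ∧ H.map Formula.shift ⊆ K ∧ Settles K B := by
  have hsub (A : Formula L Γ) :
      H.map (Formula.shift (ρ := σ)) ⊆ (A :: H).map Formula.shift :=
    List.map_subset _ (List.subset_cons_self _ _)
  rcases consistent_cons_or_neg hH B with hB | hB
  · by_cases hC : ∃ h C, B = .ex σ h C
    · obtain ⟨h, C, rfl⟩ := hC
      refine ⟨C :: (Formula.ex σ h C :: H).map Formula.shift,
        consistent_witness List.mem_cons_self hB, fun A hA => .tail _ (hsub _ hA),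
        .inr ⟨.tail _ List.mem_cons_self, ?_⟩⟩
      rintro _ _ ⟨⟩
      exact List.mem_cons_self
    · exact ⟨_, consistent_shift hσ hB, hsub B,
        .inr ⟨List.mem_cons_self, fun h C hBC => absurd ⟨h, C, hBC⟩ hC⟩⟩
  · exact ⟨_, consistent_shift hσ hB, hsub B.neg, .inl List.mem_cons_self⟩

/-- A compatible choice of formulas in the contexts of a Henkin construction: a formula that may
mention finitely many of the adjoined variables. -/
def Coherent (B : ∀ m, Formula L (ctx L m)) : Prop := ∀ᶠ m in atTop, B (m + 1) = (B m).shift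

/-- The sequences of hypotheses in a Henkin construction: each formula is eventually settled, and
this happens at stages that adjoin a variable of any prescribed type. -/
structure Tower (T : ∀ Γ : Ctx, Set (Formula L Γ)) where
  /-- the hypotheses at stage `m` -/
  hyps : ∀ m, List (Formula L (ctx L m))
  consistent : ∀ m, ¬ Derives T (hyps m) .bot
  mono : ∀ m, (hyps m).map Formula.shift ⊆ hyps (m + 1)
  exists_settles : ∀ {σ : Ty}, L.varTy σ → ∀ {B : ∀ m, Formula L (ctx L m)}, Coherent B →
    ∀ n, ∃ m ≥ n, witnessTy L m = σ ∧ Settles (hyps (m + 1)) (B m)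

theorem exists_tower {H₀ : List (Sentence L)} (hH₀ : ¬ Derives T H₀ .bot) :
    ∃ W : Tower T, W.hyps 0 = H₀ := by
  have : Nonempty (Σ n, Formula L (ctx L n)) := ⟨⟨0, .bot⟩⟩
  obtain ⟨g, hg⟩ := exists_surjective_nat (Σ n, Formula L (ctx L n))
  let goal (m : ℕ) : Formula L (ctx L m) :=
    up (X := fun m => Formula L (ctx L m)) (fun _ => .bot) (fun _ A => A.shift) (g (task m)).2 m
  let State (m : ℕ) := {H : List (Formula L (ctx L m)) // ¬ Derives T H .bot}
  have hstep (m : ℕ) (H : State m) := exists_settles (witnessTy_mem m) H.2 (goal m)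
  choose next hnext hmono hsettles using hstep
  let H (m : ℕ) : State m := Nat.rec ⟨H₀, hH₀⟩ (fun m H => ⟨next m H, hnext m H⟩) m
  refine ⟨⟨fun m => (H m).1, fun m => (H m).2, fun m => hmono m (H m), ?_⟩, rfl⟩
  intro σ hσ B hB n
  obtain ⟨k, hk⟩ := eventually_atTop.1 hB
  obtain ⟨i, hi⟩ := hg ⟨max n k, B (max n k)⟩
  obtain ⟨m, hm, hmσ, rfl⟩ := exists_witnessTy_task hσ i (max n k)
  have hgoal : goal m = B m := by
    simp only [goal]
    rw [hi]
    exact up_eq (X := fun m => Formula L (ctx L m)) _ _ B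
      (fun j hj => hk j ((le_max_right n k).trans hj)) hm
  exact ⟨m, (le_max_left n k).trans hm, hmσ, hgoal ▸ hsettles m (H m)⟩

namespace Tower
variable (W : Tower T)

/-- The formulas `B m` are derivable from some stage on. -/
def Tr (B : ∀ m, Formula L (ctx L m)) : Prop := ∀ᶠ m in atTop, Derives T (W.hyps m) (B m)

variable {W}

theorem not_tr_bot : ¬ W.Tr fun _ => .bot := fun h =>
  have ⟨m, hm⟩ := h.exists
  W.consistent m hm

theorem not_tr_neg {B : ∀ m, Formula L (ctx L m)} (h : W.Tr B) :
    ¬ W.Tr fun m => (B m).neg := fun h' =>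
  not_tr_bot <| by
    filter_upwards [h, h'] with m d d'
    exact d'.impE d

theorem tr_and_iff {A B : ∀ m, Formula L (ctx L m)} :
    (W.Tr fun m => .and (A m) (B m)) ↔ W.Tr A ∧ W.Tr B := by
  refine ⟨fun h => ⟨h.mono fun _ d => d.andE₁, h.mono fun _ d => d.andE₂⟩, fun ⟨h, h'⟩ => ?_⟩
  filter_upwards [h, h'] with m d d'
  exact d.andI d'

variable [ClassicalTheory T]

theorem derives_succ {m : ℕ} {A : Formula L (ctx L m)} (d : Derives T (W.hyps m) A) :
    Derives T (W.hyps (m + 1)) A.shift :=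
  d.shift.weaken (W.mono m)

theorem Tr.of_frequently {B : ∀ m, Formula L (ctx L m)} (hB : Coherent B)
    (h : ∃ᶠ m in atTop, Derives T (W.hyps m) (B m)) : W.Tr B := by
  obtain ⟨n, hn⟩ := eventually_atTop.1 hB
  obtain ⟨m, hm, d⟩ := frequently_atTop.1 h n
  refine eventually_atTop.2 ⟨m, fun k hk => ?_⟩
  induction k, hk using Nat.le_induction with
  | base => exact d
  | succ k hk ih => exact hn k (hm.trans hk) ▸ derives_succ ih

theorem tr_or_tr_neg {B : ∀ m, Formula L (ctx L m)} (hB : Coherent B) :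
    W.Tr B ∨ W.Tr fun m => (B m).neg := by
  obtain ⟨n, hn⟩ := eventually_atTop.1 hB
  have hneg : Coherent fun m => (B m).neg := hB.mono fun m hm => congrArg Formula.neg hm
  by_cases h : ∃ᶠ m in atTop, Derives T (W.hyps m) (B m)
  · exact .inl (.of_frequently hB h)
  refine .inr (.of_frequently hneg (frequently_atTop.2 fun k => ?_))
  obtain ⟨k', hk'⟩ := eventually_atTop.1 (not_frequently.1 h)
  obtain ⟨m, hm, -, hs⟩ := W.exists_settles L.nat_mem hB (max n (max k k'))
  have hBm := hn m (by omega)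
  refine ⟨m + 1, by omega, ?_⟩
  rcases hs with hs | ⟨hs, -⟩
  · exact hBm ▸ .hyp hs
  · exact absurd (hBm ▸ Derives.hyp (T := T) hs) (hk' (m + 1) (by omega))

theorem tr_imp_iff {A B : ∀ m, Formula L (ctx L m)} (hA : Coherent A) :
    (W.Tr fun m => A m ⇒ B m) ↔ (W.Tr A → W.Tr B) := by
  constructor
  · intro h hA
    filter_upwards [h, hA] with m d d'
    exact d.impE d'
  · intro h
    rcases tr_or_tr_neg (W := W) hA with hA | hA
    · filter_upwards [h hA] with m d
      exact .impI d.cons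
    · filter_upwards [hA] with m d
      exact .impI (.botE (.impE d.cons .head))

theorem tr_or_iff {A B : ∀ m, Formula L (ctx L m)} (hA : Coherent A) :
    (W.Tr fun m => .or (A m) (B m)) ↔ W.Tr A ∨ W.Tr B := by
  constructor
  · intro h
    refine (tr_or_tr_neg hA).imp_right fun hA => ?_
    filter_upwards [h, hA] with m d d'
    exact .orE d (.botE (.impE d'.cons .head)) .head
  · rintro (h | h)
    · exact h.mono fun _ d => .orI₁ d
    · exact h.mono fun _ d => .orI₂ d

end Tower

/-- A compatible choice of terms in the contexts of a Henkin construction: a term that may mention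
finitely many of the adjoined variables. -/
structure Germ (L : Fragment) (σ : Ty) where
  /-- the term at stage `m` -/
  at_ : ∀ m, Term L (ctx L m) σ
  coh : ∀ᶠ m in atTop, at_ (m + 1) = (at_ m).shift

theorem exists_germ_at_eq {σ : Ty} {n : ℕ} (t : Term L (ctx L n) σ) :
    ∃ a : Germ L σ, a.at_ n = t ∧ ∀ m ≥ n, a.at_ (m + 1) = (a.at_ m).shift := by
  let s := up (X := fun m => Term L (ctx L m) σ) (fun _ => .default σ) (fun _ t => t.shift) t
  have hs : ∀ m ≥ n, s (m + 1) = (s m).shift := fun m hm => up_succ _ _ _ hm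
  exact ⟨⟨s, eventually_atTop.2 ⟨n, hs⟩⟩, up_self (X := fun m => Term L (ctx L m) σ)
    (fun _ => .default σ) (fun _ t => t.shift) t, hs⟩

namespace Tower
variable {W : Tower T} [ClassicalTheory T] {σ : Ty} {h : L.varTy σ}
  {C : ∀ m, Formula L (σ :: ctx L m)}

theorem Tr.exists_inst (hC : Coherent fun m => .ex σ h (C m))
    (hT : W.Tr fun m => .ex σ h (C m)) :
    ∃ a : Germ L σ, W.Tr fun m => (C m).inst (a.at_ m) := by
  obtain ⟨n, hn⟩ := eventually_atTop.1 (hC.and hT)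
  obtain ⟨m, hm, rfl, hs⟩ := W.exists_settles h hC n
  have hCm : C m ∈ W.hyps (m + 1) := by
    rcases hs with hs | ⟨-, hs⟩
    · exact absurd (.impE (.hyp hs) (derives_succ (hn m hm).2)) (W.consistent (m + 1))
    · exact hs h (C m) rfl
  have hCsucc (k : ℕ) (hk : n ≤ k) : C (k + 1) = (C k).rename (Ren.lift fun _ x => .succ x) :=
    eq_of_heq (Formula.ex.inj (hn k hk).1).2
  obtain ⟨a, ha, hcoh⟩ :=
    exists_germ_at_eq (n := m + 1) (.var h .zero : Term L (ctx L (m + 1)) (witnessTy L m))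
  refine ⟨a, eventually_atTop.2 ⟨m + 1, fun k hk => ?_⟩⟩
  induction k, hk using Nat.le_induction with
  | base =>
    have : (C (m + 1)).inst (a.at_ (m + 1)) = C m := by
      rw [ha, hCsucc m hm]
      exact Formula.rename_lift_inst_zero h (C m)
    exact (congrArg (Derives T (W.hyps (m + 1))) this).mpr (.hyp hCm)
  | succ k hk ih =>
    have : (C (k + 1)).inst (a.at_ (k + 1)) = ((C k).inst (a.at_ k)).shift := by
      rw [hCsucc k (by omega), hcoh k hk, Formula.shift, Formula.inst_rename]
      rfl
    exact (congrArg (Derives T (W.hyps (k + 1))) this).mpr (derives_succ ih)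

theorem tr_ex_iff (hC : Coherent fun m => .ex σ h (C m)) :
    (W.Tr fun m => .ex σ h (C m)) ↔ ∃ a : Germ L σ, W.Tr fun m => (C m).inst (a.at_ m) :=
  ⟨Tr.exists_inst hC, fun ⟨a, ha⟩ => ha.mono fun m d => .exI (a.at_ m) d⟩

theorem tr_all_iff (hC : Coherent fun m => .all σ h (C m)) :
    (W.Tr fun m => .all σ h (C m)) ↔ ∀ a : Germ L σ, W.Tr fun m => (C m).inst (a.at_ m) := by
  refine ⟨fun hT a => hT.mono fun m d => .allE (a.at_ m) d, fun hT => ?_⟩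
  refine (tr_or_tr_neg hC).resolve_right fun hn => ?_
  have hneg : Coherent fun m => .ex σ h (C m).neg := hC.mono fun m hm => by
    have hm := eq_of_heq (Formula.all.inj hm).2
    exact congrArg (fun A => Formula.ex σ h (Formula.neg A)) hm
  obtain ⟨a, ha⟩ := Tr.exists_inst hneg (hn.mono fun m d => d.ex_neg_of_neg_all)
  exact not_tr_neg (hT a) ha

end Tower

end Henkin

/-! ### Structures and satisfaction -/

/-- A typed applicative structure with interpretations of the constants of `L`. -/
structure Struct (L : Fragment) where
  /-- the objects of each type -/
  D : Ty → Type
  app : {σ τ : Ty} → D (σ ⇾ τ) → D σ → D τ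
  zero : D .nat
  succ : D (.nat ⇾ .nat)
  add : D (.nat ⇾ .nat ⇾ .nat)
  mul : D (.nat ⇾ .nat ⇾ .nat)
  proj (ρ τ : Ty) : D (ρ ⇾ τ ⇾ ρ)
  comb (δ ρ τ : Ty) : D ((δ ⇾ ρ ⇾ τ) ⇾ (δ ⇾ ρ) ⇾ δ ⇾ τ)
  recursor (σ : Ty) (h : L.recTy σ) : D (.nat ⇾ σ ⇾ (σ ⇾ .nat ⇾ σ) ⇾ σ)

namespace Struct
variable {L : Fragment} (M : Struct L)

/-- An assignment of objects to the variables of a context. -/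
abbrev Env (Γ : Ctx) : Type := ∀ ⦃σ : Ty⦄, L.varTy σ → Var Γ σ → M.D σ

variable {M} {Γ Δ : Ctx} {ρ : Ty}

/-- The assignment for the empty context. -/
def Env.nil : M.Env [] := fun _ _ x => nomatch x

theorem Env.eq_nil (e : M.Env []) : e = .nil := by
  funext _ _ x
  cases x

/-- Extension of an assignment by a value of the innermost variable. -/
def Env.cons (a : M.D ρ) (e : M.Env Γ) : M.Env (ρ :: Γ)
  | _, _, .zero => a
  | _, h, .succ x => e h x

/-- The value of a term. -/
def eval (e : M.Env Γ) : {σ : Ty} → Term L Γ σ → M.D σ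
  | _, .var h x => e h x
  | _, .zero => M.zero
  | _, .succ => M.succ
  | _, .add => M.add
  | _, .mul => M.mul
  | _, .proj ρ τ => M.proj ρ τ
  | _, .comb δ ρ τ => M.comb δ ρ τ
  | _, .recursor σ h => M.recursor σ h
  | _, .app s t => M.app (eval e s) (eval e t)

/-- Satisfaction of a formula under an assignment. -/
def Sat : {Γ : Ctx} → M.Env Γ → Formula L Γ → Prop
  | _, e, .eq s t => eval e s = eval e t
  | _, _, .bot => False
  | _, e, .and A B => Sat e A ∧ Sat e B
  | _, e, .or A B => Sat e A ∨ Sat e B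
  | _, e, .imp A B => Sat e A → Sat e B
  | _, e, .all _ _ A => ∀ a, Sat (Env.cons a e) A
  | _, e, .ex _ _ A => ∃ a, Sat (Env.cons a e) A

theorem eval_rename (e : M.Env Δ) (r : Ren Γ Δ) {σ : Ty} (t : Term L Γ σ) :
    eval e (t.rename r) = eval (fun _ h x => e h (r x)) t := by
  induction t <;> simp_all only [eval, Term.rename]

theorem eval_subst (e : M.Env Δ) (s : Sub L Γ Δ) {σ : Ty} (t : Term L Γ σ) :
    eval e (t.subst s) = eval (fun _ h x => eval e (s h x)) t := by
  induction t <;> simp_all only [eval, Term.subst]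

theorem Env.cons_lift (a : M.D ρ) (e : M.Env Δ) (r : Ren Γ Δ) :
    (fun _ h x => Env.cons a e h (r.lift x) : M.Env (ρ :: Γ)) =
      Env.cons a (fun _ h x => e h (r x)) := by
  funext σ h x
  cases x <;> rfl

theorem Env.eval_lift (a : M.D ρ) (e : M.Env Δ) (s : Sub L Γ Δ) :
    (fun _ h x => eval (Env.cons a e) (s.lift h x) : M.Env (ρ :: Γ)) =
      Env.cons a (fun _ h x => eval e (s h x)) := by
  funext σ h x
  cases x with
  | zero => rfl
  | succ x => exact eval_rename _ _ _

theorem sat_rename (e : M.Env Δ) (r : Ren Γ Δ) (A : Formula L Γ) :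
    Sat e (A.rename r) ↔ Sat (fun _ h x => e h (r x)) A := by
  induction A generalizing Δ <;>
    simp_all only [Sat, Formula.rename, eval_rename, Env.cons_lift]

theorem sat_subst (e : M.Env Δ) (s : Sub L Γ Δ) (A : Formula L Γ) :
    Sat e (A.subst s) ↔ Sat (fun _ h x => eval e (s h x)) A := by
  induction A generalizing Δ <;>
    simp_all only [Sat, Formula.subst, eval_subst, Env.eval_lift]

theorem sat_shift (a : M.D ρ) (e : M.Env Γ) (A : Formula L Γ) :
    Sat (Env.cons a e) A.shift ↔ Sat e A :=
  sat_rename _ _ _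

theorem sat_inst (e : M.Env Γ) (A : Formula L (ρ :: Γ)) (t : Term L Γ ρ) :
    Sat e (A.inst t) ↔ Sat (Env.cons (eval e t) e) A := by
  rw [Formula.inst, sat_subst]
  refine iff_of_eq (congrArg (Sat · A) ?_)
  funext σ h x
  cases x <;> rfl

theorem sat_step (n : M.D .nat) (e : M.Env Γ) (A : Formula L (.nat :: Γ)) :
    Sat (Env.cons n e) (A.subst Sub.step) ↔ Sat (Env.cons (M.app M.succ n) e) A := by
  rw [sat_subst]
  refine iff_of_eq (congrArg (Sat · A) ?_)
  funext σ h x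
  cases x <;> rfl

theorem sat_choice {ρ τ : Ty} (hρ : L.varTy ρ) (hY : L.varTy (ρ ⇾ τ)) (x : M.D ρ)
    (Y : M.D (ρ ⇾ τ)) (e : M.Env Γ) (A : Formula L (τ :: ρ :: Γ)) :
    Sat (Env.cons x (Env.cons Y e)) (A.subst (Sub.choice hρ hY)) ↔
      Sat (Env.cons (M.app Y x) (Env.cons x e)) A := by
  rw [sat_subst]
  refine iff_of_eq (congrArg (Sat · A) ?_)
  funext σ h x
  rcases x with _ | x
  · rfl
  · cases x <;> rfl

variable (M) in
/-- The axioms `T` are valid in `M`. -/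
def Models (T : ∀ Γ : Ctx, Set (Formula L Γ)) : Prop :=
  ∀ ⦃Γ : Ctx⦄ ⦃A : Formula L Γ⦄, A ∈ T Γ → ∀ e : M.Env Γ, M.Sat e A

variable {T : ∀ Γ : Ctx, Set (Formula L Γ)}

theorem Models.sat_of_derives (hM : M.Models T) {H : List (Formula L Γ)} {A : Formula L Γ}
    (d : Derives T H A) (e : M.Env Γ) (he : ∀ B ∈ H, M.Sat e B) : M.Sat e A := by
  have shift {Γ : Ctx} {H : List (Formula L Γ)} {σ : Ty} {e : M.Env Γ} (a : M.D σ)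
      (he : ∀ B ∈ H, M.Sat e B) : ∀ B ∈ H.map Formula.shift, M.Sat (.cons a e) B :=
    List.forall_mem_map.2 fun B hB => (sat_shift a e B).2 (he B hB)
  induction d with
  | ax h => exact hM h e
  | hyp h => exact he _ h
  | botE _ ih => exact (ih e he).elim
  | andI _ _ ih₁ ih₂ => exact ⟨ih₁ e he, ih₂ e he⟩
  | andE₁ _ ih => exact (ih e he).1
  | andE₂ _ ih => exact (ih e he).2
  | orI₁ _ ih => exact .inl (ih e he)
  | orI₂ _ ih => exact .inr (ih e he)
  | orE _ _ _ ih ih₁ ih₂ =>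
    rcases ih e he with h | h
    · exact ih₁ e (List.forall_mem_cons.2 ⟨h, he⟩)
    · exact ih₂ e (List.forall_mem_cons.2 ⟨h, he⟩)
  | impI _ ih => exact fun h => ih e (List.forall_mem_cons.2 ⟨h, he⟩)
  | impE _ _ ih₁ ih₂ => exact ih₁ e he (ih₂ e he)
  | allI _ ih => exact fun a => ih _ (shift a he)
  | allE t _ ih => exact (sat_inst _ _ _).2 (ih e he _)
  | exI t _ ih => exact ⟨_, (sat_inst _ _ _).1 (ih e he)⟩
  | exE _ _ ih₁ ih₂ =>
    obtain ⟨a, ha⟩ := ih₁ e he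
    exact (sat_shift a e _).1 (ih₂ _ (List.forall_mem_cons.2 ⟨ha, shift a he⟩))

theorem Models.sat_of_provable (hM : M.Models T) {Φ : Sentence L} (hΦ : Provable T Φ)
    (e : M.Env []) : M.Sat e Φ :=
  hM.sat_of_derives hΦ e (List.forall_mem_nil _)

end Struct

/-- Models of `T` in which the equations for `Π`, `Σ` and the recursors hold as identities between
objects of all types, not only up to the formula `s =_σ t`. -/
class IsModel {L : Fragment} (T : ∀ Γ : Ctx, Set (Formula L Γ)) (M : Struct L) : Prop where
  proj_eq {ρ τ : Ty} (a : M.D ρ) (b : M.D τ) : M.app (M.app (M.proj ρ τ) a) b = a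
  comb_eq {δ ρ τ : Ty} (a : M.D (δ ⇾ ρ ⇾ τ)) (b : M.D (δ ⇾ ρ)) (c : M.D δ) :
    M.app (M.app (M.app (M.comb δ ρ τ) a) b) c = M.app (M.app a c) (M.app b c)
  rec_zero {σ : Ty} (h : L.recTy σ) (y : M.D σ) (z : M.D (σ ⇾ .nat ⇾ σ)) :
    M.app (M.app (M.app (M.recursor σ h) M.zero) y) z = y
  rec_succ {σ : Ty} (h : L.recTy σ) (n : M.D .nat) (y : M.D σ) (z : M.D (σ ⇾ .nat ⇾ σ)) :
    M.app (M.app (M.app (M.recursor σ h) (M.app M.succ n)) y) z =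
      M.app (M.app z (M.app (M.app (M.app (M.recursor σ h) n) y) z)) n
  models : M.Models T

/-- Fragments in which the equation `s =_σ t` is a formula whenever `σ` is the type of a variable,
and which have variables for the values of all recursors. -/
class Fragment.Regular (L : Fragment) : Prop where
  argsIn_of_varTy {σ : Ty} : L.varTy σ → σ.ArgsIn L
  varTy_of_recTy {σ : Ty} : L.recTy σ → L.varTy σ

instance : Fragment.second.Regular where
  argsIn_of_varTy := by
    rintro _ (rfl | rfl)
    · exact trivial
    · exact ⟨.inl rfl, trivial⟩
  varTy_of_recTy := Or.inl

namespace Henkin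

/-! ### The extensional term model of a Henkin tower -/

variable {L : Fragment} {Γ : Ctx}

/-- Application of germs. -/
def Germ.app {σ τ : Ty} (f : Germ L (σ ⇾ τ)) (a : Germ L σ) : Germ L τ where
  at_ m := .app (f.at_ m) (a.at_ m)
  coh := by
    filter_upwards [f.coh, a.coh] with m h₁ h₂
    rw [h₁, h₂]
    rfl

/-- An assignment of germs to the variables of a context. -/
abbrev GermEnv (L : Fragment) (Γ : Ctx) : Type := ∀ ⦃σ : Ty⦄, L.varTy σ → Var Γ σ → Germ L σ

namespace GermEnv

/-- The substitution given by an assignment of germs at stage `m`. -/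
def sub (ν : GermEnv L Γ) (m : ℕ) : Sub L Γ (ctx L m) := fun _ h x => (ν h x).at_ m

/-- Extension of an assignment by a value of the innermost variable. -/
def cons {ρ : Ty} (a : Germ L ρ) (ν : GermEnv L Γ) : GermEnv L (ρ :: Γ)
  | _, _, .zero => a
  | _, h, .succ x => ν h x

theorem cons_sub {ρ : Ty} (a : Germ L ρ) (ν : GermEnv L Γ) (m : ℕ) :
    (cons a ν).sub m = Sub.cons (a.at_ m) (ν.sub m) := by
  funext σ h x
  cases x <;> rfl

theorem eventually_sub_succ (ν : GermEnv L Γ) :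
    ∀ᶠ m in atTop, ν.sub (m + 1) = fun _ h x => (ν.sub m h x).shift := by
  induction Γ with
  | nil =>
    refine .of_forall fun m => ?_
    funext _ _ x
    cases x
  | cons ρ Γ ih =>
    have hhead : ∀ᶠ m in atTop, ∀ h : L.varTy ρ,
        (ν h .zero).at_ (m + 1) = ((ν h .zero).at_ m).shift := by
      by_cases h : L.varTy ρ
      · exact (ν h .zero).coh.mono fun m hm _ => hm
      · exact .of_forall fun _ h' => absurd h' h
    filter_upwards [hhead, ih fun _ h x => ν h x.succ] with m h₁ h₂
    funext σ h x
    cases x with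
    | zero => exact h₁ h
    | succ x => exact congrFun (congrFun (congrFun h₂ σ) h) x

theorem coherent_subst (ν : GermEnv L Γ) (A : Formula L Γ) :
    Coherent fun m => A.subst (ν.sub m) := by
  filter_upwards [ν.eventually_sub_succ] with m hm
  rw [hm]
  exact (Formula.rename_subst _ _ A).symm

/-- The germ of a term whose variables stand for germs. -/
noncomputable def germ (ν : GermEnv L Γ) {σ : Ty} (t : Term L Γ σ) : Germ L σ where
  at_ m := t.subst (ν.sub m)
  coh := by
    filter_upwards [ν.eventually_sub_succ] with m hm
    rw [hm]
    exact (Term.rename_subst _ _ t).symm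

end GermEnv

/-- The germ of a closed term. -/
noncomputable def Germ.closed {σ : Ty} (t : Term L [] σ) : Germ L σ :=
  GermEnv.germ (Γ := []) (fun _ _ x => nomatch x) t

namespace Tower
variable {T : ∀ Γ : Ctx, Set (Formula L Γ)} (W : Tower T) {σ τ : Ty}

/-- The hereditarily extensional partial equivalence relation on germs. -/
def Per : (σ : Ty) → Germ L σ → Germ L σ → Prop
  | .nat, a, b => W.Tr fun m => a.at_ m ≐ b.at_ m
  | .arr ρ τ, f, g => ∀ a b : Germ L ρ, Per ρ a b → Per τ (f.app a) (g.app b)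

/-- From some stage on, all equations `a u₁ ⋯ uₖ = b u₁ ⋯ uₖ` are derivable. -/
def AppsEq (a b : Germ L σ) : Prop :=
  ∀ᶠ m in atTop, ∀ u, Derives T (W.hyps m) ((a.at_ m).apps u ≐ (b.at_ m).apps u)

variable {W}

theorem AppsEq.app {f g : Germ L (σ ⇾ τ)} (h : W.AppsEq f g) (a : Germ L σ) :
    W.AppsEq (f.app a) (g.app a) :=
  h.mono fun m d u => d (.cons (a.at_ m) u)

variable [ClassicalTheory T]

theorem Per.symm {a b : Germ L σ} (h : W.Per σ a b) : W.Per σ b a := by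
  induction σ with
  | nat =>
    filter_upwards [h] with m d
    exact .impE (.eha (.eq_symm _ _)) d
  | arr ρ τ ihρ ihτ => exact fun a b hab => ihτ (h b a (ihρ hab))

theorem Per.trans {a b c : Germ L σ} (h : W.Per σ a b) (h' : W.Per σ b c) : W.Per σ a c := by
  induction σ with
  | nat =>
    filter_upwards [h, h'] with m d d'
    exact .impE (.impE (.eha (.eq_trans _ _ _)) d) d'
  | arr ρ τ ihρ ihτ => exact fun a b hab => ihτ (h a b hab) (h' b b (ihρ hab.symm hab))

theorem AppsEq.trans {a b c : Germ L σ} (h : W.AppsEq a b) (h' : W.AppsEq b c) :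
    W.AppsEq a c := by
  filter_upwards [h, h'] with m d d' u
  exact .impE (.impE (.eha (.eq_trans _ _ _)) (d u)) (d' u)

theorem Per.congr {a a' b b' : Germ L σ} (h : W.Per σ a b) (ha : W.AppsEq a' a)
    (hb : W.AppsEq b' b) : W.Per σ a' b' := by
  induction σ with
  | nat =>
    have ha : W.Per .nat a' a := ha.mono fun m d => d .nil
    have hb : W.Per .nat b' b := hb.mono fun m d => d .nil
    exact (ha.trans h).trans hb.symm
  | arr ρ τ _ ih => exact fun c c' hc => ih (h c c' hc) (ha.app c) (hb.app c')

theorem Per.of_appsEq {a b : Germ L σ} (hb : W.Per σ b b) (h : W.AppsEq a b) : W.Per σ a b :=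
  hb.congr h (.of_forall fun _ _ => .eha (.eq_refl _))

theorem appsEq_proj {ρ τ : Ty} (a : Germ L ρ) (b : Germ L τ) :
    W.AppsEq (((Germ.closed (.proj ρ τ)).app a).app b) a :=
  .of_forall fun _ u => .eha (.proj _ _ u)

theorem appsEq_comb {δ ρ τ : Ty} (a : Germ L (δ ⇾ ρ ⇾ τ)) (b : Germ L (δ ⇾ ρ)) (c : Germ L δ) :
    W.AppsEq ((((Germ.closed (.comb δ ρ τ)).app a).app b).app c) ((a.app c).app (b.app c)) :=
  .of_forall fun _ u => .eha (.comb _ _ _ u)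

theorem appsEq_rec_zero (h : L.recTy σ) (y : Germ L σ) (z : Germ L (σ ⇾ .nat ⇾ σ)) :
    W.AppsEq ((((Germ.closed (.recursor σ h)).app (.closed .zero)).app y).app z) y :=
  .of_forall fun _ u => .eha (.rec_zero h _ _ u)

theorem appsEq_rec_succ (h : L.recTy σ) (n : Germ L .nat) (y : Germ L σ)
    (z : Germ L (σ ⇾ .nat ⇾ σ)) :
    W.AppsEq ((((Germ.closed (.recursor σ h)).app ((Germ.closed .succ).app n)).app y).app z)
      ((z.app ((((Germ.closed (.recursor σ h)).app n).app y).app z)).app n) :=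
  .of_forall fun _ u => .eha (.rec_succ h _ _ _ u)

theorem per_proj (ρ τ : Ty) : W.Per _ (.closed (.proj ρ τ)) (.closed (.proj ρ τ)) :=
  fun _ _ ha _ _ _ => ha.congr (appsEq_proj _ _) (appsEq_proj _ _)

theorem per_comb (δ ρ τ : Ty) : W.Per _ (.closed (.comb δ ρ τ)) (.closed (.comb δ ρ τ)) :=
  fun _ _ ha _ _ hb c c' hc =>
    (ha c c' hc _ _ (hb c c' hc)).congr (appsEq_comb _ _ _) (appsEq_comb _ _ _)

theorem eqAt_coherent (h : σ.ArgsIn L) (a b : Germ L σ) :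
    Coherent fun m => Formula.eqAt σ h (a.at_ m) (b.at_ m) := by
  filter_upwards [a.coh, b.coh] with m ha hb
  simp only [ha, hb, Formula.shift, Term.shift, Term.rename_eq_subst, Formula.rename_eq_subst,
    Formula.eqAt_subst]
  rfl

theorem appsEq_app_of_eqAt {ρ : Ty} (h : ρ.ArgsIn L) {a b : Germ L ρ}
    (hab : W.Tr fun m => Formula.eqAt ρ h (a.at_ m) (b.at_ m)) (f : Germ L (ρ ⇾ τ)) :
    W.AppsEq (f.app a) (f.app b) :=
  hab.mono fun _ d u => .impE (.eha (.ext h _ _ _ u)) d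

variable [L.Regular]

theorem per_self_and_tr_eqAt (h : σ.ArgsIn L) : (∀ a, W.Per σ a a) ∧
    ∀ a b, W.Per σ a b → W.Tr fun m => Formula.eqAt σ h (a.at_ m) (b.at_ m) := by
  induction σ with
  | nat => exact ⟨fun _ => .of_forall fun _ => .eha (.eq_refl _), fun _ _ => id⟩
  | arr ρ τ ihρ ihτ =>
    have hρ := Fragment.Regular.argsIn_of_varTy h.1
    refine ⟨fun f a b hab => ?_, fun f g hfg => (tr_all_iff (eqAt_coherent h f g)).2 fun a => ?_⟩
    · exact ((ihτ h.2).1 (f.app b)).of_appsEq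
        (appsEq_app_of_eqAt hρ ((ihρ hρ).2 a b hab) f)
    · refine ((ihτ h.2).2 _ _ (hfg a a ((ihρ hρ).1 a))).mono fun m d => ?_
      simp only [Formula.inst, Formula.eqAt_subst, Term.subst, Term.shift_subst_single]
      exact d

theorem per_self (h : σ.ArgsIn L) (a : Germ L σ) : W.Per σ a a := (per_self_and_tr_eqAt h).1 a

theorem Per.appsEq_app {ρ : Ty} (h : ρ.ArgsIn L) {a b : Germ L ρ} (hab : W.Per ρ a b)
    (f : Germ L (ρ ⇾ τ)) : W.AppsEq (f.app a) (f.app b) :=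
  appsEq_app_of_eqAt h ((per_self_and_tr_eqAt h).2 a b hab) f

theorem per_recursor (σ : Ty) (h : L.recTy σ) :
    W.Per _ (.closed (.recursor σ h)) (.closed (.recursor σ h)) := by
  intro n n' hn y y' hy z z' hz
  have hσ : L.varTy σ := Fragment.Regular.varTy_of_recTy h
  have hargs : σ.ArgsIn L := Fragment.Regular.argsIn_of_varTy hσ
  refine (per_self hargs _).of_appsEq ?_
  have hn := ((hn.appsEq_app (ρ := .nat) trivial (.closed (.recursor σ h))).app y).app z
  have hy := (hy.appsEq_app hargs ((Germ.closed (.recursor σ h)).app n')).app z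
  exact (hn.trans hy).trans (hz.appsEq_app (ρ := σ ⇾ .nat ⇾ σ) ⟨hσ, L.nat_mem, hargs⟩ _)

theorem per_germ {ν : GermEnv L Γ} (t : Term L Γ σ) : W.Per σ (ν.germ t) (ν.germ t) := by
  induction t with
  | var h x => exact per_self (Fragment.Regular.argsIn_of_varTy h) _
  | zero => exact per_self (σ := .nat) trivial _
  | succ => exact per_self (σ := .nat ⇾ .nat) ⟨L.nat_mem, trivial⟩ _
  | add | mul => exact per_self (σ := .nat ⇾ .nat ⇾ .nat) ⟨L.nat_mem, L.nat_mem, trivial⟩ _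
  | proj ρ τ => exact per_proj ρ τ
  | comb δ ρ τ => exact per_comb δ ρ τ
  | recursor σ h => exact per_recursor σ h
  | app _ _ ihs iht => exact ihs _ _ iht

variable (W)

/-- The setoid on the self-related germs. -/
def setoid (σ : Ty) : Setoid {a : Germ L σ // W.Per σ a a} where
  r a b := W.Per σ a.1 b.1
  iseqv := ⟨fun a => a.2, Per.symm, Per.trans⟩

/-- The extensional collapse of the germs. -/
noncomputable def model : Struct L where
  D σ := Quotient (W.setoid σ)
  app := Quotient.map₂ (fun f a => ⟨f.1.app a.1, f.2 _ _ a.2⟩) fun _ _ h _ _ h' => h _ _ h'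
  zero := ⟦⟨.closed .zero, per_germ _⟩⟧
  succ := ⟦⟨.closed .succ, per_germ _⟩⟧
  add := ⟦⟨.closed .add, per_germ _⟩⟧
  mul := ⟦⟨.closed .mul, per_germ _⟩⟧
  proj ρ τ := ⟦⟨.closed (.proj ρ τ), per_germ _⟩⟧
  comb δ ρ τ := ⟦⟨.closed (.comb δ ρ τ), per_germ _⟩⟧
  recursor σ h := ⟦⟨.closed (.recursor σ h), per_germ _⟩⟧

/-- The object given by a self-related germ. -/
def toD (a : Germ L σ) (h : W.Per σ a a) : W.model.D σ := Quotient.mk (W.setoid σ) ⟨a, h⟩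

variable {W}

theorem toD_eq {a b : Germ L σ} {ha : W.Per σ a a} {hb : W.Per σ b b} :
    W.toD a ha = W.toD b hb ↔ W.Per σ a b := Quotient.eq (r := W.setoid σ)

theorem exists_toD (x : W.model.D σ) : ∃ a h, x = W.toD a h := by
  obtain ⟨a, rfl⟩ := Quotient.exists_rep x
  exact ⟨a.1, a.2, rfl⟩

theorem app_toD {f : Germ L (σ ⇾ τ)} {a : Germ L σ} (hf : W.Per _ f f) (ha : W.Per _ a a) :
    W.model.app (W.toD f hf) (W.toD a ha) = W.toD (f.app a) (hf _ _ ha) := rfl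

variable (W) in
/-- The assignment of objects given by an assignment of germs. -/
def env (ν : GermEnv L Γ) : W.model.Env Γ :=
  fun _ h x => W.toD (ν h x) (per_self (Fragment.Regular.argsIn_of_varTy h) _)

theorem exists_env (e : W.model.Env Γ) : ∃ ν, e = W.env ν := by
  choose ν hν he using fun σ (h : L.varTy σ) x => exists_toD (W := W) (σ := σ) (e h x)
  exact ⟨ν, funext fun σ => funext fun h => funext fun x => he σ h x⟩

theorem eval_env (ν : GermEnv L Γ) (t : Term L Γ σ) :
    W.model.eval (W.env ν) t = W.toD (ν.germ t) (per_germ t) := by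
  induction t with
  | app s t ihs iht =>
    rw [Struct.eval, ihs, iht, app_toD]
    rfl
  | _ => rfl

theorem forall_D_iff (h : L.varTy σ) {P : W.model.D σ → Prop} : (∀ x, P x) ↔
    ∀ a : Germ L σ, P (W.toD a (per_self (Fragment.Regular.argsIn_of_varTy h) a)) := by
  refine ⟨fun H a => H _, fun H x => ?_⟩
  obtain ⟨a, ha, rfl⟩ := exists_toD x
  exact H a

theorem env_cons {ρ : Ty} (h : L.varTy ρ) (a : Germ L ρ) (ν : GermEnv L Γ) :
    Struct.Env.cons (W.toD a (per_self (Fragment.Regular.argsIn_of_varTy h) a)) (W.env ν) =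
      W.env (ν.cons a) := by
  funext σ h x
  cases x <;> rfl

theorem sat_env (A : Formula L Γ) (ν : GermEnv L Γ) :
    W.model.Sat (W.env ν) A ↔ W.Tr fun m => A.subst (ν.sub m) := by
  induction A with
  | eq s t =>
    rw [Struct.Sat, eval_env, eval_env, toD_eq]
    rfl
  | bot => exact iff_of_false id not_tr_bot
  | and A B ihA ihB => exact (and_congr (ihA ν) (ihB ν)).trans tr_and_iff.symm
  | or A B ihA ihB => exact (or_congr (ihA ν) (ihB ν)).trans (tr_or_iff (ν.coherent_subst A)).symm
  | imp A B ihA ihB =>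
    exact (imp_congr (ihA ν) (ihB ν)).trans (tr_imp_iff (ν.coherent_subst A)).symm
  | all σ h A ih =>
    simp only [Struct.Sat, Formula.subst, forall_D_iff h, env_cons h, ih, GermEnv.cons_sub]
    simpa only [Formula.subst_lift_inst] using
      (tr_all_iff (ν.coherent_subst (.all σ h A))).symm
  | ex σ h A ih =>
    rw [Struct.Sat, ← not_forall_not, forall_D_iff h, not_forall_not]
    simp only [Formula.subst, env_cons h, ih, GermEnv.cons_sub]
    simpa only [Formula.subst_lift_inst] using
      (tr_ex_iff (ν.coherent_subst (.ex σ h A))).symm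

theorem models_model : W.model.Models T := by
  intro Γ A hA e
  obtain ⟨ν, rfl⟩ := exists_env e
  exact (sat_env A ν).2 (.of_forall fun m => .ax (ClassicalTheory.subst_mem _ hA))

instance : IsModel T W.model where
  proj_eq a b := by
    obtain ⟨a, ha, rfl⟩ := exists_toD a
    obtain ⟨b, hb, rfl⟩ := exists_toD b
    exact toD_eq.2 (ha.of_appsEq (appsEq_proj _ _))
  comb_eq a b c := by
    obtain ⟨a, ha, rfl⟩ := exists_toD a
    obtain ⟨b, hb, rfl⟩ := exists_toD b
    obtain ⟨c, hc, rfl⟩ := exists_toD c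
    exact toD_eq.2 ((ha _ _ hc _ _ (hb _ _ hc)).of_appsEq (appsEq_comb _ _ _))
  rec_zero h y z := by
    obtain ⟨y, hy, rfl⟩ := exists_toD y
    obtain ⟨z, hz, rfl⟩ := exists_toD z
    exact toD_eq.2 (hy.of_appsEq (appsEq_rec_zero h _ _))
  rec_succ h n y z := by
    obtain ⟨n, hn, rfl⟩ := exists_toD n
    obtain ⟨y, hy, rfl⟩ := exists_toD y
    obtain ⟨z, hz, rfl⟩ := exists_toD z
    refine toD_eq.2 (Per.of_appsEq ?_ (appsEq_rec_succ h _ _ _))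
    exact per_self (Fragment.Regular.argsIn_of_varTy (Fragment.Regular.varTy_of_recTy h)) _
  models := models_model

end Tower

end Henkin

theorem exists_countermodel {L : Fragment} [L.Regular] {T : ∀ Γ : Ctx, Set (Formula L Γ)}
    [ClassicalTheory T] {Φ : Sentence L} (hΦ : ¬ Provable T Φ) :
    ∃ M : Struct L, IsModel T M ∧ ¬ M.Sat .nil Φ := by
  obtain ⟨W, hW⟩ := Henkin.exists_tower (H₀ := [Φ.neg]) fun d => hΦ (.byContra d)
  let ν : Henkin.GermEnv L [] := fun _ _ x => nomatch x
  refine ⟨W.model, inferInstance, fun h => ?_⟩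
  rw [← Struct.Env.eq_nil (W.env ν), Henkin.Tower.sat_env] at h
  refine Henkin.Tower.not_tr_neg h (.of_forall fun m => .hyp ?_)
  have hsub {Δ : Ctx} (s s' : Sub L [] Δ) : s = s' := by
    funext _ _ x
    cases x
  change Φ.neg.subst (ν.sub m) ∈ W.hyps m
  induction m with
  | zero =>
    have : Φ.neg.subst (ν.sub 0) = Φ.neg :=
      (congrArg (Φ.neg.subst ·) (hsub _ fun _ h x => .var h x)).trans (Formula.subst_var _)
    exact (congrArg₂ (· ∈ ·) this hW).mpr List.mem_cons_self
  | succ m ih =>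
    have : (Φ.neg.subst (ν.sub m)).shift = Φ.neg.subst (ν.sub (m + 1)) :=
      (Formula.rename_subst ..).trans (congrArg (Φ.neg.subst ·) (hsub _ _))
    exact cast (congrArg (· ∈ W.hyps (m + 1)) this) (W.mono m (List.mem_map_of_mem ih))

/-! ### Definability with parameters -/

/-- Inclusion of the first part of a context. -/
def Ren.inl {Δ : Ctx} : {Γ : Ctx} → Ren Γ (Γ ++ Δ)
  | [] => fun _ x => nomatch x
  | _ :: _ => fun
    | _, .zero => .zero
    | _, .succ x => .succ (Ren.inl x)

/-- Inclusion of the second part of a context. -/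
def Ren.inr {Δ : Ctx} : (Γ : Ctx) → Ren Δ (Γ ++ Δ)
  | [] => fun _ x => x
  | _ :: Γ => fun _ x => .succ (Ren.inr Γ x)

/-- Renaming of the second part of a context. -/
def Ren.liftAll {Δ₁ Δ₂ : Ctx} (r : Ren Δ₁ Δ₂) : (Γ : Ctx) → Ren (Γ ++ Δ₁) (Γ ++ Δ₂)
  | [] => r
  | _ :: Γ => (r.liftAll Γ).lift

namespace Struct
variable {L : Fragment} {M : Struct L} {Γ Δ Δ₁ Δ₂ : Ctx} {ρ σ τ : Ty}

/-- Concatenation of assignments. -/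
def Env.append : {Γ : Ctx} → M.Env Γ → M.Env Δ → M.Env (Γ ++ Δ)
  | [], _, p => p
  | _ :: _, e, p => fun
    | _, h, .zero => e h .zero
    | _, h, .succ x => Env.append (fun _ h x => e h (.succ x)) p h x

theorem Env.append_cons (a : M.D ρ) (e : M.Env Γ) (p : M.Env Δ) :
    (Env.cons a e).append p = .cons a (e.append p) := by
  funext _ _ x
  cases x <;> rfl

theorem Env.append_inl (e : M.Env Γ) (p : M.Env Δ) (h : L.varTy σ) (x : Var Γ σ) :
    e.append p h (Ren.inl x) = e h x := by
  induction x with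
  | zero => rfl
  | succ _ ih => exact ih (fun _ h x => e h x.succ) h

theorem Env.append_inr (e : M.Env Γ) (p : M.Env Δ) (h : L.varTy σ) (x : Var Δ σ) :
    e.append p h (Ren.inr Γ x) = p h x := by
  induction Γ with
  | nil => rfl
  | cons ρ Γ ih => exact ih fun _ h x => e h x.succ

theorem Env.append_liftAll (r : Ren Δ₁ Δ₂) (e : M.Env Γ) (p : M.Env Δ₂) :
    (fun _ h x => e.append p h (r.liftAll Γ x)) = e.append fun _ h x => p h (r x) := by
  induction Γ with
  | nil => rfl
  | cons ρ Γ ih =>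
    funext σ h x
    cases x with
    | zero => rfl
    | succ x => exact congrFun₃ (ih fun _ h x => e h x.succ) σ h x

theorem sat_append_left (e : M.Env Γ) (p : M.Env Δ₁) (q : M.Env Δ₂) (A : Formula L (Γ ++ Δ₁)) :
    Sat (e.append (p.append q)) (A.rename (Ren.inl.liftAll Γ)) ↔ Sat (e.append p) A := by
  rw [sat_rename, Env.append_liftAll]
  simp only [Env.append_inl]

theorem sat_append_right (e : M.Env Γ) (p : M.Env Δ₁) (q : M.Env Δ₂) (A : Formula L (Γ ++ Δ₂)) :
    Sat (e.append (p.append q)) (A.rename ((Ren.inr Δ₁).liftAll Γ)) ↔ Sat (e.append q) A := by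
  rw [sat_rename, Env.append_liftAll]
  simp only [Env.append_inr]

theorem eval_append_left (e : M.Env Γ) (p : M.Env Δ₁) (q : M.Env Δ₂)
    (t : Term L (Γ ++ Δ₁) σ) :
    eval (e.append (p.append q)) (t.rename (Ren.inl.liftAll Γ)) = eval (e.append p) t := by
  rw [eval_rename, Env.append_liftAll]
  simp only [Env.append_inl]

theorem eval_append_right (e : M.Env Γ) (p : M.Env Δ₁) (q : M.Env Δ₂)
    (t : Term L (Γ ++ Δ₂) σ) :
    eval (e.append (p.append q)) (t.rename ((Ren.inr Δ₁).liftAll Γ)) = eval (e.append q) t := by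
  rw [eval_rename, Env.append_liftAll]
  simp only [Env.append_inr]

/-- The predicates on assignments that are given by a formula with parameters. -/
def Definable (P : M.Env Γ → Prop) : Prop :=
  ∃ (Δ : Ctx) (p : M.Env Δ) (A : Formula L (Γ ++ Δ)), ∀ e, P e ↔ Sat (e.append p) A

/-- The functions on assignments that are given by a term with parameters. -/
def TermDefinable (f : M.Env Γ → M.D σ) : Prop :=
  ∃ (Δ : Ctx) (p : M.Env Δ) (t : Term L (Γ ++ Δ) σ), ∀ e, f e = eval (e.append p) t

/-- Definability of a predicate of one number. -/
abbrev DefinablePred (P : M.D .nat → Prop) : Prop :=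
  Definable fun e : M.Env [.nat] => P (e L.nat_mem .zero)

namespace TermDefinable

theorem var {h : L.varTy σ} {x : Var Γ σ} : TermDefinable fun e : M.Env Γ => e h x :=
  ⟨[], .nil, .var h (Ren.inl x), fun e => (e.append_inl .nil h x).symm⟩

theorem param (h : L.varTy σ) (a : M.D σ) : TermDefinable fun _ : M.Env Γ => a :=
  ⟨[σ], .cons a .nil, .var h (Ren.inr Γ .zero), fun e => (e.append_inr (.cons a .nil) h .zero).symm⟩

theorem const {a : M.D .nat} : TermDefinable fun _ : M.Env Γ => a := param L.nat_mem a

theorem closed (t : ∀ {Δ : Ctx}, Term L Δ σ) {a : M.D σ}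
    (h : ∀ {Δ : Ctx} (e : M.Env Δ), eval e t = a) : TermDefinable fun _ : M.Env Γ => a :=
  ⟨[], .nil, t, fun _ => (h _).symm⟩

theorem app {f : M.Env Γ → M.D (σ ⇾ τ)} {g : M.Env Γ → M.D σ} (hf : TermDefinable f)
    (hg : TermDefinable g) : TermDefinable fun e => M.app (f e) (g e) := by
  obtain ⟨Δ₁, p, s, hs⟩ := hf
  obtain ⟨Δ₂, q, t, ht⟩ := hg
  refine ⟨Δ₁ ++ Δ₂, p.append q,
    .app (s.rename (Ren.inl.liftAll Γ)) (t.rename ((Ren.inr Δ₁).liftAll Γ)), fun e => ?_⟩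
  simp only [eval, eval_append_left, eval_append_right, hs, ht]

theorem weaken {f : M.Env Γ → M.D τ} (hf : TermDefinable f) :
    TermDefinable fun e : M.Env (σ :: Γ) => f fun _ h x => e h (.succ x) := by
  obtain ⟨Δ, p, t, ht⟩ := hf
  refine ⟨Δ, p, t.shift, fun e => (ht _).trans ?_⟩
  rw [Term.shift, eval_rename]
  rfl

end TermDefinable

namespace Definable
variable {P Q : M.Env Γ → Prop}

theorem bot : Definable fun _ : M.Env Γ => False := ⟨[], .nil, .bot, fun _ => .rfl⟩

theorem eq {f g : M.Env Γ → M.D .nat} (hf : TermDefinable f) (hg : TermDefinable g) :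
    Definable fun e => f e = g e := by
  obtain ⟨Δ₁, p, s, hs⟩ := hf
  obtain ⟨Δ₂, q, t, ht⟩ := hg
  refine ⟨Δ₁ ++ Δ₂, p.append q,
    s.rename (Ren.inl.liftAll Γ) ≐ t.rename ((Ren.inr Δ₁).liftAll Γ), fun e => ?_⟩
  simp only [Sat, eval_append_left, eval_append_right, hs, ht]

theorem exists_common (hP : Definable P) (hQ : Definable Q) :
    ∃ (Δ : Ctx) (p : M.Env Δ) (A B : Formula L (Γ ++ Δ)),
      ∀ e, (P e ↔ Sat (e.append p) A) ∧ (Q e ↔ Sat (e.append p) B) := by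
  obtain ⟨Δ₁, p, A, hA⟩ := hP
  obtain ⟨Δ₂, q, B, hB⟩ := hQ
  refine ⟨Δ₁ ++ Δ₂, p.append q, A.rename (Ren.inl.liftAll Γ),
    B.rename ((Ren.inr Δ₁).liftAll Γ), fun e => ?_⟩
  rw [sat_append_left, sat_append_right]
  exact ⟨hA e, hB e⟩

theorem and (hP : Definable P) (hQ : Definable Q) : Definable fun e => P e ∧ Q e :=
  have ⟨Δ, p, A, B, h⟩ := hP.exists_common hQ
  ⟨Δ, p, A.and B, fun e => and_congr (h e).1 (h e).2⟩

theorem or (hP : Definable P) (hQ : Definable Q) : Definable fun e => P e ∨ Q e :=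
  have ⟨Δ, p, A, B, h⟩ := hP.exists_common hQ
  ⟨Δ, p, A.or B, fun e => or_congr (h e).1 (h e).2⟩

theorem imp (hP : Definable P) (hQ : Definable Q) : Definable fun e => P e → Q e :=
  have ⟨Δ, p, A, B, h⟩ := hP.exists_common hQ
  ⟨Δ, p, A.imp B, fun e => imp_congr (h e).1 (h e).2⟩

theorem iff (hP : Definable P) (hQ : Definable Q) : Definable fun e => P e ↔ Q e := by
  simp only [iff_iff_implies_and_implies]
  exact (hP.imp hQ).and (hQ.imp hP)

theorem not (hP : Definable P) : Definable fun e => ¬ P e := hP.imp bot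

theorem all {h : L.varTy σ} {Q : M.D σ → M.Env Γ → Prop}
    (hQ : Definable fun e : M.Env (σ :: Γ) => Q (e h .zero) fun _ h x => e h (.succ x)) :
    Definable fun e => ∀ a, Q a e := by
  obtain ⟨Δ, p, A, hA⟩ := hQ
  exact ⟨Δ, p, .all σ h A, fun e => forall_congr' fun a => Env.append_cons a e p ▸ hA (.cons a e)⟩

theorem ex {h : L.varTy σ} {Q : M.D σ → M.Env Γ → Prop}
    (hQ : Definable fun e : M.Env (σ :: Γ) => Q (e h .zero) fun _ h x => e h (.succ x)) :
    Definable fun e => ∃ a, Q a e := by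
  obtain ⟨Δ, p, A, hA⟩ := hQ
  exact ⟨Δ, p, .ex σ h A, fun e => exists_congr fun a => Env.append_cons a e p ▸ hA (.cons a e)⟩

theorem allNat {Q : M.D .nat → M.Env Γ → Prop} (hQ : Definable fun e : M.Env (.nat :: Γ) =>
    Q (e L.nat_mem .zero) fun _ h x => e h (.succ x)) : Definable fun e => ∀ a, Q a e := all hQ

theorem exNat {Q : M.D .nat → M.Env Γ → Prop} (hQ : Definable fun e : M.Env (.nat :: Γ) =>
    Q (e L.nat_mem .zero) fun _ h x => e h (.succ x)) : Definable fun e => ∃ a, Q a e := ex hQ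

theorem comp {P : M.D .nat → Prop} {f : M.Env Γ → M.D .nat} (hP : DefinablePred P)
    (hf : TermDefinable f) : Definable fun e => P (f e) := by
  have hQ : Definable fun e : M.Env Γ => ∃ n, n = f e ∧ P n := by
    refine exNat (.and (.eq .var hf.weaken) ?_)
    obtain ⟨Δ, p, A, hA⟩ := hP
    refine ⟨Δ, p, A.rename (Ren.lift (Ren.inr Γ)), fun e => ?_⟩
    rw [sat_rename]
    refine (hA (.cons (e L.nat_mem .zero) .nil)).trans (iff_of_eq (congrArg (Sat · A) ?_))
    funext σ h x
    cases x with
    | zero => rfl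
    | succ x => exact (Env.append_inr (fun _ h x => e h x.succ) p h x).symm
  simpa only [exists_eq_left] using hQ

end Definable

end Struct

namespace Struct

/-- The numbers of a structure. -/
abbrev N {L : Fragment} (M : Struct L) : Type := M.D .nat

variable {M : Struct .second}

/-! ### Arithmetic in models of `RCA` -/

instance : Zero M.N := ⟨M.zero⟩
instance : One M.N := ⟨M.app M.succ M.zero⟩
instance : Add M.N := ⟨fun a b => M.app (M.app M.add a) b⟩
instance : Mul M.N := ⟨fun a b => M.app (M.app M.mul a) b⟩

namespace TermDefinable
variable {Γ : Ctx} {f g : M.Env Γ → M.N}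

theorem add (hf : TermDefinable f) (hg : TermDefinable g) : TermDefinable fun e => f e + g e :=
  .app (.app (.closed .add fun _ => rfl) hf) hg

theorem mul (hf : TermDefinable f) (hg : TermDefinable g) : TermDefinable fun e => f e * g e :=
  .app (.app (.closed .mul fun _ => rfl) hf) hg

end TermDefinable

namespace N
variable [hM : IsModel RCA M]

theorem sat_axiom {Γ : Ctx} {A : Formula .second Γ} (h : EHA .second Γ A) (e : M.Env Γ) :
    M.Sat e A :=
  hM.models (ClassicalTheory.eha_mem h) e

/-- A variable for a number. -/
abbrev numVar {Γ : Ctx} (x : Var Γ .nat) : Term .second Γ .nat := .var Fragment.second.nat_mem x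

theorem add_zero (a : M.N) : a + 0 = a :=
  sat_axiom (.add_zero (numVar .zero)) (.cons a .nil)

theorem app_succ (a : M.N) : M.app M.succ a = a + 1 :=
  ((sat_axiom (.add_succ (numVar .zero) .zero) (.cons a .nil)).trans
    (congrArg (M.app M.succ) (add_zero a))).symm

theorem add_succ (a b : M.N) : a + (b + 1) = a + b + 1 := by
  rw [← app_succ, ← app_succ]
  exact sat_axiom (.add_succ (numVar .zero) (numVar (.succ .zero))) (.cons a (.cons b .nil))

theorem mul_zero (a : M.N) : a * 0 = 0 :=
  sat_axiom (.mul_zero (numVar .zero)) (.cons a .nil)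

theorem mul_succ (a b : M.N) : a * (b + 1) = a * b + a := by
  rw [← app_succ]
  exact sat_axiom (.mul_succ (numVar .zero) (numVar (.succ .zero))) (.cons a (.cons b .nil))

theorem succ_ne_zero (a : M.N) : a + 1 ≠ 0 := by
  rw [← app_succ]
  exact sat_axiom (.succ_ne_zero (numVar .zero)) (.cons a .nil)

theorem succ_inj {a b : M.N} (h : a + 1 = b + 1) : a = b := by
  rw [← app_succ, ← app_succ] at h
  exact sat_axiom (.succ_inj (numVar .zero) (numVar (.succ .zero))) (.cons a (.cons b .nil)) h

theorem induction {P : M.N → Prop} (hP : DefinablePred P) (zero : P 0)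
    (succ : ∀ n, P n → P (n + 1)) (n : M.N) : P n := by
  obtain ⟨Δ, p, A, hA⟩ := hP
  have iff (n : M.N) : P n ↔ M.Sat (.cons n p) A :=
    Env.append_cons n Env.nil p ▸ hA (.cons n .nil)
  refine (iff n).2 (sat_axiom (.induction A) p ?_ (fun n hn => ?_) n)
  · exact (sat_inst _ _ _).2 ((iff 0).1 zero)
  · rw [sat_step, app_succ, ← iff]
    exact succ n ((iff n).2 hn)

theorem zero_add (a : M.N) : 0 + a = a := by
  refine induction (P := fun a => 0 + a = a) (.eq (.add .const .var) .var) (add_zero 0) ?_ a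
  intro n hn
  rw [add_succ, hn]

theorem succ_add (a b : M.N) : a + 1 + b = a + b + 1 := by
  refine induction (P := fun b => a + 1 + b = a + b + 1)
    (.eq (.add .const .var) (.add (.add .const .var) .const)) ?_ ?_ b
  · rw [add_zero, add_zero]
  · intro n hn
    rw [add_succ, hn, add_succ]

theorem add_comm (a b : M.N) : a + b = b + a := by
  refine induction (P := fun b => a + b = b + a)
    (.eq (.add .const .var) (.add .var .const)) ?_ ?_ b
  · rw [add_zero, zero_add]
  · intro n hn
    rw [add_succ, hn, succ_add]

theorem add_assoc (a b c : M.N) : a + b + c = a + (b + c) := by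
  refine induction (P := fun c => a + b + c = a + (b + c))
    (.eq (.add .const .var) (.add .const (.add .const .var))) ?_ ?_ c
  · rw [add_zero, add_zero]
  · intro n hn
    rw [add_succ, hn, add_succ, add_succ]

instance : AddCommMonoid M.N where
  add_assoc := add_assoc
  zero_add := zero_add
  add_zero := add_zero
  add_comm := add_comm
  nsmul := nsmulRec

theorem zero_mul (a : M.N) : 0 * a = 0 := by
  refine induction (P := fun a => 0 * a = 0) (.eq (.mul .const .var) .const) (mul_zero 0) ?_ a
  intro n hn
  rw [mul_succ, hn, add_zero]

theorem succ_mul (a b : M.N) : (a + 1) * b = a * b + b := by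
  refine induction (P := fun b => (a + 1) * b = a * b + b)
    (.eq (.mul .const .var) (.add (.mul .const .var) .var)) ?_ ?_ b
  · rw [mul_zero, mul_zero, add_zero]
  · intro n hn
    rw [mul_succ, hn, mul_succ]
    abel

theorem mul_comm (a b : M.N) : a * b = b * a := by
  refine induction (P := fun b => a * b = b * a)
    (.eq (.mul .const .var) (.mul .var .const)) ?_ ?_ b
  · rw [mul_zero, zero_mul]
  · intro n hn
    rw [mul_succ, hn, succ_mul]

theorem mul_add (a b c : M.N) : a * (b + c) = a * b + a * c := by
  refine induction (P := fun c => a * (b + c) = a * b + a * c)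
    (.eq (.mul .const (.add .const .var)) (.add .const (.mul .const .var))) ?_ ?_ c
  · rw [add_zero, mul_zero, add_zero]
  · intro n hn
    rw [add_succ, mul_succ, hn, mul_succ, add_assoc]

theorem mul_assoc (a b c : M.N) : a * b * c = a * (b * c) := by
  refine induction (P := fun c => a * b * c = a * (b * c))
    (.eq (.mul .const .var) (.mul .const (.mul .const .var))) ?_ ?_ c
  · rw [mul_zero, mul_zero, mul_zero]
  · intro n hn
    rw [mul_succ, hn, mul_succ, mul_add]

theorem mul_one (a : M.N) : a * 1 = a := by
  rw [← zero_add 1, mul_succ, mul_zero, zero_add]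

instance : CommSemiring M.N where
  left_distrib := mul_add
  right_distrib a b c := by rw [mul_comm, mul_add, mul_comm c a, mul_comm c b]
  zero_mul := zero_mul
  mul_zero := mul_zero
  mul_assoc := mul_assoc
  one_mul a := by rw [mul_comm, mul_one]
  mul_one := mul_one
  mul_comm := mul_comm

theorem eq_zero_or_succ (a : M.N) : a = 0 ∨ ∃ b, a = b + 1 :=
  induction (P := fun a => a = 0 ∨ ∃ b, a = b + 1)
    (.or (.eq .var .const) (.exNat (.eq .var (.add .var .const)))) (.inl rfl)
    (fun n _ => .inr ⟨n, rfl⟩) a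

theorem add_right_cancel (a b c : M.N) : b + a = c + a → b = c := by
  refine induction (P := fun a => b + a = c + a → b = c)
    (.imp (.eq (.add .const .var) (.add .const .var)) (.eq .const .const)) ?_ ?_ a
  · simp only [add_zero, imp_self]
  · intro n hn h
    rw [add_succ, add_succ] at h
    exact hn (succ_inj h)

instance : IsCancelAdd M.N where
  add_left_cancel a b c h :=
    add_right_cancel a b c (by rwa [add_comm b, add_comm c])
  add_right_cancel a b c := add_right_cancel a b c

theorem eq_zero_of_add_eq_zero {a b : M.N} (h : a + b = 0) : b = 0 := by
  rcases eq_zero_or_succ b with rfl | ⟨b, rfl⟩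
  · rfl
  · rw [add_succ] at h
    exact absurd h (succ_ne_zero _)

instance : LE M.N := ⟨fun a b => ∃ c, b = a + c⟩

theorem le_total (a b : M.N) : a ≤ b ∨ b ≤ a := by
  refine induction (P := fun a => (∃ c, b = a + c) ∨ ∃ c, a = b + c)
    (.or (.exNat (.eq .const (.add .var .var))) (.exNat (.eq .var (.add .const .var)))) ?_ ?_ a
  · exact .inl ⟨b, (zero_add b).symm⟩
  · rintro n (⟨c, rfl⟩ | ⟨c, rfl⟩)
    · rcases eq_zero_or_succ c with rfl | ⟨c, rfl⟩
      · exact .inr ⟨1, by rw [add_zero]⟩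
      · exact .inl ⟨c, by ring⟩
    · exact .inr ⟨c + 1, by ring⟩

theorem le_antisymm {a b : M.N} : a ≤ b → b ≤ a → a = b := by
  rintro ⟨c, rfl⟩ ⟨d, hd⟩
  rw [add_assoc, left_eq_add, add_comm] at hd
  rw [eq_zero_of_add_eq_zero hd, add_zero]

noncomputable instance : LinearOrder M.N where
  le_refl a := ⟨0, (add_zero a).symm⟩
  le_trans := by
    rintro a _ _ ⟨c, rfl⟩ ⟨d, rfl⟩
    exact ⟨c + d, add_assoc _ _ _⟩
  le_antisymm _ _ := le_antisymm
  le_total := le_total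
  toDecidableLE := Classical.decRel _

instance : CanonicallyOrderedAdd M.N where
  exists_add_of_le := id
  le_add_self _ b := ⟨b, add_comm _ _⟩
  le_self_add _ b := ⟨b, rfl⟩

instance : IsOrderedAddMonoid M.N where
  add_le_add_left := by
    rintro a _ ⟨c, rfl⟩ b
    exact ⟨c, by ring⟩

theorem add_one_le_iff {a b : M.N} : a + 1 ≤ b ↔ a < b := by
  constructor
  · rintro ⟨c, rfl⟩
    refine lt_of_le_of_ne ⟨1 + c, add_assoc _ _ _⟩ fun h => succ_ne_zero c ?_
    rwa [add_assoc, left_eq_add, add_comm] at h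
  · intro h
    obtain ⟨c, rfl⟩ := h.le
    rcases eq_zero_or_succ c with rfl | ⟨c, rfl⟩
    · exact absurd (add_zero a).symm h.ne
    · exact ⟨c, by ring⟩

noncomputable instance : SuccOrder M.N := .ofSuccLeIff (· + 1) add_one_le_iff

noncomputable instance : SuccAddOrder M.N := ⟨fun _ => rfl⟩

instance : NoMaxOrder M.N := ⟨fun a => ⟨a + 1, add_one_le_iff.1 le_rfl⟩⟩

instance : Nontrivial M.N :=
  ⟨1, 0, zero_add (1 : M.N) ▸ succ_ne_zero 0⟩

theorem mul_lt_mul_left {a b c : M.N} (ha : 0 < a) (h : b < c) : a * b < a * c := by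
  obtain ⟨d, rfl⟩ := Order.add_one_le_of_lt h
  rw [show a * (b + 1 + d) = a * b + (a + a * d) by ring]
  exact lt_add_of_pos_right _ (ha.trans_le le_self_add)

instance : IsStrictOrderedRing M.N where
  zero_le_one := zero_le
  le_of_add_le_add_left _ _ _ := le_of_add_le_add_left
  mul_lt_mul_of_pos_left _ ha _ _ := mul_lt_mul_left ha
  mul_lt_mul_of_pos_right a ha b c h := by
    simpa only [mul_comm] using mul_lt_mul_left ha h

end N

namespace Definable
variable {Γ : Ctx} {f g : M.Env Γ → M.N}

theorem le (hf : TermDefinable f) (hg : TermDefinable g) : Definable fun e => f e ≤ g e :=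
  .exNat (.eq hg.weaken (.add hf.weaken .var))

theorem lt [IsModel RCA M] (hf : TermDefinable f) (hg : TermDefinable g) :
    Definable fun e => f e < g e := by
  simp only [← N.add_one_le_iff]
  exact .le (.add hf .const) hg

end Definable

theorem N.exists_least [IsModel RCA M] {P : M.N → Prop} (hP : DefinablePred P) {n : M.N}
    (hn : P n) : ∃ m, P m ∧ ∀ k < m, ¬ P k := by
  by_contra! h
  have : ∀ n, ∀ k < n, ¬ P k := by
    refine N.induction (.allNat (.imp (.lt .var .var) (.not (.comp hP .var)))) ?_ ?_
    · exact fun k hk => absurd hk not_lt_zero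
    · intro n ih k hk hPk
      obtain ⟨m, hm, hPm⟩ := h k hPk
      exact ih m (hm.trans_le (Order.lt_add_one_iff.1 hk)) hPm
  exact this (n + 1) n (lt_add_one n) hn

end Struct

theorem Fragment.one_mem : Fragment.second.varTy .one := .inr rfl

namespace Struct
variable {M : Struct .second}

/-! ### Representable functions -/

section
variable {ρ σ τ : Ty}

/-- The functions that are given by application of an object of the structure. -/
def Representable (φ : M.D σ → M.D τ) : Prop := ∃ f : M.D (σ ⇾ τ), ∀ a, M.app f a = φ a

/-- The binary functions that are given by repeated application of an object of the structure. -/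
def Representable₂ (φ : M.D ρ → M.D σ → M.D τ) : Prop :=
  ∃ f : M.D (ρ ⇾ σ ⇾ τ), ∀ a b, M.app (M.app f a) b = φ a b

theorem Representable.of_object (f : M.D (σ ⇾ τ)) : Representable fun a => M.app f a :=
  ⟨f, fun _ => rfl⟩

/-- The value `R₀ n y z` of the recursor. -/
def recN (n y : M.N) (z : M.D (.nat ⇾ .nat ⇾ .nat)) : M.N :=
  M.app (M.app (M.app (M.recursor .nat rfl) n) y) z

/-- An injective coding of pairs. The square root of `pair a b` is `a + b`, which makes it easy to
decode. -/
def pair (a b : M.N) : M.N := (a + b) * (a + b) + a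

theorem TermDefinable.recN {Γ : Ctx} {f g : M.Env Γ → M.N}
    {h : M.Env Γ → M.D (.nat ⇾ .nat ⇾ .nat)} (hf : TermDefinable f) (hg : TermDefinable g)
    (hh : TermDefinable h) : TermDefinable fun e => recN (f e) (g e) (h e) :=
  .app (.app (.app (.closed (.recursor .nat rfl) fun _ => rfl) hf) hg) hh

theorem TermDefinable.pair {Γ : Ctx} {f g : M.Env Γ → M.N} (hf : TermDefinable f)
    (hg : TermDefinable g) : TermDefinable fun e => pair (f e) (g e) :=
  .add (.mul (.add hf hg) (.add hf hg)) hf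

theorem TermDefinable.comp {Γ : Ctx} {φ : M.N → M.N} {f : M.Env Γ → M.N} (hφ : Representable φ)
    (hf : TermDefinable f) : TermDefinable fun e => φ (f e) := by
  obtain ⟨g, hg⟩ := hφ
  simp only [← hg]
  exact .app (.param Fragment.one_mem g) hf

variable [hM : IsModel RCA M]

theorem recN_zero (y : M.N) (z : M.D (.nat ⇾ .nat ⇾ .nat)) : recN 0 y z = y :=
  hM.rec_zero _ y z

theorem recN_succ (n y : M.N) (z : M.D (.nat ⇾ .nat ⇾ .nat)) :
    recN (n + 1) y z = M.app (M.app z (recN n y z)) n := by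
  rw [← N.app_succ]
  exact hM.rec_succ _ n y z

namespace Representable

theorem id : Representable fun a : M.D σ => a :=
  ⟨M.app (M.app (M.comb σ (.nat ⇾ σ) σ) (M.proj σ (.nat ⇾ σ))) (M.proj σ .nat), fun a => by
    simp only [hM.comb_eq, hM.proj_eq]⟩

theorem const (b : M.D τ) : Representable fun _ : M.D σ => b :=
  ⟨M.app (M.proj τ σ) b, fun a => hM.proj_eq b a⟩

theorem app {φ : M.D σ → M.D (ρ ⇾ τ)} {ψ : M.D σ → M.D ρ} (hφ : Representable φ)
    (hψ : Representable ψ) : Representable fun a => M.app (φ a) (ψ a) := by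
  obtain ⟨f, hf⟩ := hφ
  obtain ⟨g, hg⟩ := hψ
  exact ⟨M.app (M.app (M.comb σ ρ τ) f) g, fun a => by rw [hM.comb_eq, hf, hg]⟩

theorem comp {φ : M.D ρ → M.D τ} {ψ : M.D σ → M.D ρ} (hφ : Representable φ)
    (hψ : Representable ψ) : Representable fun a => φ (ψ a) := by
  obtain ⟨f, hf⟩ := hφ
  simp only [← hf]
  exact .app (.const f) hψ

variable {f g : M.D σ → M.N}

theorem add (hf : Representable f) (hg : Representable g) : Representable fun a => f a + g a :=
  .app (.app (.const _) hf) hg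

theorem mul (hf : Representable f) (hg : Representable g) : Representable fun a => f a * g a :=
  .app (.app (.const _) hf) hg

theorem pair (hf : Representable f) (hg : Representable g) :
    Representable fun a => pair (f a) (g a) :=
  .add (.mul (.add hf hg) (.add hf hg)) hf

theorem recN {h : M.D σ → M.D (.nat ⇾ .nat ⇾ .nat)} (hf : Representable f)
    (hg : Representable g) (hh : Representable h) :
    Representable fun a => recN (f a) (g a) (h a) :=
  .app (.app (.app (.const _) hf) hg) hh

end Representable

namespace Representable₂

theorem of_left {φ : M.D ρ → M.D τ} (hφ : Representable φ) :
    Representable₂ fun a (_ : M.D σ) => φ a := by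
  obtain ⟨f, hf⟩ := Representable.app (.const (M.proj τ σ)) hφ
  exact ⟨f, fun a b => by rw [hf, hM.proj_eq]⟩

theorem of_right {φ : M.D σ → M.D τ} (hφ : Representable φ) :
    Representable₂ fun (_ : M.D ρ) b => φ b := by
  obtain ⟨f, hf⟩ := hφ
  exact ⟨M.app (M.proj _ ρ) f, fun a b => by rw [hM.proj_eq, hf]⟩

theorem app {δ : Ty} {φ : M.D ρ → M.D σ → M.D (δ ⇾ τ)} {ψ : M.D ρ → M.D σ → M.D δ}
    (hφ : Representable₂ φ) (hψ : Representable₂ ψ) :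
    Representable₂ fun a b => M.app (φ a b) (ψ a b) := by
  obtain ⟨f, hf⟩ := hφ
  obtain ⟨g, hg⟩ := hψ
  obtain ⟨h, hh⟩ := Representable.app (.app (.const (M.comb σ δ τ)) (.of_object f)) (.of_object g)
  exact ⟨h, fun a b => by rw [hh, hM.comb_eq, hf, hg]⟩

theorem curry {φ : M.N → M.D τ} (hφ : Representable φ) :
    Representable₂ fun a b => φ (pair a b) := by
  obtain ⟨f, hf⟩ := hφ
  have add {g h : M.N → M.N → M.N} (hg : Representable₂ g) (hh : Representable₂ h) :
      Representable₂ fun a b => g a b + h a b := .app (.app (.of_left (.const _)) hg) hh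
  have sum : Representable₂ fun a b : M.N => a + b := add (.of_left .id) (.of_right .id)
  simp only [← hf]
  exact .app (.of_left (.const f))
    (add (.app (.app (.of_left (.const M.mul)) sum) sum) (.of_left .id))

end Representable₂

end

section
variable [hM : IsModel RCA M]

/-! ### Truncated subtraction -/

theorem exists_pred : ∃ f : M.D .one, M.app f 0 = 0 ∧ ∀ n, M.app f (n + 1) = n := by
  obtain ⟨z, hz⟩ := Representable₂.of_right (ρ := .nat) (Representable.id (M := M) (σ := .nat))
  obtain ⟨f, hf⟩ := Representable.recN (M := M) .id (.const 0) (.const z)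
  exact ⟨f, (hf 0).trans (recN_zero _ _),
    fun n => (hf (n + 1)).trans ((recN_succ _ _ _).trans (hz _ _))⟩

variable (M) in
/-- An object of type `1` for the predecessor function. -/
noncomputable def pred : M.D .one := (exists_pred (M := M)).choose

theorem pred_zero : M.app M.pred 0 = 0 := exists_pred.choose_spec.1

theorem pred_succ (n : M.N) : M.app M.pred (n + 1) = n := exists_pred.choose_spec.2 n

theorem pred_le_iff {n c : M.N} : M.app M.pred n ≤ c ↔ n ≤ c + 1 := by
  rcases N.eq_zero_or_succ n with rfl | ⟨n, rfl⟩
  · exact iff_of_true (pred_zero.trans_le zero_le) zero_le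
  · rw [pred_succ, add_le_add_iff_right]

variable (M) in
/-- The predecessor function as a step function for the recursor: `predStep r m = pred r`. -/
noncomputable def predStep : M.D (.nat ⇾ .nat ⇾ .nat) :=
  M.app (M.app (M.comb _ _ _) (M.app (M.proj _ _) (M.proj .nat .nat))) M.pred

theorem predStep_app (r m : M.N) : M.app (M.app M.predStep r) m = M.app M.pred r := by
  rw [predStep, hM.comb_eq, hM.proj_eq, hM.proj_eq]

noncomputable instance : _root_.Sub M.N := ⟨fun a b => recN b a M.predStep⟩

theorem TermDefinable.sub {Γ : Ctx} {f g : M.Env Γ → M.N} (hf : TermDefinable f)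
    (hg : TermDefinable g) : TermDefinable fun e => f e - g e :=
  .recN hg hf (.app (.app (.closed (.comb _ _ _) fun _ => rfl)
    (.app (.closed (.proj _ _) fun _ => rfl) (.closed (.proj _ _) fun _ => rfl)))
    (.param Fragment.one_mem M.pred))

theorem Representable.sub {σ : Ty} {f g : M.D σ → M.N} (hf : Representable f)
    (hg : Representable g) : Representable fun a => f a - g a :=
  .recN hg hf (.const _)

instance : OrderedSub M.N where
  tsub_le_iff_right a b c := by
    refine N.induction (P := fun b => ∀ c, a - b ≤ c ↔ a ≤ c + b)
      (.allNat (.iff (.le (.sub .const .var) .var) (.le .const (.add .var .var)))) ?_ ?_ b c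
    · intro c
      change recN 0 a _ ≤ c ↔ _
      rw [recN_zero, add_zero]
    · intro b ih c
      change recN (b + 1) a _ ≤ c ↔ _
      rw [recN_succ, predStep_app, pred_le_iff, add_comm b, ← add_assoc]
      exact ih (c + 1)

/-! ### Choice and decoding of pairs -/

theorem exists_choice {φ : M.N → M.N → M.N}
    (hφ : TermDefinable fun e : M.Env [.nat, .nat] =>
      φ (e Fragment.second.nat_mem (.succ .zero)) (e Fragment.second.nat_mem .zero))
    (h : ∀ x, ∃ y, φ x y = 0) : ∃ f : M.D .one, ∀ x, φ x (M.app f x) = 0 := by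
  obtain ⟨Δ, p, t, ht⟩ := hφ
  have sat_iff (x y : M.N) : φ x y = 0 ↔ M.Sat (.cons y (.cons x p)) (t ≐ .zero) := by
    have := ht (.cons y (.cons x .nil))
    rw [Env.append_cons, Env.append_cons] at this
    exact Eq.congr_left this
  obtain ⟨f, hf⟩ := hM.models
    (.inr (.inl (.choice (Fragment.nat_mem _) (Fragment.nat_mem _) Fragment.one_mem (t ≐ .zero)
      trivial))) p
    fun x => (h x).imp fun y => (sat_iff x y).1
  exact ⟨f, fun x => (sat_iff _ _).2 ((sat_choice _ _ x f p _).1 (hf x))⟩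

theorem exists_representable_choice {φ : M.N → M.N} (hφ : Representable φ)
    (h : ∀ x, ∃ y, φ (pair x y) = 0) : ∃ f : M.D .one, ∀ x, φ (pair x (M.app f x)) = 0 :=
  exists_choice (φ := fun x y => φ (pair x y)) (.comp hφ (.pair .var .var)) h

theorem exists_sqrt (n : M.N) : ∃ s, s * s ≤ n ∧ n < (s + 1) * (s + 1) := by
  refine N.induction (P := fun n => ∃ s, s * s ≤ n ∧ n < (s + 1) * (s + 1))
    (.exNat (.and (.le (.mul .var .var) .var)
      (.lt .var (.mul (.add .var .const) (.add .var .const))))) ?_ ?_ n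
  · exact ⟨0, by simp, by simp⟩
  · rintro n ⟨s, hs, hs'⟩
    rcases lt_or_ge (n + 1) ((s + 1) * (s + 1)) with h | h
    · exact ⟨s, hs.trans (lt_add_one n).le, h⟩
    · refine ⟨s + 1, h, ?_⟩
      have lt := lt_add_one (s + 1)
      exact (N.add_one_le_iff.2 hs').trans_lt (mul_lt_mul'' lt lt zero_le zero_le)

theorem exists_representable_sqrt : ∃ f : M.N → M.N, Representable f ∧
    ∀ n, f n * f n ≤ n ∧ n < (f n + 1) * (f n + 1) := by
  have eq_zero_iff (n s : M.N) : s * s - n + (n + 1 - (s + 1) * (s + 1)) = 0 ↔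
      s * s ≤ n ∧ n < (s + 1) * (s + 1) := by
    rw [add_eq_zero, tsub_eq_zero_iff_le, tsub_eq_zero_iff_le, N.add_one_le_iff]
  obtain ⟨f, hf⟩ := exists_choice (M := M)
    (φ := fun n s => s * s - n + (n + 1 - (s + 1) * (s + 1)))
    (.add (.sub (.mul .var .var) .var)
      (.sub (.add .var .const) (.mul (.add .var .const) (.add .var .const))))
    fun n => (exists_sqrt n).imp fun s => (eq_zero_iff n s).2
  exact ⟨M.app f, .of_object f, fun n => (eq_zero_iff _ _).1 (hf n)⟩

/-- The integer square root. -/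
noncomputable def sqrt : M.N → M.N := exists_representable_sqrt.choose

theorem representable_sqrt : Representable (M := M) sqrt := exists_representable_sqrt.choose_spec.1

theorem sqrt_mul_self_le (n : M.N) : sqrt n * sqrt n ≤ n :=
  (exists_representable_sqrt.choose_spec.2 n).1

theorem sqrt_eq {n s : M.N} (hs : s * s ≤ n) (hs' : n < (s + 1) * (s + 1)) : sqrt n = s := by
  have le_of_lt_sq {s t : M.N} (h : s * s < (t + 1) * (t + 1)) : s ≤ t :=
    Order.lt_add_one_iff.1 (lt_of_mul_self_lt_mul_self₀ zero_le h)
  have h := exists_representable_sqrt.choose_spec.2 n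
  exact le_antisymm (le_of_lt_sq (h.1.trans_lt hs')) (le_of_lt_sq (hs.trans_lt h.2))

theorem sqrt_pair (a b : M.N) : sqrt (pair a b) = a + b := by
  refine sqrt_eq le_self_add ?_
  rw [pair, show (a + b + 1) * (a + b + 1) = (a + b) * (a + b) + a + (a + b + b) + 1 by ring,
    Order.lt_add_one_iff]
  exact le_self_add

/-- The first component of a pair. -/
noncomputable def fst (n : M.N) : M.N := n - sqrt n * sqrt n

/-- The second component of a pair. -/
noncomputable def snd (n : M.N) : M.N := sqrt n - fst n

@[simp]
theorem fst_pair (a b : M.N) : fst (pair a b) = a := by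
  rw [fst, sqrt_pair, pair, add_tsub_cancel_left]

@[simp]
theorem snd_pair (a b : M.N) : snd (pair a b) = b := by
  rw [snd, fst_pair, sqrt_pair, add_tsub_cancel_left]

theorem snd_le (n : M.N) : snd n ≤ n := by
  have le_mul_self (s : M.N) : s ≤ s * s := by
    rcases N.eq_zero_or_succ s with rfl | ⟨s, rfl⟩
    · exact zero_le
    · exact le_mul_of_one_le_left zero_le le_add_self
  exact tsub_le_self.trans ((le_mul_self _).trans (sqrt_mul_self_le n))

namespace Representable
variable {σ : Ty} {f : M.D σ → M.N}

theorem fst (hf : Representable f) : Representable fun a => fst (f a) :=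
  .sub hf (.mul (.comp representable_sqrt hf) (.comp representable_sqrt hf))

theorem snd (hf : Representable f) : Representable fun a => snd (f a) :=
  .sub (.comp representable_sqrt hf) (.fst hf)

end Representable

theorem exists_primrec {φ ψ : M.N → M.N} (hφ : Representable φ) (hψ : Representable ψ) :
    ∃ s : M.N → M.N → M.N, (∀ p, s p 0 = φ p) ∧
      (∀ p n, s p (n + 1) = ψ (pair (pair p (s p n)) n)) ∧
      Representable fun q => s (fst q) (snd q) := by
  obtain ⟨g, hg⟩ := Representable₂.curry hψ
  obtain ⟨step, hstep⟩ := Representable₂.curry (.of_object g)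
  refine ⟨fun p n => recN n (φ p) (M.app step p), fun p => recN_zero _ _, fun p n => ?_,
    .recN (.snd .id) (.comp hφ (.fst .id)) (.app (.const step) (.fst .id))⟩
  exact (recN_succ _ _ _).trans ((congrArg (M.app · n) (hstep _ _)).trans (hg _ _))

end

end Struct

namespace Struct
variable {M : Struct .second} [hM : IsModel RCA M]

/-! ### Coded finite sets -/

/-- The list with head `x` and tail `D`, where `0` codes the empty list. -/
def cons (x D : M.N) : M.N := pair x D + 1

/-- The first element of a coded list. -/
noncomputable def head (D : M.N) : M.N := fst (D - 1)

/-- A coded list without its first element. -/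
noncomputable def tail (D : M.N) : M.N := snd (D - 1)

theorem head_cons (x D : M.N) : head (cons x D) = x := by
  rw [head, cons, add_tsub_cancel_right, fst_pair]

theorem tail_cons (x D : M.N) : tail (cons x D) = D := by
  rw [tail, cons, add_tsub_cancel_right, snd_pair]

theorem tail_zero : tail (0 : M.N) = 0 := by
  rw [tail, zero_tsub]
  exact nonpos_iff_eq_zero.1 (snd_le 0)

theorem exists_drop : ∃ d : M.N → M.N → M.N, (∀ D, d D 0 = D) ∧
    (∀ D i, d D (i + 1) = tail (d D i)) ∧ Representable fun q => d (fst q) (snd q) := by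
  obtain ⟨d, zero, succ, hd⟩ := exists_primrec (M := M) (ψ := fun q => tail (snd (fst q))) .id
    (.snd (.sub (.snd (.fst .id)) (.const 1)))
  refine ⟨d, zero, fun D i => ?_, hd⟩
  rw [succ, fst_pair, snd_pair]

/-- `drop D i` is the coded list `D` without its first `i` elements. -/
noncomputable def drop : M.N → M.N → M.N := exists_drop.choose

theorem drop_zero (D : M.N) : drop D 0 = D := exists_drop.choose_spec.1 D

theorem drop_succ (D i : M.N) : drop D (i + 1) = tail (drop D i) := exists_drop.choose_spec.2.1 D i

theorem representable_drop : Representable fun q : M.N => drop (fst q) (snd q) :=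
  exists_drop.choose_spec.2.2

theorem Representable.head {f : M.N → M.N} (hf : Representable f) :
    Representable fun n => head (f n) := .fst (.sub hf (.const 1))

theorem Representable.drop {f g : M.N → M.N} (hf : Representable f) (hg : Representable g) :
    Representable fun n => drop (f n) (g n) := by
  simpa only [fst_pair, snd_pair] using representable_drop.comp (.pair hf hg)

theorem TermDefinable.head {Γ : Ctx} {f : M.Env Γ → M.N} (hf : TermDefinable f) :
    TermDefinable fun e => head (f e) := .comp (.head .id) hf

theorem TermDefinable.drop {Γ : Ctx} {f g : M.Env Γ → M.N} (hf : TermDefinable f)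
    (hg : TermDefinable g) : TermDefinable fun e => drop (f e) (g e) := by
  simpa only [fst_pair, snd_pair] using TermDefinable.comp representable_drop (.pair hf hg)

theorem drop_tail (D i : M.N) : drop (tail D) i = drop D (i + 1) := by
  refine N.induction (P := fun i => drop (tail D) i = drop D (i + 1))
    (.eq (.drop .const .var) (.drop .const (.add .var .const))) ?_ ?_ i
  · rw [drop_succ, drop_zero, drop_zero]
  · intro i ih
    rw [drop_succ, ih, ← drop_succ]

theorem tail_lt {D : M.N} (hD : 0 < D) : tail D < D := by
  rcases N.eq_zero_or_succ D with rfl | ⟨c, rfl⟩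
  · exact absurd hD (lt_irrefl 0)
  · rw [tail, add_tsub_cancel_right]
    exact Order.lt_add_one_iff.2 (snd_le c)

theorem lt_of_drop_pos {D i : M.N} (h : 0 < drop D i) : i < D := by
  have key : ∀ i, 0 < drop D i → i + drop D i ≤ D := by
    refine N.induction (.imp (.lt .const (.drop .const .var))
      (.le (.add .var (.drop .const .var)) .const)) ?_ ?_
    · rw [drop_zero, zero_add]
      exact fun _ => le_rfl
    · intro i ih h
      have hi : 0 < drop D i := by
        rw [drop_succ] at h
        refine pos_iff_ne_zero.2 fun h₀ => h.ne' ?_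
        rw [h₀, tail_zero]
      calc i + 1 + drop D (i + 1) = i + (tail (drop D i) + 1) := by rw [drop_succ]; ring
        _ ≤ i + drop D i := by gcongr; exact N.add_one_le_iff.2 (tail_lt hi)
        _ ≤ D := ih hi
  exact (lt_add_of_pos_right i h).trans_le (key i h)

/-- `x` is an element of the coded list `D`. Codes of lists are used as codes of finite sets. -/
def Mem (x D : M.N) : Prop := ∃ i, 0 < drop D i ∧ head (drop D i) = x

theorem Definable.mem {Γ : Ctx} {f g : M.Env Γ → M.N} (hf : TermDefinable f)
    (hg : TermDefinable g) : Definable fun e => Mem (f e) (g e) :=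
  .exNat (.and (.lt .const (.drop hg.weaken .var)) (.eq (.head (.drop hg.weaken .var)) hf.weaken))

theorem not_mem_zero (x : M.N) : ¬ Mem x 0 := fun ⟨_, hi, _⟩ => not_lt_zero (lt_of_drop_pos hi)

theorem mem_iff_of_pos {y D : M.N} (hD : 0 < D) : Mem y D ↔ y = head D ∨ Mem y (tail D) := by
  constructor
  · rintro ⟨i, hi, rfl⟩
    rcases N.eq_zero_or_succ i with rfl | ⟨i, rfl⟩
    · rw [drop_zero]
      exact .inl rfl
    · rw [← drop_tail] at hi ⊢
      exact .inr ⟨i, hi, rfl⟩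
  · rintro (rfl | ⟨i, hi, rfl⟩)
    · exact ⟨0, by rwa [drop_zero], by rw [drop_zero]⟩
    · exact ⟨i + 1, by rwa [← drop_tail], by rw [← drop_tail]⟩

theorem mem_cons {x y D : M.N} : Mem y (cons x D) ↔ y = x ∨ Mem y D := by
  have pos : 0 < cons x D := zero_le.trans_lt (lt_add_one _)
  rw [mem_iff_of_pos pos, head_cons, tail_cons]

theorem list_induction {P : M.N → Prop} (hP : DefinablePred P) (zero : P 0)
    (step : ∀ D, 0 < D → P (tail D) → P D) (D : M.N) : P D := by
  by_contra hD
  obtain ⟨E, hE, h⟩ := N.exists_least (P := fun D => ¬ P D) (.not hP) hD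
  rcases eq_or_ne E 0 with rfl | hpos
  · exact hE zero
  · exact hE (step E (pos_iff_ne_zero.2 hpos)
      (not_not.1 (h _ (tail_lt (pos_iff_ne_zero.2 hpos)))))

/-- The code of a one-element set. -/
def singleton (x : M.N) : M.N := cons x 0

theorem mem_singleton {x y : M.N} : Mem y (singleton x) ↔ y = x :=
  mem_cons.trans (or_iff_left (not_mem_zero y))

theorem exists_mem_iff_or (D E : M.N) : ∃ U, ∀ y, Mem y U ↔ Mem y D ∨ Mem y E := by
  refine list_induction (P := fun E => ∃ U, ∀ y, Mem y U ↔ Mem y D ∨ Mem y E)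
    (.exNat (.allNat (.iff (.mem .var .var) (.or (.mem .var .const) (.mem .var .var))))) ?_ ?_ E
  · exact ⟨D, fun y => (or_iff_left (not_mem_zero y)).symm⟩
  · rintro E hE ⟨U, hU⟩
    refine ⟨cons (head E) U, fun y => ?_⟩
    rw [mem_cons, hU, mem_iff_of_pos hE, or_left_comm]

/-! ### Computably enumerable predicates -/

/-- Predicates that are enumerated by an object of type `1`. -/
def CE (P : M.N → Prop) : Prop :=
  ∃ φ : M.N → M.N, Representable φ ∧ ∀ n, P n ↔ ∃ k, φ (pair n k) = 0

theorem exists_bounded_all {φ : M.N → M.N} (hφ : Representable φ) : ∃ s : M.N → M.N → M.N,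
    (∀ p n, s p n = 0 ↔ ∀ k < n, φ (pair p k) = 0) ∧
      Representable fun q => s (fst q) (snd q) := by
  obtain ⟨s, zero, succ, hs⟩ := exists_primrec
    (ψ := fun q => snd (fst q) + φ (pair (fst (fst q)) (snd q))) (.const 0)
    (.add (.snd (.fst .id)) (.comp hφ (.pair (.fst (.fst .id)) (.snd .id))))
  refine ⟨s, fun p n => ?_, hs⟩
  have hsp : Representable (s p) := by
    simpa only [fst_pair, snd_pair] using hs.comp (.pair (.const p) .id)
  refine N.induction (P := fun n => s p n = 0 ↔ ∀ k < n, φ (pair p k) = 0)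
    (.iff (.eq (.comp hsp .var) .const)
      (.allNat (.imp (.lt .var .var) (.eq (.comp hφ (.pair .const .var)) .const)))) ?_ ?_ n
  · exact iff_of_true (zero p) fun k hk => absurd hk not_lt_zero
  · intro n ih
    simp only [succ, fst_pair, snd_pair, add_eq_zero, ih, Order.lt_add_one_iff, le_iff_lt_or_eq,
      or_imp, forall_and, forall_eq]

namespace CE
variable {P Q : M.N → Prop} {f g : M.N → M.N}

theorem eq_zero (hf : Representable f) : CE fun n => f n = 0 :=
  ⟨fun q => f (fst q), .comp hf (.fst .id), fun n => by simp only [fst_pair, exists_const]⟩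

theorem le (hf : Representable f) (hg : Representable g) : CE fun n => f n ≤ g n := by
  simp only [← tsub_eq_zero_iff_le]
  exact .eq_zero (.sub hf hg)

theorem lt (hf : Representable f) (hg : Representable g) : CE fun n => f n < g n := by
  simp only [← N.add_one_le_iff]
  exact .le (.add hf (.const 1)) hg

theorem comp (hP : CE P) (hf : Representable f) : CE fun n => P (f n) := by
  obtain ⟨φ, hφ, h⟩ := hP
  refine ⟨fun q => φ (pair (f (fst q)) (snd q)),
    .comp hφ (.pair (.comp hf (.fst .id)) (.snd .id)), fun n => ?_⟩
  simp only [fst_pair, snd_pair, h]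

theorem and (hP : CE P) (hQ : CE Q) : CE fun n => P n ∧ Q n := by
  obtain ⟨φ, hφ, h⟩ := hP
  obtain ⟨ψ, hψ, h'⟩ := hQ
  refine ⟨fun q => φ (pair (fst q) (fst (snd q))) + ψ (pair (fst q) (snd (snd q))),
    .add (.comp hφ (.pair (.fst .id) (.fst (.snd .id))))
      (.comp hψ (.pair (.fst .id) (.snd (.snd .id)))), fun n => ?_⟩
  simp only [h, h', fst_pair, snd_pair, add_eq_zero]
  constructor
  · rintro ⟨⟨k, hk⟩, l, hl⟩
    exact ⟨pair k l, by rwa [fst_pair], by rwa [snd_pair]⟩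
  · rintro ⟨k, hk, hl⟩
    exact ⟨⟨_, hk⟩, _, hl⟩

theorem or (hP : CE P) (hQ : CE Q) : CE fun n => P n ∨ Q n := by
  obtain ⟨φ, hφ, h⟩ := hP
  obtain ⟨ψ, hψ, h'⟩ := hQ
  exact ⟨fun q => φ q * ψ q, .mul hφ hψ, fun n => by simp only [h, h', mul_eq_zero, exists_or]⟩

theorem eq (hf : Representable f) (hg : Representable g) : CE fun n => f n = g n := by
  simp only [le_antisymm_iff]
  exact .and (.le hf hg) (.le hg hf)

variable {R : M.N → M.N → Prop}

theorem ex (hR : CE fun q => R (fst q) (snd q)) : CE fun n => ∃ k, R n k := by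
  obtain ⟨φ, hφ, h⟩ := hR
  refine ⟨fun q => φ (pair (pair (fst q) (fst (snd q))) (snd (snd q))),
    .comp hφ (.pair (.pair (.fst .id) (.fst (.snd .id))) (.snd (.snd .id))), fun n => ?_⟩
  have h (k : M.N) : R n k ↔ ∃ j, φ (pair (pair n k) j) = 0 := by
    simpa only [fst_pair, snd_pair] using h (pair n k)
  simp only [h, fst_pair, snd_pair]
  constructor
  · rintro ⟨k, j, hj⟩
    exact ⟨pair k j, by rwa [fst_pair, snd_pair]⟩
  · rintro ⟨k, hk⟩
    exact ⟨_, _, hk⟩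

theorem exists_common_bound {φ : M.N → M.N} (hφ : Representable φ) (n : M.N) {m : M.N}
    (h : ∀ k < m, ∃ j, φ (pair (pair n k) j) = 0) :
    ∃ J, ∀ k < m, ∃ j < J, φ (pair (pair n k) j) = 0 := by
  suffices ∀ l ≤ m, ∃ J, ∀ k < l, ∃ j < J, φ (pair (pair n k) j) = 0 from this m le_rfl
  refine N.induction (.imp (.le .var .const) (.exNat (.allNat (.imp (.lt .var .var) (.exNat (.and
    (.lt .var .var) (.eq (.comp hφ (.pair (.pair .const .var) .var)) .const))))))) ?_ ?_
  · exact fun _ => ⟨0, fun k hk => absurd hk not_lt_zero⟩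
  · intro l ih hl
    obtain ⟨J, hJ⟩ := ih ((lt_add_one l).le.trans hl)
    obtain ⟨j, hj⟩ := h l (N.add_one_le_iff.1 hl)
    refine ⟨J + (j + 1), fun k hk => ?_⟩
    rcases (Order.lt_add_one_iff.1 hk).lt_or_eq with hk | rfl
    · obtain ⟨i, hi, hi'⟩ := hJ k hk
      exact ⟨i, hi.trans_le le_self_add, hi'⟩
    · exact ⟨j, (lt_add_one j).trans_le le_add_self, hj⟩

theorem ball {b : M.N → M.N} (hb : Representable b) (hR : CE fun q => R (fst q) (snd q)) :
    CE fun n => ∀ k < b n, R n k := by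
  obtain ⟨φ, hφ, h⟩ := hR
  have h (n k : M.N) : R n k ↔ ∃ j, φ (pair (pair n k) j) = 0 := by
    simpa only [fst_pair, snd_pair] using h (pair n k)
  have one_sub_eq_zero (a : M.N) : 1 - a = 0 ↔ a ≠ 0 := by
    rw [tsub_eq_zero_iff_le, ← pos_iff_ne_zero, ← N.add_one_le_iff, zero_add]
  obtain ⟨s, hs, hs'⟩ := exists_bounded_all (φ := fun q => 1 - φ q) (.sub (.const 1) hφ)
  have hs'' {u v : M.N → M.N} (hu : Representable u) (hv : Representable v) :
      Representable fun q => s (u q) (v q) := by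
    simpa only [fst_pair, snd_pair] using hs'.comp (.pair hu hv)
  obtain ⟨t, ht, ht'⟩ := exists_bounded_all
    (φ := fun q => 1 - s (pair (fst (fst q)) (snd q)) (snd (fst q)))
    (.sub (.const 1) (hs'' (.pair (.fst (.fst .id)) (.snd .id)) (.snd (.fst .id))))
  have key (n J : M.N) : t (pair n J) (b n) = 0 ↔
      ∀ k < b n, ∃ j < J, φ (pair (pair n k) j) = 0 := by
    simp only [ht, fst_pair, snd_pair, one_sub_eq_zero, ne_eq, hs, not_forall, not_not, exists_prop]
  refine ⟨fun q => t q (b (fst q)), ?_, fun n => ?_⟩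
  · simpa only [fst_pair, snd_pair] using ht'.comp (.pair .id (.comp hb (.fst .id)))
  · simp only [fst_pair, key, h]
    exact ⟨exists_common_bound hφ n, fun ⟨J, hJ⟩ k hk => (hJ k hk).imp fun _ hj => hj.2⟩

theorem mem (hf : Representable f) (hg : Representable g) : CE fun n => Mem (f n) (g n) :=
  have hg' := hg.comp (.fst .id)
  .ex (.and (.lt (.const 0) (.drop hg' (.snd .id)))
    (.eq (.head (.drop hg' (.snd .id))) (hf.comp (.fst .id))))

theorem allMem (hg : Representable g) (hR : CE fun q => R (fst q) (snd q)) :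
    CE fun n => ∀ k, Mem k (g n) → R n k := by
  have hdrop : Representable fun q => drop (g (fst q)) (snd q) :=
    .drop (hg.comp (.fst .id)) (.snd .id)
  have := CE.ball (R := fun n i => drop (g n) i = 0 ∨ R n (head (drop (g n) i))) hg
    (.or (.eq_zero hdrop) (by
      simpa only [fst_pair, snd_pair] using hR.comp (.pair (.fst .id) (.head hdrop))))
  convert this using 2 with n
  constructor
  · exact fun h i _ => or_iff_not_imp_left.2 fun hi => h _ ⟨i, pos_iff_ne_zero.2 hi, rfl⟩
  · rintro h _ ⟨i, hi, rfl⟩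
    exact (h i (lt_of_drop_pos hi)).resolve_left hi.ne'

end CE

end Struct

namespace Struct
variable {M : Struct .second}

/-! ### The graph algebra of computably enumerable sets -/

variable (M) in
/-- The computably enumerable sets of numbers of a model, the elements of its graph algebra. -/
def CSet : Type := {P : M.N → Prop // CE P}

namespace CSet

instance : Membership M.N (CSet M) := ⟨fun A n => A.1 n⟩

instance : PartialOrder (CSet M) := Subtype.partialOrder _

@[ext]
theorem ext {A B : CSet M} (h : ∀ n, n ∈ A ↔ n ∈ B) : A = B :=
  Subtype.ext (funext fun n => propext (h n))

/-- The set enumerated by an object of type `1`. -/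
def ofIndex (f : M.D .one) : CSet M :=
  ⟨fun n => ∃ k, M.app f (pair n k) = 0, _, .of_object f, fun _ => Iff.rfl⟩

theorem ofIndex_surjective : Function.Surjective (ofIndex (M := M)) := by
  rintro ⟨P, φ, ⟨f, hf⟩, h⟩
  exact ⟨f, ext fun n => ((h n).trans (exists_congr fun k => by rw [hf])).symm⟩

end CSet

/-- Families of computably enumerable sets, indexed by assignments, whose membership relation is
definable. -/
def SetDefinable {Γ : Ctx} (S : M.Env Γ → CSet M) : Prop :=
  Definable fun e : M.Env (.nat :: Γ) =>
    e Fragment.second.nat_mem .zero ∈ S fun _ h x => e h (.succ x)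

section
variable {Γ : Ctx}

theorem Definable.memSet {S : M.Env Γ → CSet M} {f : M.Env Γ → M.N} (hf : TermDefinable f)
    (hS : SetDefinable S) : Definable fun e => f e ∈ S e := by
  have : Definable fun e => ∃ x, x = f e ∧ x ∈ S e := .exNat (.and (.eq .var hf.weaken) hS)
  simpa only [exists_eq_left] using this

namespace SetDefinable

theorem weaken {S : M.Env Γ → CSet M} {σ : Ty} (hS : SetDefinable S) :
    SetDefinable fun e : M.Env (σ :: Γ) => S fun _ h x => e h (.succ x) := by
  obtain ⟨Δ, p, A, hA⟩ := hS
  let r : Ren (.nat :: (Γ ++ Δ)) (.nat :: σ :: (Γ ++ Δ)) := Ren.lift fun _ x => .succ x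
  refine ⟨Δ, p, A.rename r, fun e => ?_⟩
  refine (hA (.cons (e Fragment.second.nat_mem .zero) fun _ h x => e h (.succ (.succ x)))).trans ?_
  rw [sat_rename]
  refine iff_of_eq (congrArg (M.Sat · A) ?_)
  funext τ h x
  cases x <;> rfl

theorem index {h : Fragment.second.varTy .one} {x : Var Γ .one} :
    SetDefinable fun e : M.Env Γ => .ofIndex (e h x) :=
  .exNat (.eq (.app .var (.pair .var .var)) .const)

theorem const {A : CSet M} : SetDefinable fun _ : M.Env Γ => A := by
  obtain ⟨f, rfl⟩ := CSet.ofIndex_surjective A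
  exact .exNat (.eq (.app (.param Fragment.one_mem f) (.pair .var .var)) .const)

end SetDefinable

theorem Definable.eqSet {S T : M.Env Γ → CSet M} (hS : SetDefinable S) (hT : SetDefinable T) :
    Definable fun e => S e = T e := by
  simp only [CSet.ext_iff]
  exact .allNat (.iff (.memSet .var hS.weaken) (.memSet .var hT.weaken))

end

variable [hM : IsModel RCA M]

namespace CSet

/-- Application in the graph algebra: an element `pair n D` of `A` says that `n` belongs to `A ⋆ B`
as soon as the finite set coded by `D` is contained in `B`. -/
def app (A B : CSet M) : CSet M :=
  ⟨fun n => ∃ D, A.1 (pair n D) ∧ ∀ d, Mem d D → B.1 d,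
    .ex (.and (A.2.comp (.pair (.fst .id) (.snd .id))) (.allMem (.snd .id) (B.2.comp (.snd .id))))⟩

infixl:70 " ⋆ " => CSet.app

/-- The finite set with code `D`. -/
def fin (D : M.N) : CSet M := ⟨fun n => Mem n D, .mem .id (.const D)⟩

/-- The set whose only element is `a`. It represents the number `a` in the graph algebra. -/
def single (a : M.N) : CSet M := fin (singleton a)

variable {A A' B B' : CSet M} {a b n D E : M.N}

theorem mem_app : n ∈ A ⋆ B ↔ ∃ D, pair n D ∈ A ∧ fin D ≤ B := .rfl

@[gcongr]
theorem app_mono (hA : A ≤ A') (hB : B ≤ B') : A ⋆ B ≤ A' ⋆ B' :=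
  fun _ ⟨D, h, hD⟩ => ⟨D, hA _ h, fun d hd => hB d (hD d hd)⟩

theorem fin_zero_le : fin 0 ≤ A := fun n hn => absurd hn (not_mem_zero n)

theorem mem_single : n ∈ single a ↔ n = a := mem_singleton

theorem fin_singleton_le : fin (singleton a) ≤ A ↔ a ∈ A :=
  ⟨fun h => h a (mem_single.2 rfl), fun h n hn => by rwa [mem_single.1 hn]⟩

theorem single_inj : single a = single b ↔ a = b := by
  refine ⟨fun h => ?_, congrArg single⟩
  rw [← mem_single, ← h, mem_single]

theorem fin_le_iff_of_pos (hD : 0 < D) : fin D ≤ A ↔ head D ∈ A ∧ fin (tail D) ≤ A := by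
  have : fin D ≤ A ↔ ∀ d, d = head D ∨ Mem d (tail D) → d ∈ A :=
    forall_congr' fun d => imp_congr_left (mem_iff_of_pos hD)
  simp only [this, or_imp, forall_and, forall_eq]
  rfl

theorem exists_fin_le_and_le (hD : fin D ≤ A) (hE : fin E ≤ A) :
    ∃ U, fin U ≤ A ∧ fin D ≤ fin U ∧ fin E ≤ fin U := by
  obtain ⟨U, hU⟩ := exists_mem_iff_or D E
  exact ⟨U, fun d hd => ((hU d).1 hd).elim (hD d) (hE d), fun d hd => (hU d).2 (.inl hd),
    fun d hd => (hU d).2 (.inr hd)⟩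

end CSet

namespace SetDefinable
variable {Γ : Ctx}

theorem single {f : M.Env Γ → M.N} (hf : TermDefinable f) :
    SetDefinable fun e => .single (f e) := by
  have : Definable fun e : M.Env (.nat :: Γ) =>
      e Fragment.second.nat_mem .zero = f fun _ h x => e h (.succ x) := .eq .var hf.weaken
  simpa only [SetDefinable, CSet.mem_single] using this

theorem app {S T : M.Env Γ → CSet M} (hS : SetDefinable S) (hT : SetDefinable T) :
    SetDefinable fun e => S e ⋆ T e :=
  .exNat (.and (.memSet (.pair .var .var) hS.weaken.weaken)
    (.allNat (.imp (.mem .var .var) (.memSet .var hT.weaken.weaken.weaken))))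

end SetDefinable

/-- Uniformly computably enumerable families of sets, indexed by numbers. -/
def UniformlyCE (S : M.N → CSet M) : Prop := CE fun q => snd q ∈ S (fst q)

namespace UniformlyCE
variable {S T : M.N → CSet M} {f : M.N → M.N}

theorem mem (hS : UniformlyCE S) (hf : Representable f) : CE fun n => f n ∈ S n := by
  simpa only [fst_pair, snd_pair] using CE.comp hS (.pair .id hf)

theorem comp (hS : UniformlyCE S) (hf : Representable f) : UniformlyCE fun n => S (f n) :=
  mem (S := fun q => S (f (fst q))) (by
    simpa only [UniformlyCE, fst_pair, snd_pair] using
      CE.comp hS (.pair (hf.comp (.fst (.fst .id))) (.snd .id))) (.snd .id)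

theorem fin (hf : Representable f) : UniformlyCE fun n => .fin (f n) :=
  CE.mem (.snd .id) (hf.comp (.fst .id))

theorem single (hf : Representable f) : UniformlyCE fun n => .single (f n) :=
  fin (.add (.pair hf (.const 0)) (.const 1))

theorem app (hS : UniformlyCE S) (hT : UniformlyCE T) : UniformlyCE fun n => S n ⋆ T n :=
  CE.ex (.and ((hS.comp (.fst (.fst .id))).mem (.pair (.snd (.fst .id)) (.snd .id)))
    (.allMem (.snd .id) ((hT.comp (.fst (.fst (.fst .id)))).mem (.snd .id))))

end UniformlyCE

namespace CSet

/-! ### Combinators of the graph algebra -/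

/-- The graph of the binary enumeration operator with axioms `P n D E`, each of which puts `n` into
the value as soon as the arguments contain the finite sets coded by `D` and `E`. -/
noncomputable def graph₂ {P : M.N → M.N → M.N → Prop}
    (hP : CE fun q => P (fst (fst q)) (snd q) (snd (fst q))) : CSet M := ⟨_, hP⟩

theorem mem_graph₂ {P : M.N → M.N → M.N → Prop}
    (hP : CE fun q => P (fst (fst q)) (snd q) (snd (fst q))) {n : M.N} {A B : CSet M} :
    n ∈ graph₂ hP ⋆ A ⋆ B ↔ ∃ D E, fin D ≤ A ∧ fin E ≤ B ∧ P n D E := by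
  have mem_graph (n D E : M.N) : pair (pair n E) D ∈ graph₂ hP ↔ P n D E := by
    change P _ _ _ ↔ _
    simp only [fst_pair, snd_pair]
  simp only [mem_app, mem_app (A := graph₂ hP), mem_graph]
  exact ⟨fun ⟨E, ⟨D, h, hD⟩, hE⟩ => ⟨D, E, hD, hE, h⟩,
    fun ⟨D, E, hD, hE, h⟩ => ⟨E, ⟨D, h, hD⟩, hE⟩⟩

/-- The graph of a ternary enumeration operator, see `graph₂`. -/
noncomputable def graph₃ {P : M.N → M.N → M.N → M.N → Prop}
    (hP : CE fun q => P (fst (fst (fst q))) (snd q) (snd (fst q)) (snd (fst (fst q)))) : CSet M :=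
  ⟨_, hP⟩

theorem mem_graph₃ {P : M.N → M.N → M.N → M.N → Prop}
    (hP : CE fun q => P (fst (fst (fst q))) (snd q) (snd (fst q)) (snd (fst (fst q)))) {n : M.N}
    {A B C : CSet M} :
    n ∈ graph₃ hP ⋆ A ⋆ B ⋆ C ↔ ∃ D E F, fin D ≤ A ∧ fin E ≤ B ∧ fin F ≤ C ∧ P n D E F := by
  have mem_graph (n D E F : M.N) : pair (pair (pair n F) E) D ∈ graph₃ hP ↔ P n D E F := by
    change P _ _ _ _ ↔ _
    simp only [fst_pair, snd_pair]
  simp only [mem_app, mem_app (A := graph₃ hP ⋆ A), mem_app (A := graph₃ hP), mem_graph]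
  exact ⟨fun ⟨F, ⟨E, ⟨D, h, hD⟩, hE⟩, hF⟩ => ⟨D, E, F, hD, hE, hF, h⟩,
    fun ⟨D, E, F, hD, hE, hF, h⟩ => ⟨F, ⟨E, ⟨D, h, hD⟩, hE⟩, hF⟩⟩

variable (M) in
/-- The projection combinator. -/
noncomputable def K : CSet M :=
  graph₂ (P := fun n D _ => n ∈ fin D) (UniformlyCE.mem (.fin (.snd .id)) (.fst (.fst .id)))

theorem K_app (A B : CSet M) : K M ⋆ A ⋆ B = A := by
  ext n
  rw [K, mem_graph₂]
  exact ⟨fun ⟨_, _, hD, _, h⟩ => hD n h,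
    fun h => ⟨_, 0, fin_singleton_le.2 h, fin_zero_le, mem_single.2 rfl⟩⟩

theorem exists_fin_le_app {A B : CSet M} (D : M.N) (h : fin D ≤ A ⋆ B) :
    ∃ E F, fin E ≤ A ∧ fin F ≤ B ∧ fin D ≤ fin E ⋆ fin F := by
  have le_iff (D E F : M.N) : fin D ≤ fin E ⋆ fin F ↔
      ∀ d, Mem d D → ∃ G, Mem (pair d G) E ∧ ∀ x, Mem x G → Mem x F := .rfl
  refine list_induction (P := fun D => fin D ≤ A ⋆ B →
    ∃ E F, fin E ≤ A ∧ fin F ≤ B ∧ fin D ≤ fin E ⋆ fin F) ?_ ?_ ?_ D h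
  · have fin_le {Γ : Ctx} {f : M.Env Γ → M.N} (hf : TermDefinable f) (A : CSet M) :
        Definable fun e => fin (f e) ≤ A :=
      .allNat (.imp (.mem .var hf.weaken) (.memSet .var .const))
    simp only [le_iff]
    exact .imp (fin_le .var _) (.exNat (.exNat (.and (fin_le .var _) (.and (fin_le .var _)
      (.allNat (.imp (.mem .var .var) (.exNat (.and (.mem (.pair .var .var) .var)
        (.allNat (.imp (.mem .var .var) (.mem .var .var)))))))))))
  · exact fun _ => ⟨0, 0, fin_zero_le, fin_zero_le, fin_zero_le⟩
  · intro D hD ih h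
    rw [fin_le_iff_of_pos hD] at h
    obtain ⟨G, hGA, hGB⟩ := mem_app.1 h.1
    obtain ⟨E, F, hE, hF, hEF⟩ := ih h.2
    obtain ⟨E', hE', hEE', hGE'⟩ := exists_fin_le_and_le hE (fin_singleton_le.2 hGA)
    obtain ⟨F', hF', hFF', hGF'⟩ := exists_fin_le_and_le hF hGB
    exact ⟨E', F', hE', hF', (fin_le_iff_of_pos hD).2
      ⟨⟨G, fin_singleton_le.1 hGE', hGF'⟩, hEF.trans (app_mono hEE' hFF')⟩⟩

variable (M) in
/-- The substitution combinator. -/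
noncomputable def S : CSet M :=
  graph₃ (P := fun n D E F => n ∈ fin D ⋆ fin F ⋆ (fin E ⋆ fin F))
    (UniformlyCE.mem (.app (.app (.fin (.snd .id)) (.fin (.snd (.fst (.fst .id)))))
      (.app (.fin (.snd (.fst .id))) (.fin (.snd (.fst (.fst .id)))))) (.fst (.fst (.fst .id))))

theorem S_app (A B C : CSet M) : S M ⋆ A ⋆ B ⋆ C = A ⋆ C ⋆ (B ⋆ C) := by
  ext n
  rw [S, mem_graph₃]
  constructor
  · rintro ⟨D, E, F, hD, hE, hF, h⟩
    exact app_mono (app_mono hD hF) (app_mono hE hF) n h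
  · intro h
    obtain ⟨U, hU, hUBC⟩ := mem_app.1 h
    obtain ⟨F, hF, hFC⟩ := mem_app.1 hU
    obtain ⟨E, G, hE, hG, hUEG⟩ := exists_fin_le_app U hUBC
    obtain ⟨H, hH, hFH, hGH⟩ := exists_fin_le_and_le hFC hG
    refine ⟨singleton (pair (pair n U) F), E, H, fin_singleton_le.2 hF, hE, hH, ?_⟩
    exact ⟨U, ⟨F, mem_single.2 rfl, hFH⟩, hUEG.trans (app_mono le_rfl hGH)⟩

variable (M) in
/-- Case distinction on a number. -/
noncomputable def cases : CSet M :=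
  graph₃ (P := fun n D E F => 0 ∈ fin D ∧ n ∈ fin E ∨ ∃ m, m + 1 ∈ fin D ∧ n ∈ fin F ⋆ single m)
    (.or (.and (UniformlyCE.mem (.fin (.snd .id)) (.const 0))
        (UniformlyCE.mem (.fin (.snd (.fst .id))) (.fst (.fst (.fst .id)))))
      (.ex (.and (UniformlyCE.mem (.fin (.snd (.fst .id))) (.add (.snd .id) (.const 1)))
        (UniformlyCE.mem (.app (.fin (.snd (.fst (.fst (.fst .id))))) (.single (.snd .id)))
          (.fst (.fst (.fst (.fst .id))))))))

theorem mem_cases {n : M.N} {A B C : CSet M} : n ∈ cases M ⋆ A ⋆ B ⋆ C ↔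
    0 ∈ A ∧ n ∈ B ∨ ∃ m, m + 1 ∈ A ∧ n ∈ C ⋆ single m := by
  rw [cases, mem_graph₃]
  constructor
  · rintro ⟨D, E, F, hD, hE, hF, ⟨h, h'⟩ | ⟨m, h, h'⟩⟩
    · exact .inl ⟨hD _ h, hE _ h'⟩
    · exact .inr ⟨m, hD _ h, app_mono hF le_rfl _ h'⟩
  · rintro (⟨h, h'⟩ | ⟨m, h, F, h', hF⟩)
    · exact ⟨singleton 0, singleton n, 0, fin_singleton_le.2 h, fin_singleton_le.2 h', fin_zero_le,
        .inl ⟨mem_single.2 rfl, mem_single.2 rfl⟩⟩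
    · exact ⟨singleton (m + 1), 0, singleton (pair n F), fin_singleton_le.2 h, fin_zero_le,
        fin_singleton_le.2 h', .inr ⟨m, mem_single.2 rfl, F, mem_single.2 rfl, hF⟩⟩

theorem cases_zero (A B : CSet M) : cases M ⋆ single 0 ⋆ A ⋆ B = A := by
  ext n
  simp only [mem_cases, mem_single, N.succ_ne_zero, false_and, exists_false, or_false, true_and]

theorem cases_succ (m : M.N) (A B : CSet M) :
    cases M ⋆ single (m + 1) ⋆ A ⋆ B = B ⋆ single m := by
  ext n
  simp only [mem_cases, mem_single, (N.succ_ne_zero m).symm, false_and, false_or, add_left_inj,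
    exists_eq_left]

/-- The element of the graph algebra that represents a binary function on numbers. -/
noncomputable def lift₂ {φ : M.N → M.N} (hφ : Representable φ) : CSet M :=
  graph₂ (P := fun n D E => ∃ a b, (a ∈ fin D ∧ b ∈ fin E) ∧ n = φ (pair a b))
    (.ex (.ex (.and (.and (UniformlyCE.mem (.fin (.snd (.fst (.fst .id)))) (.snd (.fst .id)))
      (UniformlyCE.mem (.fin (.snd (.fst (.fst (.fst .id))))) (.snd .id)))
      (.eq (.fst (.fst (.fst (.fst .id)))) (hφ.comp (.pair (.snd (.fst .id)) (.snd .id)))))))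

theorem lift₂_app {φ : M.N → M.N} (hφ : Representable φ) (a b : M.N) :
    lift₂ hφ ⋆ single a ⋆ single b = single (φ (pair a b)) := by
  ext n
  rw [lift₂, mem_graph₂, mem_single]
  constructor
  · rintro ⟨D, E, hD, hE, a', b', ⟨ha, hb⟩, rfl⟩
    rw [mem_single.1 (hD _ ha), mem_single.1 (hE _ hb)]
  · rintro rfl
    exact ⟨_, _, le_rfl, le_rfl, a, b, ⟨mem_single.2 rfl, mem_single.2 rfl⟩, rfl⟩

/-- The element of the graph algebra that represents a function on numbers. -/
noncomputable def lift {φ : M.N → M.N} (hφ : Representable φ) : CSet M :=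
  lift₂ (hφ.comp (.snd .id)) ⋆ single 0

theorem lift_app {φ : M.N → M.N} (hφ : Representable φ) (a : M.N) :
    lift hφ ⋆ single a = single (φ a) := by
  rw [lift, lift₂_app, snd_pair]

end CSet

variable (M) in
/-- Combinatory terms over the graph algebra, with de Bruijn indices as variables. -/
inductive CL : Type
  | var (i : ℕ) : CL
  | const (A : CSet M) : CL
  | app (s t : CL) : CL

namespace CL

/-- The assignment that sends the variable `0` to `A` and the variable `i + 1` to `ν i`. -/
def push (A : CSet M) (ν : ℕ → CSet M) : ℕ → CSet M
  | 0 => A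
  | i + 1 => ν i

/-- The value of a combinatory term. -/
def eval (ν : ℕ → CSet M) : CL M → CSet M
  | var i => ν i
  | const A => A
  | app s t => eval ν s ⋆ eval ν t

/-- Bracket abstraction of the variable `0`. -/
noncomputable def abs : CL M → CL M
  | var 0 => .app (.app (.const (.S M)) (.const (.K M))) (.const (.K M))
  | var (i + 1) => .app (.const (.K M)) (.var i)
  | const A => .app (.const (.K M)) (.const A)
  | app s t => .app (.app (.const (.S M)) (abs s)) (abs t)

theorem eval_abs (ν : ℕ → CSet M) (t : CL M) (A : CSet M) :
    eval ν (abs t) ⋆ A = eval (push A ν) t := by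
  induction t with
  | var i =>
    cases i with
    | zero => simp only [abs, eval, CSet.S_app, CSet.K_app, push]
    | succ i => simp only [abs, eval, CSet.K_app, push]
  | const B => simp only [abs, eval, CSet.K_app]
  | app s t ih₁ ih₂ => simp only [abs, eval, CSet.S_app, ih₁, ih₂]

end CL

namespace CSet

/-- The value of a closed combinatory term. -/
noncomputable def ofCL (t : CL M) : CSet M := t.eval fun _ => K M

theorem exists_fix : ∃ Y : CSet M, ∀ F, Y ⋆ F = F ⋆ (Y ⋆ F) := by
  let U : CSet M := ofCL (.abs (.abs (.app (.var 0) (.app (.app (.var 1) (.var 1)) (.var 0)))))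
  have hU (A F : CSet M) : U ⋆ A ⋆ F = F ⋆ (A ⋆ A ⋆ F) := by
    simp only [U, ofCL, CL.eval_abs, CL.eval, CL.push]
  exact ⟨U ⋆ U, hU U⟩

theorem exists_recursor : ∃ R : CSet M, (∀ A B, R ⋆ single 0 ⋆ A ⋆ B = A) ∧
    ∀ n A B, R ⋆ single (n + 1) ⋆ A ⋆ B = B ⋆ (R ⋆ single n ⋆ A ⋆ B) ⋆ single n := by
  obtain ⟨Y, hY⟩ := exists_fix (M := M)
  let G : CSet M := ofCL (.abs (.abs (.abs (.abs (.app
    (.app (.var 1) (.app (.app (.app (.var 3) (.var 0)) (.var 2)) (.var 1))) (.var 0))))))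
  have hG (R A B n : CSet M) : G ⋆ R ⋆ A ⋆ B ⋆ n = B ⋆ (R ⋆ n ⋆ A ⋆ B) ⋆ n := by
    simp only [G, ofCL, CL.eval_abs, CL.eval, CL.push]
  let F : CSet M := ofCL (.abs (.abs (.abs (.abs (.app
    (.app (.app (.const (cases M)) (.var 2)) (.var 1))
    (.app (.app (.app (.const G) (.var 3)) (.var 1)) (.var 0)))))))
  have hF (R n A B : CSet M) : F ⋆ R ⋆ n ⋆ A ⋆ B = cases M ⋆ n ⋆ A ⋆ (G ⋆ R ⋆ A ⋆ B) := by
    simp only [F, ofCL, CL.eval_abs, CL.eval, CL.push]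
  refine ⟨Y ⋆ F, fun A B => ?_, fun n A B => ?_⟩
  · rw [hY, hF, cases_zero]
  · conv_lhs => rw [hY, hF, cases_succ, hG]

theorem exists_search : ∃ U : CSet M, ∀ G n,
    (G ⋆ single n = single 0 → U ⋆ G ⋆ single n = single n) ∧
    ∀ m, G ⋆ single n = single (m + 1) → U ⋆ G ⋆ single n = U ⋆ G ⋆ single (n + 1) := by
  obtain ⟨Y, hY⟩ := exists_fix (M := M)
  have hs : Representable fun n : M.N => n + 1 := .add .id (.const 1)
  let H : CSet M := ofCL (.abs (.abs (.abs (.abs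
    (.app (.app (.var 3) (.var 2)) (.app (.const (lift hs)) (.var 1)))))))
  have hH (R G n m : CSet M) : H ⋆ R ⋆ G ⋆ n ⋆ m = R ⋆ G ⋆ (lift hs ⋆ n) := by
    simp only [H, ofCL, CL.eval_abs, CL.eval, CL.push]
  let F : CSet M := ofCL (.abs (.abs (.abs (.app
    (.app (.app (.const (cases M)) (.app (.var 1) (.var 0))) (.var 0))
    (.app (.app (.app (.const H) (.var 2)) (.var 1)) (.var 0))))))
  have hF (R G n : CSet M) : F ⋆ R ⋆ G ⋆ n = cases M ⋆ (G ⋆ n) ⋆ n ⋆ (H ⋆ R ⋆ G ⋆ n) := by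
    simp only [F, ofCL, CL.eval_abs, CL.eval, CL.push]
  refine ⟨Y ⋆ F, fun G n => ⟨fun h => ?_, fun m h => ?_⟩⟩
  · rw [hY, hF, h, cases_zero]
  · conv_lhs => rw [hY, hF, h, cases_succ, hH, lift_app]

theorem exists_minimization : ∃ U : CSet M, ∀ {G n}, (∀ m, ∃ v, G ⋆ single m = single v) →
    G ⋆ single n = single 0 → (∀ k < n, G ⋆ single k ≠ single 0) → U ⋆ G = single n := by
  obtain ⟨U, hU⟩ := exists_search (M := M)
  refine ⟨ofCL (.abs (.app (.app (.const U) (.var 0)) (.const (single 0)))), ?_⟩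
  intro G n total hn hlt
  have search (j : M.N) : ∀ k, k + j = n → U ⋆ G ⋆ single k = single n := by
    induction j using N.induction with
    | hP =>
      exact .allNat (.imp (.eq (.add .var .var) .const)
        (.eqSet (.app .const (.single .var)) .const))
    | zero =>
      rintro k rfl
      rw [add_zero] at hn ⊢
      exact (hU G k).1 hn
    | succ j ih =>
      intro k hk
      have hkn : k < n := by
        rw [← hk, ← N.add_one_le_iff]
        exact add_le_add_right le_add_self k
      obtain ⟨v, hv⟩ := total k
      rcases N.eq_zero_or_succ v with rfl | ⟨v, rfl⟩
      · exact absurd hv (hlt k hkn)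
      · rw [(hU G k).2 v hv]
        exact ih _ (by rw [← hk, add_right_comm, add_assoc])
  simpa only [ofCL, CL.eval_abs, CL.eval, CL.push] using search n 0 (zero_add n)

variable (M) in
/-- The recursor of the graph algebra. -/
noncomputable def R : CSet M := exists_recursor.choose

theorem R_zero (A B : CSet M) : R M ⋆ single 0 ⋆ A ⋆ B = A := exists_recursor.choose_spec.1 A B

theorem R_succ (n : M.N) (A B : CSet M) :
    R M ⋆ single (n + 1) ⋆ A ⋆ B = B ⋆ (R M ⋆ single n ⋆ A ⋆ B) ⋆ single n :=
  exists_recursor.choose_spec.2 n A B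

end CSet

end Struct

namespace Struct
variable {M : Struct .second} [hM : IsModel RCA M]

namespace CSet

/-! ### Hereditarily extensional objects of the graph algebra -/

/-- Hereditary extensional equality, the partial equivalence relation by which the type `σ` is
interpreted in the graph algebra. -/
def Per : Ty → CSet M → CSet M → Prop
  | .nat, A, B => ∃ n, A = single n ∧ B = single n
  | .arr ρ τ, F, G => ∀ A B, Per ρ A B → Per τ (F ⋆ A) (G ⋆ B)

theorem Per.symm_and_trans (σ : Ty) : (∀ A B : CSet M, Per σ A B → Per σ B A) ∧
    ∀ A B C : CSet M, Per σ A B → Per σ B C → Per σ A C := by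
  induction σ with
  | nat =>
    refine ⟨fun A B ⟨n, hA, hB⟩ => ⟨n, hB, hA⟩, ?_⟩
    rintro A B C ⟨n, hA, hB⟩ ⟨m, hB', hC⟩
    exact ⟨n, hA, by rw [hC, ← hB', hB]⟩
  | arr ρ τ ihρ ihτ =>
    refine ⟨fun F G h A B hAB => ihτ.1 _ _ (h _ _ (ihρ.1 _ _ hAB)), fun F G H h h' A B hAB => ?_⟩
    exact ihτ.2 _ _ _ (h A A (ihρ.2 _ _ _ hAB (ihρ.1 _ _ hAB))) (h' A B hAB)

theorem Per.symm {σ : Ty} {A B : CSet M} (h : Per σ A B) : Per σ B A :=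
  (symm_and_trans σ).1 _ _ h

theorem Per.trans {σ : Ty} {A B C : CSet M} (h : Per σ A B) (h' : Per σ B C) : Per σ A C :=
  (symm_and_trans σ).2 _ _ _ h h'

theorem Per.left {σ : Ty} {A B : CSet M} (h : Per σ A B) : Per σ A A := h.trans h.symm

theorem Per.eq_of_nat {A B : CSet M} (h : Per .nat A B) : A = B := by
  obtain ⟨n, rfl, rfl⟩ := h
  rfl

theorem per_single (n : M.N) : Per .nat (single n) (single n) := ⟨n, rfl, rfl⟩

theorem definable_per {Γ : Ctx} (σ : Ty) {S T : M.Env Γ → CSet M} (hS : SetDefinable S)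
    (hT : SetDefinable T) : Definable fun e => Per σ (S e) (T e) := by
  induction σ generalizing Γ with
  | nat => exact .exNat (.and (.eqSet hS.weaken (.single .var)) (.eqSet hT.weaken (.single .var)))
  | arr ρ τ ihρ ihτ =>
    simp only [Per, ofIndex_surjective.forall]
    refine .all (h := Fragment.one_mem) (.all (h := Fragment.one_mem)
      (.imp (ihρ .index .index) (ihτ ?_ ?_)))
    · exact .app hS.weaken.weaken .index
    · exact .app hT.weaken.weaken .index

variable (M) in
/-- The element of the graph algebra that represents addition. -/
noncomputable def plus : CSet M := lift₂ (φ := fun p => fst p + snd p) (.add (.fst .id) (.snd .id))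

variable (M) in
/-- The element of the graph algebra that represents multiplication. -/
noncomputable def times : CSet M :=
  lift₂ (φ := fun p => fst p * snd p) (.mul (.fst .id) (.snd .id))

variable (M) in
/-- The element of the graph algebra that represents the successor function. -/
noncomputable def next : CSet M := lift (φ := fun n => n + 1) (.add .id (.const 1))

theorem plus_app (a b : M.N) : plus M ⋆ single a ⋆ single b = single (a + b) := by
  rw [plus, lift₂_app, fst_pair, snd_pair]

theorem times_app (a b : M.N) : times M ⋆ single a ⋆ single b = single (a * b) := by
  rw [times, lift₂_app, fst_pair, snd_pair]

theorem next_app (a : M.N) : next M ⋆ single a = single (a + 1) := lift_app _ a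

theorem per_lift {φ : M.N → M.N} (hφ : Representable φ) : Per .one (lift hφ) (lift hφ) := by
  rintro _ _ ⟨a, rfl, rfl⟩
  rw [lift_app]
  exact per_single _

theorem per_lift₂ {φ : M.N → M.N} (hφ : Representable φ) :
    Per (.nat ⇾ .one) (lift₂ hφ) (lift₂ hφ) := by
  rintro _ _ ⟨a, rfl, rfl⟩ _ _ ⟨b, rfl, rfl⟩
  rw [lift₂_app]
  exact per_single _

theorem per_K (ρ τ : Ty) : Per (ρ ⇾ τ ⇾ ρ) (K M) (K M) := by
  intro A A' hA B B' _
  rwa [K_app, K_app]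

theorem per_S (δ ρ τ : Ty) : Per ((δ ⇾ ρ ⇾ τ) ⇾ (δ ⇾ ρ) ⇾ δ ⇾ τ) (S M) (S M) := by
  intro A A' hA B B' hB C C' hC
  rw [S_app, S_app]
  exact hA _ _ hC _ _ (hB _ _ hC)

theorem per_R (σ : Ty) : Per (.nat ⇾ σ ⇾ (σ ⇾ .nat ⇾ σ) ⇾ σ) (R M) (R M) := by
  rintro _ _ ⟨n, rfl, rfl⟩ A A' hA B B' hB
  induction n using N.induction with
  | hP =>
    exact definable_per σ (.app (.app (.app .const (.single .var)) .const) .const)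
      (.app (.app (.app .const (.single .var)) .const) .const)
  | zero => rwa [R_zero, R_zero]
  | succ n ih =>
    rw [R_succ, R_succ]
    exact hB _ _ ih _ _ (per_single n)

end CSet

open CSet

variable (M) in
/-- The graph algebra as a structure in which all types have the same objects. -/
noncomputable def graph : Struct .omega where
  D _ := CSet M
  app := CSet.app
  zero := single 0
  succ := next M
  add := plus M
  mul := times M
  proj _ _ := K M
  comb _ _ _ := S M
  recursor _ _ := R M

variable (M) in
/-- The structure of the hereditarily extensional objects of the graph algebra. Two objects with the
same hereditarily extensional behaviour are not identified; this is harmless since all equations are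
between objects of type `0`. -/
noncomputable def extModel : Struct .omega where
  D σ := {A : CSet M // Per σ A A}
  app F A := ⟨F.1 ⋆ A.1, F.2 _ _ A.2⟩
  zero := ⟨single 0, per_single 0⟩
  succ := ⟨next M, per_lift _⟩
  add := ⟨plus M, per_lift₂ _⟩
  mul := ⟨times M, per_lift₂ _⟩
  proj ρ τ := ⟨K M, per_K ρ τ⟩
  comb δ ρ τ := ⟨S M, per_S δ ρ τ⟩
  recursor σ _ := ⟨R M, per_R σ⟩

/-- The assignment in the graph algebra that underlies an assignment of hereditarily extensional
objects. -/
def Env.raw {Γ : Ctx} (e : (extModel M).Env Γ) : (graph M).Env Γ := fun _ h x => (e h x).1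

theorem Env.raw_cons {Γ : Ctx} {σ : Ty} (a : (extModel M).D σ) (e : (extModel M).Env Γ) :
    raw (.cons a e) = .cons (M := graph M) a.1 (raw e) := by
  funext τ h x
  cases x <;> rfl

theorem eval_raw {Γ : Ctx} (e : (extModel M).Env Γ) {σ : Ty} (t : Term .omega Γ σ) :
    ((extModel M).eval e t).1 = (graph M).eval (Env.raw e) t := by
  induction t with
  | app s t ihs iht => exact congrArg₂ CSet.app ihs iht
  | _ => rfl

/-- Satisfaction in the graph algebra, with quantifiers restricted to hereditarily extensional
objects. -/
def SatExt : {Γ : Ctx} → (graph M).Env Γ → Formula .omega Γ → Prop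
  | _, e, .eq s t => (graph M).eval e s = (graph M).eval e t
  | _, _, .bot => False
  | _, e, .and A B => SatExt e A ∧ SatExt e B
  | _, e, .or A B => SatExt e A ∨ SatExt e B
  | _, e, .imp A B => SatExt e A → SatExt e B
  | _, e, .all σ _ A => ∀ a : CSet M, Per σ a a → SatExt (Env.cons (M := graph M) a e) A
  | _, e, .ex σ _ A => ∃ a : CSet M, Per σ a a ∧ SatExt (Env.cons (M := graph M) a e) A

theorem sat_iff_satExt {Γ : Ctx} (e : (extModel M).Env Γ) (A : Formula .omega Γ) :
    (extModel M).Sat e A ↔ SatExt (Env.raw e) A := by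
  induction A with
  | eq s t => exact Subtype.ext_iff.trans (by rw [eval_raw, eval_raw]; rfl)
  | bot => rfl
  | and A B ihA ihB => exact and_congr (ihA e) (ihB e)
  | or A B ihA ihB => exact or_congr (ihA e) (ihB e)
  | imp A B ihA ihB => exact imp_congr (ihA e) (ihB e)
  | all σ h A ih =>
    exact Subtype.forall.trans (forall₂_congr fun a ha =>
      (ih _).trans (iff_of_eq (congrArg (SatExt · A) (Env.raw_cons _ _))))
  | ex σ h A ih =>
    simp only [SatExt, ← exists_prop]
    exact Subtype.exists.trans (exists₂_congr fun a ha =>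
      (ih _).trans (iff_of_eq (congrArg (SatExt · A) (Env.raw_cons _ _))))

/-- The families of assignments in the graph algebra that are definable at each variable. -/
def EnvDefinable {Δ Γ : Ctx} (E : M.Env Δ → (graph M).Env Γ) : Prop :=
  ∀ ⦃σ : Ty⦄ (h : Fragment.omega.varTy σ) (x : Var Γ σ), SetDefinable fun e => E e h x

namespace EnvDefinable
variable {Δ Γ : Ctx} {σ : Ty} {E : M.Env Δ → (graph M).Env Γ}

theorem eval (hE : EnvDefinable E) (t : Term .omega Γ σ) :
    SetDefinable fun e => (graph M).eval (E e) t := by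
  induction t with
  | var h x => exact hE h x
  | app s t ihs iht => exact .app ihs iht
  | _ => exact .const

theorem cons (hE : EnvDefinable E) {S : M.Env Δ → CSet M} (hS : SetDefinable S) :
    EnvDefinable fun e => Env.cons (M := graph M) (ρ := σ) (S e) (E e) := by
  intro τ h x
  cases x with
  | zero => exact hS
  | succ x => exact hE h x

theorem weaken (hE : EnvDefinable E) :
    EnvDefinable fun e : M.Env (σ :: Δ) => E fun _ h x => e h (.succ x) :=
  fun _ h x => (hE h x).weaken

theorem satExt (hE : EnvDefinable E) (A : Formula .omega Γ) :
    Definable fun e => SatExt (E e) A := by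
  induction A generalizing Δ with
  | eq s t => exact .eqSet (hE.eval s) (hE.eval t)
  | bot => exact .bot
  | and A B ihA ihB => exact .and (ihA hE) (ihB hE)
  | or A B ihA ihB => exact .or (ihA hE) (ihB hE)
  | imp A B ihA ihB => exact .imp (ihA hE) (ihB hE)
  | all σ h A ih =>
    simp only [SatExt, ofIndex_surjective.forall]
    exact .all (h := Fragment.one_mem)
      (.imp (definable_per σ .index .index) (ih (hE.weaken.cons .index)))
  | ex σ h A ih =>
    simp only [SatExt, ofIndex_surjective.exists]
    exact .ex (h := Fragment.one_mem)
      (.and (definable_per σ .index .index) (ih (hE.weaken.cons .index)))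

end EnvDefinable

/-! ### The hereditarily extensional objects form a model -/

namespace extModel

/-- A number as an object of type `0`. -/
def num (n : M.N) : (extModel M).D .nat := ⟨single n, per_single n⟩

theorem num_surjective : Function.Surjective (num (M := M)) := by
  rintro ⟨A, n, h, -⟩
  exact ⟨n, Subtype.ext h.symm⟩

theorem num_inj {m n : M.N} : num m = num n ↔ m = n := Subtype.ext_iff.trans single_inj

theorem num_zero : num 0 = (extModel M).zero := rfl

theorem app_succ_num (n : M.N) : (extModel M).app (extModel M).succ (num n) = num (n + 1) :=
  Subtype.ext (next_app n)

theorem app_add_num (m n : M.N) :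
    (extModel M).app ((extModel M).app (extModel M).add (num m)) (num n) = num (m + n) :=
  Subtype.ext (plus_app m n)

theorem app_mul_num (m n : M.N) :
    (extModel M).app ((extModel M).app (extModel M).mul (num m)) (num n) = num (m * n) :=
  Subtype.ext (times_app m n)

variable {Γ : Ctx} (e : (extModel M).Env Γ)

theorem per_of_sat_eqAt {σ : Ty} (h : σ.ArgsIn .omega) (s t : Term .omega Γ σ)
    (hst : (extModel M).Sat e (.eqAt σ h s t)) :
    Per σ ((extModel M).eval e s).1 ((extModel M).eval e t).1 := by
  induction σ generalizing Γ with
  | nat => exact congrArg (Per .nat _ ·.1) hst ▸ ((extModel M).eval e s).2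
  | arr ρ τ _ ih =>
    intro A B hAB
    have := ih (.cons ⟨A, hAB.left⟩ e) h.2 _ _ (hst ⟨A, hAB.left⟩)
    simp only [Struct.eval, Term.shift, eval_rename] at this
    exact this.trans (((extModel M).eval e t).2 _ _ hAB)

variable {e}

theorem eval_apps_eq_of_per {σ : Ty} {s t : Term .omega Γ σ} (u : Spine .omega Γ σ)
    (h : Per σ ((extModel M).eval e s).1 ((extModel M).eval e t).1) :
    (extModel M).eval e (s.apps u) = (extModel M).eval e (t.apps u) := by
  induction u with
  | nil => exact Subtype.ext h.eq_of_nat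
  | cons a _ ih => exact ih (h _ _ ((extModel M).eval e a).2)

theorem eval_apps_eq {σ : Ty} {s t : Term .omega Γ σ} (u : Spine .omega Γ σ)
    (h : ((extModel M).eval e s).1 = ((extModel M).eval e t).1) :
    (extModel M).eval e (s.apps u) = (extModel M).eval e (t.apps u) :=
  eval_apps_eq_of_per u (h ▸ ((extModel M).eval e s).2)

variable (e)

theorem sat_induction (A : Formula .omega (.nat :: Γ))
    (zero : (extModel M).Sat (.cons (num 0) e) A)
    (succ : ∀ n, (extModel M).Sat (.cons (num n) e) A → (extModel M).Sat (.cons (num (n + 1)) e) A)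
    (n : M.N) : (extModel M).Sat (.cons (num n) e) A := by
  induction n using N.induction with
  | hP =>
    have hE : EnvDefinable fun _ : M.Env [.nat] => Env.raw e := fun _ _ _ => .const
    have raw_cons_num (n : M.N) : Env.raw (.cons (num n) e) =
        .cons (M := graph M) (single n) (Env.raw e) := Env.raw_cons _ _
    simpa only [DefinablePred, sat_iff_satExt, raw_cons_num] using
      (hE.cons (.single .var)).satExt A
  | zero => exact zero
  | succ n ih => exact succ n ih

theorem sat_of_eha {A : Formula .omega Γ} (h : EHA .omega Γ A) : (extModel M).Sat e A := by
  have hn (t : Term .omega Γ .nat) : ∃ n, num n = (extModel M).eval e t := num_surjective _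
  cases h with
  | eq_refl t => rfl
  | eq_symm s t => exact Eq.symm
  | eq_trans s t u => exact Eq.trans
  | succ_ne_zero t =>
    obtain ⟨n, hn⟩ := hn t
    simpa only [Sat, Struct.eval, ← hn, ← num_zero, app_succ_num, num_inj] using N.succ_ne_zero n
  | succ_inj s t =>
    obtain ⟨⟨m, hm⟩, n, hn⟩ := hn s, hn t
    simpa only [Sat, Struct.eval, ← hm, ← hn, app_succ_num, num_inj] using N.succ_inj
  | add_zero s =>
    obtain ⟨m, hm⟩ := hn s
    simp only [Sat, Struct.eval, ← hm, ← num_zero, app_add_num, _root_.add_zero]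
  | add_succ s t =>
    obtain ⟨⟨m, hm⟩, n, hn⟩ := hn s, hn t
    simp only [Sat, Struct.eval, ← hm, ← hn, app_succ_num, app_add_num, add_assoc]
  | mul_zero s =>
    obtain ⟨m, hm⟩ := hn s
    simp only [Sat, Struct.eval, ← hm, ← num_zero, app_mul_num, MulZeroClass.mul_zero]
  | mul_succ s t =>
    obtain ⟨⟨m, hm⟩, n, hn⟩ := hn s, hn t
    simp only [Sat, Struct.eval, ← hm, ← hn, app_succ_num, app_add_num, app_mul_num, mul_add_one]
  | ext h x y z u =>
    exact fun hxy =>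
      eval_apps_eq_of_per u (((extModel M).eval e z).2 _ _ (per_of_sat_eqAt e h x y hxy))
  | proj x y u => exact eval_apps_eq u (K_app _ _)
  | comb x y z u => exact eval_apps_eq u (S_app _ _ _)
  | rec_zero h y z u => exact eval_apps_eq u (R_zero _ _)
  | rec_succ h t y z u =>
    obtain ⟨n, hn⟩ := hn t
    refine eval_apps_eq u ?_
    simp only [Struct.eval, ← hn, app_succ_num]
    exact R_succ n _ _
  | induction A =>
    intro zero succ a
    obtain ⟨n, rfl⟩ := num_surjective a
    refine sat_induction e A ((sat_inst _ _ _).1 zero) (fun n ih => ?_) n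
    rw [← app_succ_num, ← sat_step]
    exact succ (num n) ih

end extModel

/-! ### Quantifier-free choice -/

/-- Hereditary extensional equality of assignments. -/
def Env.Per {Γ : Ctx} (e e' : (extModel M).Env Γ) : Prop :=
  ∀ ⦃σ : Ty⦄ (h : Fragment.omega.varTy σ) (x : Var Γ σ), CSet.Per σ (e h x).1 (e' h x).1

section
variable {Γ : Ctx} {ρ σ : Ty} {e e' : (extModel M).Env Γ}

theorem Env.Per.refl (e : (extModel M).Env Γ) : Env.Per e e := fun _ h x => (e h x).2

theorem Env.Per.cons {a a' : (extModel M).D σ} (he : Env.Per e e')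
    (ha : CSet.Per σ a.1 a'.1) : Env.Per (.cons a e) (.cons a' e') := by
  intro τ h x
  cases x with
  | zero => exact ha
  | succ x => exact he h x

theorem Env.Per.eval (he : Env.Per e e') (t : Term .omega Γ σ) :
    CSet.Per σ ((extModel M).eval e t).1 ((extModel M).eval e' t).1 := by
  induction t with
  | var h x => exact he h x
  | app _ _ ihs iht => exact ihs _ _ iht
  | _ => exact Subtype.prop (p := fun A => CSet.Per _ A A) _

theorem Env.Per.sat_iff (he : Env.Per e e') (A : Formula .omega Γ) :
    (extModel M).Sat e A ↔ (extModel M).Sat e' A := by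
  induction A with
  | eq s t =>
    have hs := Subtype.ext (he.eval s).eq_of_nat
    have ht := Subtype.ext (he.eval t).eq_of_nat
    rw [Sat, Sat, hs, ht]
  | bot => rfl
  | and A B ihA ihB => exact and_congr (ihA he) (ihB he)
  | or A B ihA ihB => exact or_congr (ihA he) (ihB he)
  | imp A B ihA ihB => exact imp_congr (ihA he) (ihB he)
  | all σ _ A ih => exact forall_congr' fun a => ih (he.cons a.2)
  | ex σ _ A ih => exact exists_congr fun a => ih (he.cons a.2)

end

/-- The binary operations on the graph algebra that are represented by an element. -/
def Realizable₂ (f : CSet M → CSet M → CSet M) : Prop := ∃ C : CSet M, ∀ A B, C ⋆ A ⋆ B = f A B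

namespace Realizable₂

theorem left : Realizable₂ fun A _ : CSet M => A := ⟨K M, K_app⟩

theorem right : Realizable₂ fun _ B : CSet M => B :=
  ⟨ofCL (.abs (.abs (.var 0))), fun A B => by simp only [ofCL, CL.eval_abs, CL.eval, CL.push]⟩

theorem const (C : CSet M) : Realizable₂ fun _ _ : CSet M => C :=
  ⟨ofCL (.abs (.abs (.const C))), fun A B => by simp only [ofCL, CL.eval_abs, CL.eval]⟩

theorem app {f g : CSet M → CSet M → CSet M} (hf : Realizable₂ f) (hg : Realizable₂ g) :
    Realizable₂ fun A B => f A B ⋆ g A B := by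
  obtain ⟨C, hC⟩ := hf
  obtain ⟨D, hD⟩ := hg
  refine ⟨ofCL (.abs (.abs (.app (.app (.app (.const C) (.var 1)) (.var 0))
    (.app (.app (.const D) (.var 1)) (.var 0))))), fun A B => ?_⟩
  simp only [ofCL, CL.eval_abs, CL.eval, CL.push, hC, hD]

theorem eval {Γ : Ctx} {ρ τ σ : Ty} (e : (graph M).Env Γ) (t : Term .omega (τ :: ρ :: Γ) σ) :
    Realizable₂ fun A B : CSet M =>
      (graph M).eval (.cons (M := graph M) B (.cons (M := graph M) A e)) t := by
  induction t with
  | var h x =>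
    match x with
    | .zero => exact .right
    | .succ .zero => exact .left
    | .succ (.succ x) => exact .const _
  | app s t ihs iht => exact ihs.app iht
  | _ => exact .const _

end Realizable₂

section
variable {ρ τ : Ty}

/-- The relations `P` between hereditarily extensional objects that have a characteristic function
in the graph algebra, with value `0` where `P` holds. -/
def HasCharacteristic (P : (extModel M).D ρ → (extModel M).D τ → Prop) : Prop :=
  ∃ C : CSet M, ∀ x y, ∃ v, C ⋆ x.1 ⋆ y.1 = single v ∧ (v = 0 ↔ P x y)

namespace HasCharacteristic
variable {P Q : (extModel M).D ρ → (extModel M).D τ → Prop}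

theorem of_realizable₂ {f g : CSet M → CSet M → CSet M} (hf : Realizable₂ f) (hg : Realizable₂ g)
    {φ : M.N → M.N} (hφ : Representable φ)
    (h : ∀ x y, ∃ a b, f x.1 y.1 = single a ∧ g x.1 y.1 = single b ∧ (φ (pair a b) = 0 ↔ P x y)) :
    HasCharacteristic P := by
  obtain ⟨C, hC⟩ := ((Realizable₂.const (lift₂ hφ)).app hf).app hg
  refine ⟨C, fun x y => ?_⟩
  obtain ⟨a, b, ha, hb, h⟩ := h x y
  exact ⟨φ (pair a b), by simp only [hC, ha, hb, lift₂_app], h⟩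

theorem combine (hP : HasCharacteristic P) (hQ : HasCharacteristic Q) {φ : M.N → M.N}
    (hφ : Representable φ) {r : Prop → Prop → Prop}
    (h : ∀ a b, φ (pair a b) = 0 ↔ r (a = 0) (b = 0)) :
    HasCharacteristic fun x y => r (P x y) (Q x y) := by
  obtain ⟨C, hC⟩ := hP
  obtain ⟨D, hD⟩ := hQ
  refine of_realizable₂ ⟨C, fun _ _ => rfl⟩ ⟨D, fun _ _ => rfl⟩ hφ fun x y => ?_
  obtain ⟨a, ha, haP⟩ := hC x y
  obtain ⟨b, hb, hbQ⟩ := hD x y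
  exact ⟨a, b, ha, hb, by rw [h, haP, hbQ]⟩

theorem and (hP : HasCharacteristic P) (hQ : HasCharacteristic Q) :
    HasCharacteristic fun x y => P x y ∧ Q x y :=
  hP.combine hQ (φ := fun p => fst p + snd p) (.add (.fst .id) (.snd .id)) fun a b => by
    rw [fst_pair, snd_pair, add_eq_zero]

theorem or (hP : HasCharacteristic P) (hQ : HasCharacteristic Q) :
    HasCharacteristic fun x y => P x y ∨ Q x y :=
  hP.combine hQ (φ := fun p => fst p * snd p) (.mul (.fst .id) (.snd .id)) fun a b => by
    rw [fst_pair, snd_pair, mul_eq_zero]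

theorem imp (hP : HasCharacteristic P) (hQ : HasCharacteristic Q) :
    HasCharacteristic fun x y => P x y → Q x y :=
  hP.combine hQ (φ := fun p => (1 - fst p) * snd p)
    (.mul (.sub (.const 1) (.fst .id)) (.snd .id)) (r := (· → ·)) fun a b => by
    rw [fst_pair, snd_pair, mul_eq_zero, tsub_eq_zero_iff_le]
    rcases N.eq_zero_or_succ a with rfl | ⟨a, rfl⟩
    · simp only [nonpos_iff_eq_zero, one_ne_zero, false_or, true_imp_iff]
    · exact iff_of_true (.inl le_add_self) fun h => absurd h (N.succ_ne_zero a)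

theorem eval_eq {Γ : Ctx} (e : (extModel M).Env Γ) (s t : Term .omega (τ :: ρ :: Γ) .nat) :
    HasCharacteristic fun (x : (extModel M).D ρ) (y : (extModel M).D τ) =>
      (extModel M).eval (.cons y (.cons x e)) s = (extModel M).eval (.cons y (.cons x e)) t := by
  refine of_realizable₂ (.eval (Env.raw e) s) (.eval (Env.raw e) t)
    (φ := fun p => (fst p - snd p) + (snd p - fst p))
    (.add (.sub (.fst .id) (.snd .id)) (.sub (.snd .id) (.fst .id))) fun x y => ?_
  obtain ⟨a, ha⟩ := extModel.num_surjective ((extModel M).eval (.cons y (.cons x e)) s)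
  obtain ⟨b, hb⟩ := extModel.num_surjective ((extModel M).eval (.cons y (.cons x e)) t)
  refine ⟨a, b, ?_, ?_, ?_⟩
  · rw [← Env.raw_cons, ← Env.raw_cons, ← eval_raw, ← ha, extModel.num]
  · rw [← Env.raw_cons, ← Env.raw_cons, ← eval_raw, ← hb, extModel.num]
  · rw [fst_pair, snd_pair, ← ha, ← hb, extModel.num_inj, add_eq_zero, tsub_eq_zero_iff_le,
      tsub_eq_zero_iff_le, le_antisymm_iff]

theorem sat {Γ : Ctx} (e : (extModel M).Env Γ) {A : Formula .omega (τ :: ρ :: Γ)} (hA : A.QF) :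
    HasCharacteristic fun (x : (extModel M).D ρ) (y : (extModel M).D τ) =>
      (extModel M).Sat (.cons y (.cons x e)) A :=
  match A, hA with
  | .eq s t, _ => .eval_eq e s t
  | .bot, _ => by
    obtain ⟨C, hC⟩ := Realizable₂.const (M := M) (single 1)
    exact ⟨C, fun x y => ⟨1, hC _ _, iff_of_false one_ne_zero id⟩⟩
  | .and _ _, hA => (sat e hA.1).and (sat e hA.2)
  | .or _ _, hA => (sat e hA.1).or (sat e hA.2)
  | .imp _ _, hA => (sat e hA.1).imp (sat e hA.2)

theorem exists_choice {P : (extModel M).D ρ → (extModel M).D .nat → Prop}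
    (hP : HasCharacteristic P) (congr : ∀ x x' y, Per ρ x.1 x'.1 → P x y → P x' y)
    (h : ∀ x, ∃ y, P x y) : ∃ Y : (extModel M).D (ρ ⇾ .nat), ∀ x, P x ((extModel M).app Y x) := by
  obtain ⟨C, hC⟩ := hP
  obtain ⟨U, hU⟩ := exists_minimization (M := M)
  have eq_zero_iff (x : (extModel M).D ρ) (n : M.N) :
      C ⋆ x.1 ⋆ single n = single 0 ↔ P x (extModel.num n) := by
    obtain ⟨v, hv, hvP⟩ := hC x (extModel.num n)
    rw [← hvP, ← single_inj, ← hv, extModel.num]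
  have exists_least (x : (extModel M).D ρ) : ∃ n,
      P x (extModel.num n) ∧ ∀ k < n, ¬ P x (extModel.num k) := by
    obtain ⟨y, hy⟩ := h x
    obtain ⟨n, rfl⟩ := extModel.num_surjective y
    simp only [← eq_zero_iff] at hy ⊢
    exact N.exists_least (.eqSet (.app .const (.single .var)) .const) hy
  let Y : CSet M := ofCL (.abs (.app (.const U) (.app (.const C) (.var 0))))
  have Y_app {x : (extModel M).D ρ} {n : M.N} (hn : P x (extModel.num n))
      (hlt : ∀ k < n, ¬ P x (extModel.num k)) : Y ⋆ x.1 = single n := by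
    simp only [Y, ofCL, CL.eval_abs, CL.eval, CL.push]
    refine hU (fun m => (hC x (extModel.num m)).imp fun _ h => h.1) ((eq_zero_iff x n).2 hn)
      fun k hk => mt (eq_zero_iff x k).1 (hlt k hk)
  have per_Y : Per (ρ ⇾ .nat) Y Y := by
    intro A A' hA
    obtain ⟨n, hn, hlt⟩ := exists_least ⟨A, hA.left⟩
    exact ⟨n, Y_app hn hlt, Y_app (x := ⟨A', hA.symm.left⟩) (congr _ _ _ hA hn)
      fun k hk => mt (congr _ _ _ hA.symm) (hlt k hk)⟩
  refine ⟨⟨Y, per_Y⟩, fun x => ?_⟩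
  obtain ⟨n, hn, hlt⟩ := exists_least x
  rwa [show (extModel M).app ⟨Y, per_Y⟩ x = extModel.num n from Subtype.ext (Y_app hn hlt)]

end HasCharacteristic

end

theorem extModel.sat_of_qfac {Γ : Ctx} {ρ : Ty} {A : Formula .omega Γ}
    (h : QFAC .omega ρ .nat Γ A) (e : (extModel M).Env Γ) : (extModel M).Sat e A := by
  obtain ⟨hρ, _, hY, A, hA⟩ := h
  intro h
  obtain ⟨Y, h⟩ := (HasCharacteristic.sat e hA).exists_choice
    (fun x x' y hx => ((Env.Per.refl e).cons hx |>.cons y.2 |>.sat_iff A).1) h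
  exact ⟨Y, fun x => (sat_choice hρ hY x Y e A).2 (h x)⟩

end Struct

/-- `RCA^ω` with the schemes `QF-AC^{ρ,0}` for all types `ρ` in place of `QF-AC^{1,0}`. -/
def RCAomegaAllTypes (Γ : Ctx) : Set (Formula Fragment.omega Γ) :=
  {A | EHA .omega Γ A ∨ (∃ ρ, QFAC .omega ρ .nat Γ A) ∨ LEM .omega Γ A}

theorem Struct.models_extModel (M : Struct .second) [IsModel RCA M] :
    (extModel M).Models RCAomegaAllTypes := by
  rintro Γ A (h | ⟨ρ, h⟩ | h) e
  · exact extModel.sat_of_eha e h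
  · exact extModel.sat_of_qfac h e
  · cases h
    exact Classical.em _

namespace Struct
variable {M : Struct .second} [hM : IsModel RCA M]

open CSet

/-! ### Transfer of second order sentences -/

/-- The logical relation between a model of `RCA` and its graph algebra. -/
def Rel : (σ : Ty) → M.D σ → CSet M → Prop
  | .nat, a, A => A = single a
  | .arr ρ τ, f, F => ∀ a A, Rel ρ a A → Rel τ (M.app f a) (F ⋆ A)

theorem rel_recursor {σ : Ty} (h : Fragment.second.recTy σ) : Rel _ (M.recursor σ h) (R M) := by
  obtain rfl : σ = .nat := h
  rintro n _ rfl y _ rfl z Z hz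
  change R M ⋆ single n ⋆ single y ⋆ Z = single (recN n y z)
  induction n using N.induction with
  | hP =>
    exact .eqSet (.app (.app (.app .const (.single .var)) .const) .const)
      (.single (.comp (.recN .id (.const y) (.const z)) .var))
  | zero => rw [R_zero, recN_zero]
  | succ n ih =>
    rw [R_succ, ih, recN_succ]
    exact hz _ _ rfl _ _ rfl

theorem rel_eval {Γ : Ctx} {e : M.Env Γ} {e' : (graph M).Env Γ}
    (he : ∀ ⦃σ : Ty⦄ (h : Fragment.second.varTy σ) (x : Var Γ σ), Rel σ (e h x) (e' trivial x))
    {σ : Ty} (t : Term .second Γ σ) : Rel σ (M.eval e t) ((graph M).eval e' t.toOmega) := by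
  induction t with
  | var h x => exact he h x
  | zero => rfl
  | succ =>
    rintro a _ rfl
    exact (next_app a).trans (congrArg single (N.app_succ a).symm)
  | add =>
    rintro a _ rfl b _ rfl
    exact plus_app a b
  | mul =>
    rintro a _ rfl b _ rfl
    exact times_app a b
  | proj ρ τ =>
    intro a A hA b B _
    change Rel ρ (M.app (M.app (M.proj ρ τ) a) b) (K M ⋆ A ⋆ B)
    rwa [hM.proj_eq, K_app]
  | comb δ ρ τ =>
    intro a A hA b B hB c C hC
    change Rel τ (M.app (M.app (M.app (M.comb δ ρ τ) a) b) c) (S M ⋆ A ⋆ B ⋆ C)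
    rw [hM.comb_eq, S_app]
    exact hA _ _ hC _ _ (hB _ _ hC)
  | recursor σ h => exact rel_recursor h
  | app _ _ ihs iht => exact ihs _ _ iht

theorem exists_rel_extModel {σ : Ty} (h : Fragment.second.varTy σ) (a : M.D σ) :
    ∃ b : (extModel M).D σ, Rel σ a b.1 := by
  rcases h with rfl | rfl
  · exact ⟨extModel.num a, rfl⟩
  · refine ⟨⟨lift (.of_object a), per_lift _⟩, ?_⟩
    rintro n _ rfl
    exact lift_app (.of_object a) n

theorem exists_app_eq {B : CSet M} (hB : ∀ n, ∃ m, B ⋆ single n = single m) :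
    ∃ f : M.D .one, ∀ n, B ⋆ single n = single (M.app f n) := by
  have ce : UniformlyCE fun n => B ⋆ single n :=
    .app (S := fun _ => B) (CE.comp B.2 (.snd .id)) (.single .id)
  obtain ⟨φ, hφ, h⟩ := ce
  have mem_iff (n m : M.N) : m ∈ B ⋆ single n ↔ ∃ k, φ (pair (pair n m) k) = 0 := by
    simpa only [fst_pair, snd_pair] using h (pair n m)
  obtain ⟨f, hf⟩ := exists_representable_choice
    (φ := fun q => φ (pair (pair (fst q) (fst (snd q))) (snd (snd q))))
    (.comp hφ (.pair (.pair (.fst .id) (.fst (.snd .id))) (.snd (.snd .id)))) fun n => by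
      obtain ⟨m, hm⟩ := hB n
      obtain ⟨k, hk⟩ := (mem_iff n m).1 (hm ▸ mem_single.2 rfl)
      exact ⟨pair m k, by simpa only [fst_pair, snd_pair] using hk⟩
  simp only [fst_pair, snd_pair] at hf
  obtain ⟨g, hg⟩ := Representable.fst (.of_object f)
  refine ⟨g, fun n => ?_⟩
  obtain ⟨m, hm⟩ := hB n
  have mem := (mem_iff n _).2 ⟨_, hf n⟩
  rw [hm, mem_single] at mem
  rw [hm, ← mem, hg]

theorem exists_rel_of_extModel {σ : Ty} (h : Fragment.second.varTy σ) (b : (extModel M).D σ) :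
    ∃ a : M.D σ, Rel σ a b.1 := by
  rcases h with rfl | rfl
  · obtain ⟨n, rfl⟩ := extModel.num_surjective b
    exact ⟨n, rfl⟩
  · obtain ⟨f, hf⟩ := exists_app_eq fun n => (b.2 _ _ (per_single n)).imp fun _ h => h.1
    refine ⟨f, ?_⟩
    rintro n _ rfl
    exact hf n

/-- The logical relation between assignments. -/
def EnvRel {Γ : Ctx} (e : M.Env Γ) (e' : (extModel M).Env Γ) : Prop :=
  ∀ ⦃σ : Ty⦄ (h : Fragment.second.varTy σ) (x : Var Γ σ), Rel σ (e h x) (e' trivial x).1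

theorem EnvRel.cons {Γ : Ctx} {σ : Ty} {e : M.Env Γ} {e' : (extModel M).Env Γ} {a : M.D σ}
    {b : (extModel M).D σ} (he : EnvRel e e') (hab : Rel σ a b.1) :
    EnvRel (.cons a e) (.cons b e') := by
  intro τ h x
  cases x with
  | zero => exact hab
  | succ x => exact he h x

theorem EnvRel.sat_iff {Γ : Ctx} {e : M.Env Γ} {e' : (extModel M).Env Γ} (he : EnvRel e e')
    (A : Formula .second Γ) : M.Sat e A ↔ (extModel M).Sat e' A.toOmega := by
  induction A with
  | eq s t =>
    have eval_eq (u : Term .second _ .nat) :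
        ((extModel M).eval e' u.toOmega).1 = single (M.eval e u) :=
      (eval_raw e' u.toOmega).trans (rel_eval (e' := Env.raw e') he u)
    refine Iff.trans ?_ Subtype.ext_iff.symm
    rw [eval_eq, eval_eq]
    exact single_inj.symm
  | bot => rfl
  | and A B ihA ihB => exact and_congr (ihA he) (ihB he)
  | or A B ihA ihB => exact or_congr (ihA he) (ihB he)
  | imp A B ihA ihB => exact imp_congr (ihA he) (ihB he)
  | all σ h A ih =>
    refine ⟨fun H b => ?_, fun H a => ?_⟩
    · obtain ⟨a, hab⟩ := exists_rel_of_extModel h b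
      exact (ih (he.cons hab)).1 (H a)
    · obtain ⟨b, hab⟩ := exists_rel_extModel h a
      exact (ih (he.cons hab)).2 (H b)
  | ex σ h A ih =>
    refine ⟨fun ⟨a, H⟩ => ?_, fun ⟨b, H⟩ => ?_⟩
    · obtain ⟨b, hab⟩ := exists_rel_extModel h a
      exact ⟨b, (ih (he.cons hab)).1 H⟩
    · obtain ⟨a, hab⟩ := exists_rel_of_extModel h b
      exact ⟨a, (ih (he.cons hab)).2 H⟩

theorem sat_toOmega_iff (M : Struct .second) [IsModel RCA M] (Φ : Sentence .second) :
    (extModel M).Sat .nil Φ.toOmega ↔ M.Sat .nil Φ :=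
  (EnvRel.sat_iff (e := .nil) (e' := .nil) (fun _ _ x => nomatch x) Φ).symm

end Struct

end FiniteType

theorem mainTheorem6_general (Φ : FiniteType.Sentence FiniteType.Fragment.second)
    (hΦ : FiniteType.Provable FiniteType.RCAomegaAllTypes Φ.toOmega) :
    FiniteType.Provable FiniteType.RCA Φ := by
  by_contra not_provable
  obtain ⟨M, hM, not_sat⟩ := FiniteType.exists_countermodel not_provable
  exact not_sat ((M.sat_toOmega_iff Φ).1 (M.models_extModel.sat_of_provable hΦ .nil))

theorem mainTheorem6 (Φ : FiniteType.Sentence FiniteType.Fragment.second)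
    (hΦ : FiniteType.Provable FiniteType.RCAomega Φ.toOmega) :
    FiniteType.Provable FiniteType.RCA Φ :=
  mainTheorem6_general Φ
    (hΦ.mono (fun _ _ h => h.imp_right (Or.imp_left fun h => ⟨_, h⟩)) (List.Subset.refl _))
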